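/- Let $n,m\ge 1$. There is a constant $C>0$, depending only on $n$ and $m$, such that the following holds. Let $\Omega\subset\mathbb{R}^n$ be a bounded domain, let $Q:\Omega\to\mathbb{R}$ be Lebesgue measurable with $Q_{min}\le Q\le Q_{max}$ a.e. in $\Omega$ for constants $Q_{max}\ge Q_{min}>0$, and let $\mathbf{g}\in H^1(\Omega;\mathbb{R}^m)$ with $g_i\ge 0$ a.e. in $\Omega$ for $i=1,\dots,m$. Let $$\mathcal{A}=\{\mathbf{v}\in H^1(\Omega;\mathbb{R}^m) : \mathbf{v}-\mathbf{g}\in H^1_0(\Omega;\mathbb{R}^m),\ v_i\ge 0 \text{ a.e. in } \Omega \text{ for } i=1,\dots,m\},$$ $$J(\mathbf{v})=\int_\Omega\bigl(|\nabla\mathbf{v}|^2+Q^2\chi_{\{|\mathbf{v}|>0\}}\bigr)\,dx,\qquad |\nabla \mathbf{v}|^2=\sum_{i=1}^m|\nabla v_i|^2,$$ $$d(\mathbf{u},\mathbf{v})=\|\mathbf{u}-\mathbf{v}\|_{H^1(\Omega;\mathbb{R}^m)}+\|\chi_{\{|\mathbf{u}|>0\}}-\chi_{\{|\mathbf{v}|>0\}}\|_{L^1(\Omega)}.$$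 A function $\mathbf{u}\in\mathcal{A}$ is an absolute minimizer if $J(\mathbf{u})\le J(\mathbf{v})$ for all $\mathbf{v}\in\mathcal{A}$, and a local minimizer if there is $\epsilon>0$ such that $J(\mathbf{u})\le J(\mathbf{v})$ for all $\mathbf{v}\in\mathcal{A}$ with $d(\mathbf{u},\mathbf{v})<\epsilon$. If $\mathbf{u}$ is an absolute or a local minimizer, then the limit $\lim_{\rho\to0^+}\frac{1}{|B_\rho(x)|}\int_{B_\rho(x)}\mathbf{u}\,dy$ exists for every $x\in\Omega$ and equals $\mathbf{u}(x)$ for a.e. $x\in\Omega$; below, $\mathbf{u}(x)$ denotes this limit for every $x\in\Omega$. Moreover: 1. If $\mathbf{u}$ is an absolute minimizer, then for every ball $B_r(x)\subset\Omega$ with $\mathbf{u}(x)=0$, $$[\mathbf{u}]_{C^{0,1}(B_{r/3}(x))}:=\sup_{y,z\in B_{r/3}(x),\,y\neq z}\frac{|\mathbf{u}(y)-\mathbf{u}(z)|}{|y-z|}\le C\,Q_{max}.$$ 2. If $\mathbf{u}$ is a local minimizer, then there is $r_0>0$ (which may depend on $\Omega$, $Q$, $\mathbf{g}$ and $\mathbf{u}$)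 such that the same estimate holds, with the same $C$, for every ball $B_r(x)\subset\Omega$ with $r\le r_0$ and $\mathbf{u}(x)=0$. -/

import Mathlib

open MeasureTheory Set Filter
open scoped Topology ENNReal ContDiff

noncomputable section

namespace BernoulliSystem

/-- The Euclidean space `ℝ^n`. -/
abbrev E (n : ℕ) : Type := EuclideanSpace ℝ (Fin n)

variable {n m : ℕ}

/-- `φ ∈ C_c^∞(Ω)`. -/
def IsTestFunction (Ω : Set (E n)) (φ : E n → ℝ) : Prop :=
  ContDiff ℝ ∞ φ ∧ HasCompactSupport φ ∧ tsupport φ ⊆ Ω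

/-- `G` is a distributional (weak) gradient of the scalar function `f` in `Ω`. -/
def IsWeakGradient (Ω : Set (E n)) (f : E n → ℝ) (G : E n → E n) : Prop :=
  LocallyIntegrableOn f Ω ∧ LocallyIntegrableOn G Ω ∧
    ∀ φ : E n → ℝ, IsTestFunction Ω φ →
      ∫ x in Ω, f x • gradient φ x = -∫ x in Ω, φ x • G x

/-- On an open set the weak gradient is unique up to null sets. -/
theorem IsWeakGradient.ae_eq {Ω : Set (E n)} (hΩ : IsOpen Ω) {f : E n → ℝ} {G H : E n → E n}
    (hG : IsWeakGradient Ω f G) (hH : IsWeakGradient Ω f H) :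
    G =ᵐ[volume.restrict Ω] H := by
  have key : ∀ᵐ x ∂(volume : Measure (E n)), x ∈ Ω → (G - H) x = 0 := by
    refine hΩ.ae_eq_zero_of_integral_contDiff_smul_eq_zero (hG.2.1.sub hH.2.1) ?_
    intro φ hφ hc hs
    have int : ∀ K : E n → E n, LocallyIntegrableOn K Ω →
        Integrable (fun x => φ x • K x) volume := by
      intro K hK
      have h1 : IntegrableOn K (tsupport φ) volume :=
        hK.integrableOn_compact_subset hs hc
      have h2 : IntegrableOn (fun x => φ x • K x) (tsupport φ) volume :=
        h1.continuousOn_smul hφ.continuous.continuousOn hc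
      refine (integrableOn_iff_integrable_of_support_subset ?_).1 h2
      intro x hx
      refine subset_tsupport φ ?_
      intro h0
      exact hx (by simp [h0])
    have hset : ∀ K : E n → E n, ∫ x in Ω, φ x • K x = ∫ x, φ x • K x := by
      intro K
      refine setIntegral_eq_integral_of_forall_compl_eq_zero ?_
      intro x hx
      have : φ x = 0 := image_eq_zero_of_notMem_tsupport (fun h => hx (hs h))
      simp [this]
    have e1 := hG.2.2 φ ⟨hφ, hc, hs⟩
    have e2 := hH.2.2 φ ⟨hφ, hc, hs⟩
    rw [hset] at e1 e2
    have e3 : ∫ x, φ x • G x = ∫ x, φ x • H x := neg_injective (e1.symm.trans e2)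
    simp only [Pi.sub_apply, smul_sub]
    rw [integral_sub (int G hG.2.1) (int H hH.2.1), e3, sub_self]
  rw [Filter.EventuallyEq, ae_restrict_iff' hΩ.measurableSet]
  filter_upwards [key] with x hx hxΩ
  exact sub_eq_zero.1 (hx hxΩ)

open Classical in
/-- The weak gradient `∇f` of `f` in `Ω` (a chosen version; it is `0` if there is none). -/
def weakGradient (Ω : Set (E n)) (f : E n → ℝ) : E n → E n :=
  if h : ∃ G, IsWeakGradient Ω f G then h.choose else 0

/-- `f ∈ H¹(Ω)`. -/
def MemH1 (Ω : Set (E n)) (f : E n → ℝ) : Prop :=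
  MemLp f 2 (volume.restrict Ω) ∧
    ∃ G, IsWeakGradient Ω f G ∧ MemLp G 2 (volume.restrict Ω)

/-- `‖f‖_{H¹(Ω)}²`, for `f ∈ H¹(Ω)`. -/
def h1NormSq (Ω : Set (E n)) (f : E n → ℝ) : ℝ :=
  ∫ x in Ω, (f x ^ 2 + ‖weakGradient Ω f x‖ ^ 2)

/-- `f ∈ H¹₀(Ω)`, the closure of `C_c^∞(Ω)` in `H¹(Ω)`. -/
def MemH10 (Ω : Set (E n)) (f : E n → ℝ) : Prop :=
  MemH1 Ω f ∧ ∀ ε : ℝ, 0 < ε → ∃ φ : E n → ℝ, IsTestFunction Ω φ ∧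
    Real.sqrt (h1NormSq Ω (fun x => f x - φ x)) < ε

/-- `u ∈ H¹(Ω; ℝ^m)`. -/
def MemH1Vec (Ω : Set (E n)) (u : E n → E m) : Prop :=
  ∀ i : Fin m, MemH1 Ω (fun x => u x i)

/-- `‖u‖_{H¹(Ω; ℝ^m)}`, for `u ∈ H¹(Ω; ℝ^m)`. -/
def h1Norm (Ω : Set (E n)) (u : E n → E m) : ℝ :=
  Real.sqrt (∑ i : Fin m, h1NormSq Ω (fun x => u x i))

/-- The characteristic function of `{|u| > 0}`. -/
def posChar (u : E n → E m) : E n → ℝ :=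
  Set.indicator {x | 0 < ‖u x‖} (fun _ => 1)

/-- `J(u) = ∫_Ω (|∇u|² + Q² χ_{|u| > 0})`, where `|∇u|² = |∇u₁|² + ⋯ + |∇u_m|²`. -/
def J (Ω : Set (E n)) (Q : E n → ℝ) (u : E n → E m) : ℝ :=
  ∫ x in Ω, ((∑ i : Fin m, ‖weakGradient Ω (fun y => u y i) x‖ ^ 2) + Q x ^ 2 * posChar u x)

/-- The distance `d(u, v) = ‖u - v‖_{H¹} + ‖χ_{|u| > 0} - χ_{|v| > 0}‖_{L¹}`. -/
def d (Ω : Set (E n)) (u v : E n → E m) : ℝ :=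
  h1Norm Ω (fun x => u x - v x) + ∫ x in Ω, |posChar u x - posChar v x|

/-- The admissible class: `v ∈ H¹(Ω; ℝ^m)`, `v = g` on `∂Ω` (that is, `v - g ∈ H¹₀`), and
`v_i ≥ 0` a.e. in `Ω`. -/
def Admissible (Ω : Set (E n)) (g v : E n → E m) : Prop :=
  MemH1Vec Ω v ∧ (∀ i : Fin m, MemH10 Ω (fun x => v x i - g x i)) ∧
    ∀ i : Fin m, ∀ᵐ x ∂volume.restrict Ω, 0 ≤ v x i

/-- Absolute minimizers of `J` with boundary data `g`. -/
def IsAbsoluteMinimizer (Ω : Set (E n)) (Q : E n → ℝ) (g u : E n → E m) : Prop :=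
  Admissible Ω g u ∧ ∀ v : E n → E m, Admissible Ω g v → J Ω Q u ≤ J Ω Q v

/-- Local minimizers of `J` with boundary data `g`. -/
def IsLocalMinimizer (Ω : Set (E n)) (Q : E n → ℝ) (g u : E n → E m) : Prop :=
  Admissible Ω g u ∧ ∃ ε : ℝ, 0 < ε ∧
    ∀ v : E n → E m, Admissible Ω g v → d Ω u v < ε → J Ω Q u ≤ J Ω Q v

/-- `w` is the version of `u` that is given at every point `x` of `Ω` by the limit of the means
of `u` over the balls `B_ρ(x)` as `ρ → 0`. -/
def IsPreciseVersion (Ω : Set (E n)) (u w : E n → E m) : Prop :=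
  w =ᵐ[volume.restrict Ω] u ∧
    ∀ x ∈ Ω, Tendsto (fun ρ : ℝ => ⨍ y in Metric.ball x ρ, u y) (𝓝[>] 0) (𝓝 (w x))

/-- The seminorm `[w]_{C^{0,1}(S)} = sup |w y - w z| / |y - z|` over `y ≠ z` in `S`, with values
in `[0, ∞]` (in `ℝ≥0∞` one has `0 / 0 = 0`, so that the pairs `y = z` do not contribute). -/
def lipSeminorm (w : E n → E m) (S : Set (E n)) : ℝ≥0∞ :=
  ⨆ y ∈ S, ⨆ z ∈ S, edist (w y) (w z) / edist y z

end BernoulliSystem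

end

/-!
Consider the means of a component `u_i` over `B_r(x)` with respect to the radial weight
`η((z - x) / r)`, where `∇ζ(y) = -η(y) y` for a radial bump function `ζ`, so that the derivative of
the mean in `r` is a multiple of `-∫ ⟨∇u_i, ∇ζ_r⟩`, with `ζ_r(z) = ζ((z - x) / r)`.

The components of a minimizer are weakly subharmonic: their means increase in `r` and decrease to
the precise value of `u_i` at `x`. Comparing `u` with the competitor obtained by adding
`Qmax r ζ_r` to `u_i` bounds the derivative of the mean by a dimensional constant times `Qmax`.
In particular the precise version is at most `C Qmax dist(y, {u = 0})` near a point of `{u = 0}`.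
Away from `{u = 0}` the components are harmonic, so the means do not depend on `r` and `u` inherits
the smoothness of the weight at the scale of the distance to `{u = 0}`. For two points closer to
each other than to `{u = 0}` this gives the Lipschitz estimate; for the other pairs the linear
growth from `{u = 0}` does.
-/

open MeasureTheory Set Filter
open scoped Topology ENNReal ContDiff

noncomputable section

namespace BernoulliSystem

variable {n m : ℕ}

section Gradient

variable {H : Type*} [NormedAddCommGroup H] [InnerProductSpace ℝ H] [CompleteSpace H]

theorem gradient_mul {f g : H → ℝ} {x : H} (hf : DifferentiableAt ℝ f x)
    (hg : DifferentiableAt ℝ g x) :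
    gradient (fun y => f y * g y) x = f x • gradient g x + g x • gradient f x := by
  simp only [gradient, fderiv_fun_mul hf hg, map_add, map_smulₛₗ, conj_trivial]

theorem gradient_comp {f : H → ℝ} {Γ : ℝ → ℝ} {Γ' : ℝ} {x : H} (hf : DifferentiableAt ℝ f x)
    (hΓ : HasDerivAt Γ Γ' (f x)) :
    gradient (fun y => Γ (f y)) x = Γ' • gradient f x := by
  have hfderiv : fderiv ℝ (fun y => Γ (f y)) x = Γ' • fderiv ℝ f x :=
    (hΓ.comp_hasFDerivAt x hf.hasFDerivAt).fderiv
  simp only [gradient, hfderiv, map_smulₛₗ, conj_trivial]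

theorem gradient_comp_sub_left {f : H → ℝ} {x y : H} (hf : DifferentiableAt ℝ f (x - y)) :
    gradient (fun z => f (x - z)) y = -gradient f (x - y) := by
  have h : HasFDerivAt (fun z => f (x - z)) (-fderiv ℝ f (x - y)) y := by
    simpa using! hf.hasFDerivAt.comp y ((hasFDerivAt_id y).const_sub x)
  simp only [gradient, h.fderiv, map_neg]

theorem continuous_gradient {f : H → ℝ} (hf : ContDiff ℝ 1 f) : Continuous (gradient f) :=
  (InnerProductSpace.toDual ℝ H).symm.continuous.comp (hf.continuous_fderiv one_ne_zero)

theorem tsupport_gradient_subset (f : H → ℝ) : tsupport (gradient f) ⊆ tsupport f := by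
  refine closure_minimal (fun x hx => ?_) (isClosed_tsupport f)
  refine tsupport_fderiv_subset ℝ (subset_tsupport _ fun hzero => hx ?_)
  simp only [gradient, hzero, map_zero]

end Gradient

section CompactSupport

variable {X V : Type*} [TopologicalSpace X] [T2Space X] [MeasurableSpace X]
  [OpensMeasurableSpace X] {μ : Measure X} [NormedAddCommGroup V] [NormedSpace ℝ V] {s : Set X}

theorem integrable_continuous_smul_of_tsupport_subset {φ : X → ℝ} {K : X → V} (hφ : Continuous φ)
    (hc : HasCompactSupport φ) (hs : tsupport φ ⊆ s) (hK : LocallyIntegrableOn K s μ) :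
    Integrable (fun x => φ x • K x) μ := by
  have hon : IntegrableOn (fun x => φ x • K x) (tsupport φ) μ :=
    (hK.integrableOn_compact_subset hs hc).continuousOn_smul hφ.continuousOn hc
  exact (integrableOn_iff_integrable_of_support_subset
    ((Function.support_smul_subset_left φ K).trans (subset_tsupport φ))).1 hon

theorem integrable_smul_continuous_of_tsupport_subset [SecondCountableTopologyEither X V]
    {f : X → ℝ} {K : X → V} (hK : Continuous K) (hc : HasCompactSupport K)
    (hs : tsupport K ⊆ s) (hf : LocallyIntegrableOn f s μ) :
    Integrable (fun x => f x • K x) μ := by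
  have hon : IntegrableOn (fun x => f x • K x) (tsupport K) μ :=
    (hf.integrableOn_compact_subset hs hc).smul_continuousOn hK.continuousOn hc
  exact (integrableOn_iff_integrable_of_support_subset
    ((Function.support_smul_subset_right f K).trans (subset_tsupport K))).1 hon

end CompactSupport

section TestFunction

variable {Ω U : Set (E n)} {φ ψ : E n → ℝ}

theorem IsTestFunction.contDiff_one (h : IsTestFunction Ω φ) : ContDiff ℝ 1 φ :=
  h.1.of_le (by simp)

theorem IsTestFunction.differentiable (h : IsTestFunction Ω φ) : Differentiable ℝ φ :=
  h.1.differentiable (by simp)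

theorem IsTestFunction.eq_zero (h : IsTestFunction Ω φ) {x : E n} (hx : x ∉ Ω) : φ x = 0 :=
  image_eq_zero_of_notMem_tsupport fun hx' => hx (h.2.2 hx')

theorem IsTestFunction.tsupport_gradient_subset (h : IsTestFunction Ω φ) :
    tsupport (gradient φ) ⊆ Ω :=
  (BernoulliSystem.tsupport_gradient_subset φ).trans h.2.2

theorem IsTestFunction.gradient_eq_zero (h : IsTestFunction Ω φ) {x : E n} (hx : x ∉ Ω) :
    gradient φ x = 0 :=
  image_eq_zero_of_notMem_tsupport fun hx' => hx (h.tsupport_gradient_subset hx')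

theorem IsTestFunction.hasCompactSupport_gradient (h : IsTestFunction Ω φ) :
    HasCompactSupport (gradient φ) :=
  h.2.1.of_isClosed_subset (isClosed_tsupport _) (BernoulliSystem.tsupport_gradient_subset φ)

theorem IsTestFunction.mul (h : IsTestFunction Ω φ) (hψ : ContDiff ℝ ∞ ψ) :
    IsTestFunction Ω (fun x => φ x * ψ x) :=
  ⟨h.1.mul hψ, h.2.1.mul_right,
    (closure_mono (Function.support_mul_subset_left φ ψ)).trans h.2.2⟩

theorem IsTestFunction.const_mul (h : IsTestFunction Ω φ) (c : ℝ) :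
    IsTestFunction Ω (fun x => c * φ x) := by
  simpa only [mul_comm] using h.mul (contDiff_const (c := c))

theorem IsTestFunction.add (h : IsTestFunction Ω φ) (hψ : IsTestFunction Ω ψ) :
    IsTestFunction Ω (fun x => φ x + ψ x) :=
  ⟨h.1.add hψ.1, h.2.1.add hψ.2.1, (tsupport_add φ ψ).trans (union_subset h.2.2 hψ.2.2)⟩

theorem IsTestFunction.mono (h : IsTestFunction Ω φ) (hU : Ω ⊆ U) : IsTestFunction U φ :=
  ⟨h.1, h.2.1, h.2.2.trans hU⟩

theorem IsTestFunction.exists_abs_le (h : IsTestFunction Ω φ) : ∃ C, ∀ x, |φ x| ≤ C :=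
  h.2.1.exists_bound_of_continuous h.1.continuous

theorem IsTestFunction.memLp (h : IsTestFunction Ω φ) (p : ℝ≥0∞) (μ : Measure (E n))
    [IsFiniteMeasureOnCompacts μ] : MemLp φ p μ :=
  h.1.continuous.memLp_of_hasCompactSupport h.2.1

theorem IsTestFunction.memLp_gradient (h : IsTestFunction Ω φ) (p : ℝ≥0∞) (μ : Measure (E n))
    [IsFiniteMeasureOnCompacts μ] : MemLp (gradient φ) p μ :=
  (continuous_gradient h.contDiff_one).memLp_of_hasCompactSupport h.hasCompactSupport_gradient

variable {V : Type*} [NormedAddCommGroup V] [NormedSpace ℝ V]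

theorem IsTestFunction.integrable_smul (h : IsTestFunction Ω φ) {K : E n → V}
    (hK : LocallyIntegrableOn K Ω) : Integrable (fun x => φ x • K x) :=
  integrable_continuous_smul_of_tsupport_subset h.1.continuous h.2.1 h.2.2 hK

theorem IsTestFunction.integrable_smul_gradient (h : IsTestFunction Ω φ) {f : E n → ℝ}
    (hf : LocallyIntegrableOn f Ω) : Integrable (fun x => f x • gradient φ x) :=
  integrable_smul_continuous_of_tsupport_subset (continuous_gradient h.contDiff_one)
    h.hasCompactSupport_gradient h.tsupport_gradient_subset hf

theorem IsTestFunction.setIntegral_smul (h : IsTestFunction Ω φ) (K : E n → V) :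
    ∫ x in Ω, φ x • K x = ∫ x, φ x • K x :=
  setIntegral_eq_integral_of_forall_compl_eq_zero fun x hx => by rw [h.eq_zero hx, zero_smul]

theorem IsTestFunction.setIntegral_smul_gradient (h : IsTestFunction Ω φ) (f : E n → ℝ) :
    ∫ x in Ω, f x • gradient φ x = ∫ x, f x • gradient φ x :=
  setIntegral_eq_integral_of_forall_compl_eq_zero fun x hx => by
    rw [h.gradient_eq_zero hx, smul_zero]

end TestFunction

section WeakGradient

variable {Ω U : Set (E n)} {f g : E n → ℝ} {F G : E n → E n}

theorem IsWeakGradient.integral_eq (h : IsWeakGradient Ω f F) {φ : E n → ℝ}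
    (hφ : IsTestFunction Ω φ) : ∫ x, f x • gradient φ x = -∫ x, φ x • F x := by
  rw [← hφ.setIntegral_smul_gradient, ← hφ.setIntegral_smul]
  exact h.2.2 φ hφ

theorem isWeakGradient_of_integral (hf : LocallyIntegrableOn f Ω) (hF : LocallyIntegrableOn F Ω)
    (h : ∀ φ, IsTestFunction Ω φ → ∫ x, f x • gradient φ x = -∫ x, φ x • F x) :
    IsWeakGradient Ω f F := by
  refine ⟨hf, hF, fun φ hφ => ?_⟩
  rw [hφ.setIntegral_smul_gradient, hφ.setIntegral_smul]
  exact h φ hφ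

theorem IsWeakGradient.mono (hf : IsWeakGradient Ω f F) (hU : U ⊆ Ω) : IsWeakGradient U f F :=
  isWeakGradient_of_integral (hf.1.mono_set hU) (hf.2.1.mono_set hU)
    fun _ hφ => hf.integral_eq (hφ.mono hU)

theorem IsWeakGradient.add (hf : IsWeakGradient Ω f F) (hg : IsWeakGradient Ω g G) :
    IsWeakGradient Ω (fun x => f x + g x) (fun x => F x + G x) := by
  refine isWeakGradient_of_integral (hf.1.add hg.1) (hf.2.1.add hg.2.1) fun φ hφ => ?_
  simp only [add_smul, smul_add]
  rw [integral_add (hφ.integrable_smul_gradient hf.1) (hφ.integrable_smul_gradient hg.1),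
    integral_add (hφ.integrable_smul hf.2.1) (hφ.integrable_smul hg.2.1), hf.integral_eq hφ,
    hg.integral_eq hφ, neg_add]

theorem IsWeakGradient.const_mul (hf : IsWeakGradient Ω f F) (c : ℝ) :
    IsWeakGradient Ω (fun x => c * f x) (fun x => c • F x) := by
  refine isWeakGradient_of_integral (hf.1.smul c) (hf.2.1.smul c) fun φ hφ => ?_
  simp only [mul_smul, smul_comm (φ _) c, integral_smul, hf.integral_eq hφ, smul_neg]

theorem IsWeakGradient.sub (hf : IsWeakGradient Ω f F) (hg : IsWeakGradient Ω g G) :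
    IsWeakGradient Ω (fun x => f x - g x) (fun x => F x - G x) := by
  simpa [sub_eq_add_neg] using hf.add (hg.const_mul (-1))

theorem integral_smul_gradient_of_contDiff {ψ φ : E n → ℝ} (hψ : ContDiff ℝ 1 ψ)
    (hφ : IsTestFunction univ φ) :
    ∫ x, ψ x • gradient φ x = -∫ x, φ x • gradient ψ x := by
  have hinteg : Integrable (fun x => φ x • ψ x) :=
    hφ.integrable_smul (hψ.continuous.locallyIntegrable.locallyIntegrableOn _)
  have hintegφ : Integrable (fun x => ψ x • gradient φ x) :=
    hφ.integrable_smul_gradient (hψ.continuous.locallyIntegrable.locallyIntegrableOn _)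
  have hintegψ : Integrable (fun x => φ x • gradient ψ x) :=
    hφ.integrable_smul ((continuous_gradient hψ).locallyIntegrable.locallyIntegrableOn _)
  refine ext_inner_right ℝ fun v => ?_
  have hv : ∫ x, ψ x * fderiv ℝ φ x v = -∫ x, fderiv ℝ ψ x v * φ x := by
    refine integral_mul_fderiv_eq_neg_fderiv_mul_of_integrable ?_ ?_ ?_
      (fun x _ => hψ.differentiable one_ne_zero x) (fun x _ => hφ.differentiable x)
    · simpa [real_inner_smul_right, inner_gradient_right, mul_comm] using
        hintegψ.const_inner (𝕜 := ℝ) v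
    · simpa [real_inner_smul_right, inner_gradient_right] using hintegφ.const_inner (𝕜 := ℝ) v
    · simpa [mul_comm] using hinteg
  rw [inner_neg_left, real_inner_comm, ← integral_inner hintegφ, real_inner_comm,
    ← integral_inner hintegψ]
  simp only [real_inner_smul_right, inner_gradient_right, conj_trivial, hv,
    mul_comm (fderiv ℝ ψ _ v)]

theorem isWeakGradient_of_contDiff {ψ : E n → ℝ} (hψ : ContDiff ℝ 1 ψ) :
    IsWeakGradient Ω ψ (gradient ψ) :=
  isWeakGradient_of_integral (hψ.continuous.locallyIntegrable.locallyIntegrableOn _)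
    ((continuous_gradient hψ).locallyIntegrable.locallyIntegrableOn _)
    fun _ hφ => integral_smul_gradient_of_contDiff hψ (hφ.mono (subset_univ _))

theorem isWeakGradient_weakGradient (hf : IsWeakGradient Ω f F) :
    IsWeakGradient Ω f (weakGradient Ω f) := by
  have h : ∃ G, IsWeakGradient Ω f G := ⟨F, hf⟩
  rw [weakGradient, dif_pos h]
  exact h.choose_spec

theorem IsWeakGradient.weakGradient_ae_eq (hΩ : IsOpen Ω) (hf : IsWeakGradient Ω f F) :
    weakGradient Ω f =ᵐ[volume.restrict Ω] F :=
  (isWeakGradient_weakGradient hf).ae_eq hΩ hf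

theorem MemH1.isWeakGradient (hf : MemH1 Ω f) : IsWeakGradient Ω f (weakGradient Ω f) := by
  obtain ⟨_, G, hG, _⟩ := hf
  exact isWeakGradient_weakGradient hG

theorem MemH1.memLp_weakGradient (hΩ : IsOpen Ω) (hf : MemH1 Ω f) :
    MemLp (weakGradient Ω f) 2 (volume.restrict Ω) := by
  obtain ⟨_, G, hG, hG2⟩ := hf
  exact hG2.ae_eq (hG.weakGradient_ae_eq hΩ).symm

theorem IsWeakGradient.h1NormSq_eq (hΩ : IsOpen Ω) (hf : IsWeakGradient Ω f F) :
    h1NormSq Ω f = ∫ x in Ω, (f x ^ 2 + ‖F x‖ ^ 2) := by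
  refine integral_congr_ae ?_
  filter_upwards [hf.weakGradient_ae_eq hΩ] with x hx
  rw [hx]

end WeakGradient

section Lp

variable {X V : Type*} [MeasurableSpace X] {μ : Measure X} [NormedAddCommGroup V]

theorem eLpNorm_rpow_toReal {p : ℝ≥0∞} (hp0 : p ≠ 0) (hp : p ≠ ⊤) (F : X → V) :
    eLpNorm F p μ ^ p.toReal = ∫⁻ x, ‖F x‖ₑ ^ p.toReal ∂μ := by
  rw [eLpNorm_eq_lintegral_rpow_enorm_toReal hp0 hp, one_div,
    ENNReal.rpow_inv_rpow (ENNReal.toReal_pos hp0 hp).ne']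

theorem integral_norm_sq_le_of_eLpNorm_le {F : X → V} (hF : AEStronglyMeasurable F μ) {ε : ℝ}
    (hε : 0 ≤ ε) (h : eLpNorm F 2 μ ≤ ENNReal.ofReal ε) : ∫ x, ‖F x‖ ^ 2 ∂μ ≤ ε ^ 2 := by
  have hpow : eLpNorm F 2 μ ^ 2 = ∫⁻ x, ‖F x‖ₑ ^ 2 ∂μ := by
    simpa using eLpNorm_rpow_toReal two_ne_zero ENNReal.ofNat_ne_top F
  rw [integral_eq_lintegral_of_nonneg_ae (.of_forall fun x => sq_nonneg _) (hF.norm.pow 2)]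
  refine ENNReal.toReal_le_of_le_ofReal (sq_nonneg ε) ?_
  simp only [ENNReal.ofReal_pow (norm_nonneg _), ofReal_norm, ENNReal.ofReal_pow hε, ← hpow]
  gcongr

theorem integrable_norm_sq {F : X → V} (hF : MemLp F 2 μ) : Integrable (fun x => ‖F x‖ ^ 2) μ :=
  (memLp_two_iff_integrable_sq_norm hF.1).1 hF

theorem integrable_inner_of_memLp {V : Type*} [NormedAddCommGroup V] [InnerProductSpace ℝ V]
    {F G : X → V} (hF : MemLp F 2 μ) (hG : MemLp G 2 μ) :
    Integrable (fun x => inner ℝ (F x) (G x)) μ := by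
  refine ((integrable_norm_sq hF).add (integrable_norm_sq hG)).mono' (hF.1.inner hG.1)
    (Eventually.of_forall fun x => ?_)
  have hinner := norm_inner_le_norm (𝕜 := ℝ) (F x) (G x)
  simp only [Pi.add_apply]
  nlinarith [sq_nonneg (‖F x‖ - ‖G x‖), sq_nonneg (‖F x‖ + ‖G x‖)]

theorem memLp_comp_smul [NormedSpace ℝ V] {p : ℝ≥0∞} {f : X → ℝ} {F : X → V} {G : ℝ → ℝ} {L : ℝ}
    (hf : AEStronglyMeasurable f μ) (hF : MemLp F p μ) (hc : Continuous G) (hL : ∀ s, |G s| ≤ L) :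
    MemLp (fun x => G (f x) • F x) p μ := by
  refine hF.of_le_mul (c := L) ((hc.comp_aestronglyMeasurable hf).smul hF.1)
    (Eventually.of_forall fun x => ?_)
  rw [norm_smul]
  exact mul_le_mul_of_nonneg_right (hL _) (norm_nonneg _)

theorem memLp_of_memLp_restrict {s : Set X} {p : ℝ≥0∞} {F : X → V} (hs : MeasurableSet s)
    (hzero : ∀ x ∉ s, F x = 0) (hF : MemLp F p (μ.restrict s)) : MemLp F p μ := by
  rwa [← memLp_indicator_iff_restrict hs,
    indicator_eq_self.2 (Function.support_subset_iff'.2 hzero)] at hF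

end Lp

section Mollification

open ContinuousLinearMap (lsmul)
open scoped Convolution

theorem rpow_lintegral_mul_le_of_lintegral_eq_one {X : Type*} [MeasurableSpace X] {μ : Measure X}
    {ρ h : X → ℝ≥0∞} (hρ : AEMeasurable ρ μ) (hρ1 : ∫⁻ x, ρ x ∂μ = 1) (hh : AEMeasurable h μ)
    {q : ℝ} (hq : 1 ≤ q) : (∫⁻ x, ρ x * h x ∂μ) ^ q ≤ ∫⁻ x, ρ x * h x ^ q ∂μ := by
  have hprob : IsProbabilityMeasure (μ.withDensity ρ) :=
    ⟨by rw [withDensity_apply _ MeasurableSet.univ, setLIntegral_univ, hρ1]⟩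
  have hdensity : ∀ k : X → ℝ≥0∞, AEMeasurable k μ →
      ∫⁻ x, ρ x * k x ∂μ = ∫⁻ x, k x ∂μ.withDensity ρ := fun k hk =>
    (lintegral_withDensity_eq_lintegral_mul₀ hρ hk).symm
  have hmono := eLpNorm'_le_eLpNorm'_of_exponent_le zero_lt_one hq (μ := μ.withDensity ρ) (f := h)
    (hh.mono_ac (withDensity_absolutelyContinuous _ _)).aestronglyMeasurable
  simp only [eLpNorm', enorm_eq_self, ENNReal.rpow_one, one_div_one] at hmono
  rw [hdensity h hh, hdensity _ (hh.pow_const q),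
    ← ENNReal.le_rpow_inv_iff (zero_lt_one.trans_le hq), ← one_div]
  exact hmono

variable {G : Type*} [AddCommGroup G] [TopologicalSpace G] [IsTopologicalAddGroup G]
  [MeasurableSpace G] [BorelSpace G] {μ : Measure G} {V : Type*} [NormedAddCommGroup V]

theorem tendsto_eLpNorm_translate_sub [LocallyCompactSpace G]
    [μ.IsAddHaarMeasure] [μ.InnerRegularCompactLTTop] {p : ℝ≥0∞} [Fact (1 ≤ p)]
    (hp : p ≠ ⊤) {F : G → V} (hF : MemLp F p μ) :
    Tendsto (fun t => eLpNorm (fun x => F (x - t) - F x) p μ) (𝓝 0) (𝓝 0) := by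
  let translate : C(G × G, G) := ⟨fun q => q.2 - q.1, by fun_prop⟩
  have hmp : ∀ t, MeasurePreserving (translate.curry t) μ μ := measurePreserving_sub_right μ
  have hcont := ((continuous_const (y := hF.toLp F)).compMeasurePreservingLp
    translate.curry.continuous hmp hp).tendsto 0
  simp only [Lp.toLp_compMeasurePreserving hF] at hcont
  rw [Lp.tendsto_Lp_iff_tendsto_eLpNorm''] at hcont
  have hzero : F ∘ translate.curry 0 = F := funext fun x => congrArg F (sub_zero x)
  rwa [hzero] at hcont

variable [SecondCountableTopology G] [SFinite μ] [μ.IsAddLeftInvariant] [NormedSpace ℝ V]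
  [CompleteSpace V] {κ : G → ℝ} {F : G → V}

theorem enorm_convolution_sub_le (hκ1 : ∫ t, κ t ∂μ = 1) (hF : AEStronglyMeasurable F μ) (x : G) :
    ‖(κ ⋆[lsmul ℝ ℝ, μ] F) x - F x‖ₑ ≤ ∫⁻ t, ‖κ t‖ₑ * ‖F (x - t) - F x‖ₑ ∂μ := by
  have hκ : Integrable κ μ := .of_integral_ne_zero (by simp [hκ1])
  simp only [← enorm_smul]
  by_cases hinteg : Integrable (fun t => κ t • (F (x - t) - F x)) μ
  · have hconv : Integrable (fun t => κ t • F (x - t)) μ := by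
      refine (hinteg.add (hκ.smul_const (F x))).congr (.of_forall fun t => ?_)
      simp only [Pi.add_apply, smul_sub, sub_add_cancel]
    have hsub : (κ ⋆[lsmul ℝ ℝ, μ] F) x - F x = ∫ t, κ t • (F (x - t) - F x) ∂μ := by
      simp only [smul_sub]
      rw [integral_sub hconv (hκ.smul_const _), integral_smul_const, hκ1, one_smul]
      rfl
    exact hsub ▸ enorm_integral_le_lintegral_enorm _
  · have htop : ∫⁻ t, ‖κ t • (F (x - t) - F x)‖ₑ ∂μ = ⊤ := by
      refine not_lt_top_iff.1 fun h => hinteg ⟨hκ.1.smul (.sub ?_ aestronglyMeasurable_const), h⟩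
      exact hF.comp_quasiMeasurePreserving (quasiMeasurePreserving_sub_left μ x)
    exact htop ▸ le_top

theorem eLpNorm_convolution_sub_le (hκ0 : 0 ≤ κ) (hκ1 : ∫ t, κ t ∂μ = 1)
    (hF : AEStronglyMeasurable F μ) {p : ℝ≥0∞} (hp1 : 1 ≤ p) (hp : p ≠ ⊤) {ε : ℝ≥0∞}
    (hε : ∀ t, κ t ≠ 0 → eLpNorm (fun x => F (x - t) - F x) p μ ≤ ε) :
    eLpNorm (fun x => (κ ⋆[lsmul ℝ ℝ, μ] F) x - F x) p μ ≤ ε := by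
  have hκ : Integrable κ μ := .of_integral_ne_zero (by simp [hκ1])
  have hmass : ∫⁻ t, ‖κ t‖ₑ ∂μ = 1 := by
    rw [← ofReal_integral_norm_eq_lintegral_enorm hκ]
    simp [Real.norm_of_nonneg (hκ0 _), hκ1]
  have hp0 : p ≠ 0 := (zero_lt_one.trans_le hp1).ne'
  have hq1 : 1 ≤ p.toReal := by simpa using ENNReal.toReal_mono hp hp1
  have hq0 : 0 < p.toReal := zero_lt_one.trans_le hq1
  have hmeas : ∀ x, AEStronglyMeasurable (fun t => F (x - t) - F x) μ := fun x =>
    (hF.comp_quasiMeasurePreserving (quasiMeasurePreserving_sub_left μ x)).sub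
      aestronglyMeasurable_const
  have hmeas₂ : AEStronglyMeasurable (fun q : G × G => F (q.1 - q.2) - F q.1) (μ.prod μ) :=
    (hF.comp_quasiMeasurePreserving (quasiMeasurePreserving_sub μ μ)).sub
      (hF.comp_quasiMeasurePreserving Measure.quasiMeasurePreserving_fst)
  have htranslate : ∀ t, ‖κ t‖ₑ * ∫⁻ x, ‖F (x - t) - F x‖ₑ ^ p.toReal ∂μ ≤
      ‖κ t‖ₑ * ε ^ p.toReal := fun t => by
    rcases eq_or_ne (κ t) 0 with ht | ht
    · simp [ht]
    · rw [← eLpNorm_rpow_toReal hp0 hp]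
      gcongr
      exact hε t ht
  rw [← ENNReal.rpow_le_rpow_iff hq0, eLpNorm_rpow_toReal hp0 hp]
  calc ∫⁻ x, ‖(κ ⋆[lsmul ℝ ℝ, μ] F) x - F x‖ₑ ^ p.toReal ∂μ
      ≤ ∫⁻ x, ∫⁻ t, ‖κ t‖ₑ * ‖F (x - t) - F x‖ₑ ^ p.toReal ∂μ ∂μ := by
        refine lintegral_mono fun x => le_trans ?_
          (rpow_lintegral_mul_le_of_lintegral_eq_one hκ.1.enorm hmass (hmeas x).enorm hq1)
        gcongr
        exact enorm_convolution_sub_le hκ1 hF x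
    _ = ∫⁻ t, ∫⁻ x, ‖κ t‖ₑ * ‖F (x - t) - F x‖ₑ ^ p.toReal ∂μ ∂μ :=
        lintegral_lintegral_swap
          (hκ.1.comp_snd.enorm.mul (hmeas₂.enorm.pow_const _))
    _ ≤ ∫⁻ t, ‖κ t‖ₑ * ε ^ p.toReal ∂μ := by
        refine lintegral_mono fun t => ?_
        rw [lintegral_const_mul' _ _ enorm_ne_top]
        exact htranslate t
    _ = ε ^ p.toReal := by rw [lintegral_mul_const'' _ hκ.1.enorm, hmass, one_mul]

end Mollification

section SmoothApproximation

open ContinuousLinearMap (lsmul)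
open scoped Convolution

variable {Ω : Set (E n)} {p ψ : E n → ℝ} {P : E n → E n}

theorem gradient_convolution_eq_integral (hp : LocallyIntegrable p) (hψ : ContDiff ℝ 1 ψ)
    (hc : HasCompactSupport ψ) (x : E n) :
    gradient (ψ ⋆[lsmul ℝ ℝ, volume] p) x = ∫ s, p s • gradient ψ (x - s) := by
  have hfderiv : fderiv ℝ (ψ ⋆[lsmul ℝ ℝ, volume] p) x = ∫ s, p s • fderiv ℝ ψ (x - s) := by
    rw [(hc.hasFDerivAt_convolution_left (lsmul ℝ ℝ) hψ hp x).fderiv, convolution_eq_swap]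
    refine integral_congr_ae (Eventually.of_forall fun s => ?_)
    ext v
    simp [mul_comm]
  rw [gradient, hfderiv]
  refine ((InnerProductSpace.toDual ℝ (E n)).symm.toContinuousLinearEquiv.integral_comp_comm
    fun s => p s • fderiv ℝ ψ (x - s)).symm.trans ?_
  simp [gradient]

theorem IsWeakGradient.gradient_convolution (hp : IsWeakGradient univ p P)
    (hψ : ContDiff ℝ ∞ ψ) (hc : HasCompactSupport ψ) (x : E n) :
    gradient (ψ ⋆[lsmul ℝ ℝ, volume] p) x = (ψ ⋆[lsmul ℝ ℝ, volume] P) x := by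
  have htest : IsTestFunction univ (fun s => ψ (x - s)) :=
    ⟨hψ.comp (contDiff_const.sub contDiff_id), hc.comp_homeomorph (Homeomorph.subLeft x),
      subset_univ _⟩
  have hparts := hp.integral_eq htest
  simp only [gradient_comp_sub_left (hψ.differentiable (by simp) _), smul_neg, integral_neg,
    neg_inj] at hparts
  rw [gradient_convolution_eq_integral (locallyIntegrableOn_univ.1 hp.1) (hψ.of_le (by simp)) hc,
    hparts, convolution_eq_swap]
  rfl

theorem tsupport_convolution_subset_cthickening {K : Set (E n)} {r : ℝ}
    (hψ : ∀ x, ψ x ≠ 0 → ‖x‖ ≤ r) (hp : ∀ x ∉ K, p x = 0) :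
    tsupport (ψ ⋆[lsmul ℝ ℝ, volume] p) ⊆ Metric.cthickening r K := by
  refine closure_minimal ((support_convolution_subset _).trans ?_) Metric.isClosed_cthickening
  rintro _ ⟨a, ha, b, hb, rfl⟩
  have hbK : b ∈ K := by_contra fun h => hb (hp b h)
  refine Metric.mem_cthickening_of_dist_le (a + b) b r K hbK ?_
  simpa [dist_eq_norm] using hψ a ha

theorem exists_isTestFunction_eLpNorm_sub_le (hΩ : IsOpen Ω) (hp : IsWeakGradient univ p P)
    (hp2 : MemLp p 2) (hP2 : MemLp P 2) {K : Set (E n)} (hK : IsCompact K) (hKΩ : K ⊆ Ω)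
    (hpK : ∀ x ∉ K, p x = 0) {ε : ℝ≥0∞} (hε : 0 < ε) :
    ∃ φ : E n → ℝ, IsTestFunction Ω φ ∧ eLpNorm (fun x => φ x - p x) 2 volume ≤ ε ∧
      eLpNorm (fun x => gradient φ x - P x) 2 volume ≤ ε := by
  obtain ⟨δ, hδ, hδΩ⟩ := hK.exists_cthickening_subset_open hΩ hKΩ
  have htranslate := ((tendsto_eLpNorm_translate_sub (by simp) hp2).eventually
    (ge_mem_nhds hε)).and ((tendsto_eLpNorm_translate_sub (by simp) hP2).eventually
      (ge_mem_nhds hε))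
  obtain ⟨r, hr, hclose⟩ := Metric.eventually_nhds_iff.1 htranslate
  have hR : 0 < min r δ := lt_min hr hδ
  let ρ : ContDiffBump (0 : E n) := ⟨min r δ / 2, min r δ, by linarith, by linarith⟩
  have hρc : HasCompactSupport (ρ.normed (volume : Measure (E n))) := ρ.hasCompactSupport_normed
  have hρs : ContDiff ℝ ∞ (ρ.normed (volume : Measure (E n))) := ρ.contDiff_normed
  have hρlt : ∀ t, ρ.normed volume t ≠ 0 → ‖t‖ < min r δ := fun t ht => by
    have hmem : t ∈ Function.support (ρ.normed volume) := ht
    rwa [ρ.support_normed_eq, mem_ball_zero_iff] at hmem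
  have hρdist : ∀ t, ρ.normed volume t ≠ 0 → dist t 0 < r := fun t ht => by
    rw [dist_zero_right]
    exact (hρlt t ht).trans_le (min_le_left _ _)
  have hsupp : tsupport (ρ.normed volume ⋆[lsmul ℝ ℝ, volume] p) ⊆ Metric.cthickening δ K :=
    tsupport_convolution_subset_cthickening
      (fun t ht => ((hρlt t ht).trans_le (min_le_right _ _)).le) hpK
  refine ⟨ρ.normed volume ⋆[lsmul ℝ ℝ, volume] p,
    ⟨hρc.contDiff_convolution_left _ hρs (locallyIntegrableOn_univ.1 hp.1),
      hK.cthickening.of_isClosed_subset (isClosed_tsupport _) hsupp, hsupp.trans hδΩ⟩, ?_, ?_⟩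
  · exact eLpNorm_convolution_sub_le (fun t => ρ.nonneg_normed t) ρ.integral_normed hp2.1
      (by simp) (by simp) fun t ht => (hclose (hρdist t ht)).1
  · simp only [hp.gradient_convolution hρs hρc]
    exact eLpNorm_convolution_sub_le (fun t => ρ.nonneg_normed t) ρ.integral_normed hP2.1
      (by simp) (by simp) fun t ht => (hclose (hρdist t ht)).2

theorem exists_seq_isTestFunction_tendsto (hΩ : IsOpen Ω) (hp : IsWeakGradient univ p P)
    (hp2 : MemLp p 2) (hP2 : MemLp P 2) {K : Set (E n)} (hK : IsCompact K) (hKΩ : K ⊆ Ω)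
    (hpK : ∀ x ∉ K, p x = 0) :
    ∃ φ : ℕ → E n → ℝ, (∀ k, IsTestFunction Ω (φ k)) ∧
      Tendsto (fun k => eLpNorm (fun x => φ k x - p x) 2 volume) atTop (𝓝 0) ∧
      Tendsto (fun k => eLpNorm (fun x => gradient (φ k) x - P x) 2 volume) atTop (𝓝 0) := by
  choose φ hφ hval hgrad using fun k : ℕ =>
    exists_isTestFunction_eLpNorm_sub_le hΩ hp hp2 hP2 hK hKΩ hpK
      (ε := (k : ℝ≥0∞)⁻¹) (by simp)
  exact ⟨φ, hφ,
    tendsto_of_tendsto_of_tendsto_of_le_of_le tendsto_const_nhds ENNReal.tendsto_inv_nat_nhds_zero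
      (fun _ => zero_le) hval,
    tendsto_of_tendsto_of_tendsto_of_le_of_le tendsto_const_nhds ENNReal.tendsto_inv_nat_nhds_zero
      (fun _ => zero_le) hgrad⟩

end SmoothApproximation

section SobolevSpace

variable {Ω : Set (E n)} {f g χ φ : E n → ℝ} {F : E n → E n}

theorem IsTestFunction.memH1 (h : IsTestFunction Ω φ) (U : Set (E n)) : MemH1 U φ :=
  ⟨h.memLp 2 _, gradient φ, isWeakGradient_of_contDiff h.contDiff_one, h.memLp_gradient 2 _⟩

theorem MemH1.add (hf : MemH1 Ω f) (hg : MemH1 Ω g) : MemH1 Ω (fun x => f x + g x) := by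
  obtain ⟨hf2, F, hF, hF2⟩ := hf
  obtain ⟨hg2, G, hG, hG2⟩ := hg
  exact ⟨hf2.add hg2, _, hF.add hG, hF2.add hG2⟩

theorem MemH1.const_mul (hf : MemH1 Ω f) (c : ℝ) : MemH1 Ω (fun x => c * f x) := by
  obtain ⟨hf2, F, hF, hF2⟩ := hf
  exact ⟨hf2.const_mul c, _, hF.const_mul c, hF2.const_smul c⟩

theorem MemH1.sub (hf : MemH1 Ω f) (hg : MemH1 Ω g) : MemH1 Ω (fun x => f x - g x) := by
  simpa [sub_eq_add_neg] using hf.add (hg.const_mul (-1))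

theorem MemH1.integrable_sq_add_norm_sq_weakGradient (hΩ : IsOpen Ω) (hf : MemH1 Ω f) :
    Integrable (fun x => f x ^ 2 + ‖weakGradient Ω f x‖ ^ 2) (volume.restrict Ω) :=
  hf.1.integrable_sq.add (integrable_norm_sq (hf.memLp_weakGradient hΩ))

theorem h1NormSq_add_le (hΩ : IsOpen Ω) (hf : MemH1 Ω f) (hg : MemH1 Ω g) :
    h1NormSq Ω (fun x => f x + g x) ≤ 2 * h1NormSq Ω f + 2 * h1NormSq Ω g := by
  have hfi := (hf.integrable_sq_add_norm_sq_weakGradient hΩ).const_mul 2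
  have hgi := (hg.integrable_sq_add_norm_sq_weakGradient hΩ).const_mul 2
  rw [h1NormSq, h1NormSq, h1NormSq, ← integral_const_mul, ← integral_const_mul,
    ← integral_add hfi hgi]
  refine integral_mono_ae ((hf.add hg).integrable_sq_add_norm_sq_weakGradient hΩ)
    (hfi.add hgi) ?_
  filter_upwards [(hf.isWeakGradient.add hg.isWeakGradient).weakGradient_ae_eq hΩ] with x hx
  have hpar := parallelogram_law_with_norm ℝ (weakGradient Ω f x) (weakGradient Ω g x)
  rw [hx]
  nlinarith [sq_nonneg (f x - g x), sq_nonneg ‖weakGradient Ω f x - weakGradient Ω g x‖]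

theorem MemH10.add (hΩ : IsOpen Ω) (hf : MemH10 Ω f) (hg : MemH10 Ω g) :
    MemH10 Ω (fun x => f x + g x) := by
  refine ⟨hf.1.add hg.1, fun ε hε => ?_⟩
  obtain ⟨φ, hφ, hfφ⟩ := hf.2 (ε / 2) (by positivity)
  obtain ⟨ψ, hψ, hgψ⟩ := hg.2 (ε / 2) (by positivity)
  refine ⟨fun x => φ x + ψ x, hφ.add hψ, ?_⟩
  have hle := h1NormSq_add_le hΩ (hf.1.sub (hφ.memH1 Ω)) (hg.1.sub (hψ.memH1 Ω))
  simp only [add_sub_add_comm]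
  rw [Real.sqrt_lt' (by positivity)] at hfφ hgψ ⊢
  nlinarith

theorem exists_isTestFunction_eq_one (hΩ : IsOpen Ω) {K : Set (E n)} (hK : IsCompact K)
    (hKΩ : K ⊆ Ω) : ∃ χ : E n → ℝ, IsTestFunction Ω χ ∧ ∀ x ∈ K, χ x = 1 := by
  obtain ⟨δ, hδ, hδΩ⟩ := hK.exists_cthickening_subset_open hΩ hKΩ
  obtain ⟨χ, hsmooth, -, hsupp, hone⟩ := exists_contMDiff_support_eq_eq_one_iff (n := ⊤)
    (modelWithCornersSelf ℝ (E n)) (Metric.isOpen_thickening (δ := δ) (E := K)) hK.isClosed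
    (Metric.self_subset_thickening hδ K)
  have hs : tsupport χ ⊆ Metric.cthickening δ K := by
    rw [tsupport, hsupp]
    exact Metric.closure_thickening_subset_cthickening δ K
  exact ⟨χ, ⟨hsmooth.contDiff, hK.cthickening.of_isClosed_subset (isClosed_tsupport _) hs,
    hs.trans hδΩ⟩, fun x hx => (hone x).1 hx⟩

theorem IsWeakGradient.univ_of_isTestFunction_mul (hf : IsWeakGradient Ω f F)
    (hχ : IsTestFunction Ω χ) :
    IsWeakGradient univ (fun x => χ x * f x) (fun x => χ x • F x + f x • gradient χ x) := by
  have hχf : Integrable (fun x => χ x * f x) := hχ.integrable_smul hf.1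
  have hχF := hχ.integrable_smul hf.2.1
  have hfχ := hχ.integrable_smul_gradient hf.1
  refine isWeakGradient_of_integral (hχf.locallyIntegrable.locallyIntegrableOn _)
    ((hχF.add hfχ).locallyIntegrable.locallyIntegrableOn _) fun ψ hψ => ?_
  have hprod : ∀ x, f x • gradient (fun y => χ y * ψ y) x
      = (χ x * f x) • gradient ψ x + ψ x • (f x • gradient χ x) := fun x => by
    rw [gradient_mul (hχ.differentiable x) (hψ.differentiable x), smul_add, smul_smul,
      smul_smul, smul_smul, mul_comm (f x), mul_comm (f x)]
  have hi₁ := hψ.integrable_smul_gradient (hχf.locallyIntegrable.locallyIntegrableOn _)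
  have hi₂ := hψ.integrable_smul (hfχ.locallyIntegrable.locallyIntegrableOn _)
  have hi₃ := hψ.integrable_smul (hχF.locallyIntegrable.locallyIntegrableOn _)
  have hparts := hf.integral_eq (hχ.mul hψ.1)
  simp only [hprod] at hparts
  rw [integral_add hi₁ hi₂] at hparts
  simp only [smul_add]
  rw [integral_add hi₃ hi₂, eq_sub_of_add_eq hparts]
  simp only [smul_smul, mul_comm (ψ _)]
  abel

theorem IsTestFunction.memLp_mul (hΩ : IsOpen Ω) (hχ : IsTestFunction Ω χ) {p : ℝ≥0∞}
    (hf : MemLp f p (volume.restrict Ω)) : MemLp (fun x => χ x * f x) p :=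
  memLp_of_memLp_restrict hΩ.measurableSet (fun x hx => by simp [hχ.eq_zero hx])
    (hf.mul' (hχ.memLp ⊤ _))

theorem IsTestFunction.memLp_gradient_mul (hΩ : IsOpen Ω) (hχ : IsTestFunction Ω χ) {p : ℝ≥0∞}
    (hf : MemLp f p (volume.restrict Ω)) (hF : MemLp F p (volume.restrict Ω)) :
    MemLp (fun x => χ x • F x + f x • gradient χ x) p :=
  memLp_of_memLp_restrict hΩ.measurableSet
    (fun x hx => by simp [hχ.eq_zero hx, hχ.gradient_eq_zero hx])
    ((hF.smul (hχ.memLp ⊤ _)).add ((hχ.memLp_gradient ⊤ _).smul hf))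

theorem MemH1.isTestFunction_mul (hΩ : IsOpen Ω) (hχ : IsTestFunction Ω χ) (hf : MemH1 Ω f) :
    MemH1 Ω (fun x => χ x * f x) := by
  obtain ⟨hf2, F, hF, hF2⟩ := hf
  exact ⟨(hχ.memLp_mul hΩ hf2).restrict Ω, _,
    (hF.univ_of_isTestFunction_mul hχ).mono (subset_univ _),
    (hχ.memLp_gradient_mul hΩ hf2 hF2).restrict Ω⟩

theorem IsWeakGradient.sqrt_h1NormSq_lt (hΩ : IsOpen Ω) (hw : IsWeakGradient Ω f F)
    (hf : MemLp f 2 (volume.restrict Ω)) (hF : MemLp F 2 (volume.restrict Ω)) {ε : ℝ} (hε : 0 < ε)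
    (hfε : eLpNorm f 2 (volume.restrict Ω) ≤ ENNReal.ofReal (ε / 2))
    (hFε : eLpNorm F 2 (volume.restrict Ω) ≤ ENNReal.ofReal (ε / 2)) :
    Real.sqrt (h1NormSq Ω f) < ε := by
  have hfsq := integral_norm_sq_le_of_eLpNorm_le hf.1 (by positivity) hfε
  have hFsq := integral_norm_sq_le_of_eLpNorm_le hF.1 (by positivity) hFε
  simp only [Real.norm_eq_abs, sq_abs] at hfsq
  rw [Real.sqrt_lt' hε, hw.h1NormSq_eq hΩ, integral_add hf.integrable_sq (integrable_norm_sq hF)]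
  nlinarith

theorem MemH1.memH10_of_isCompact (hΩ : IsOpen Ω) (hf : MemH1 Ω f) {K : Set (E n)}
    (hK : IsCompact K) (hKΩ : K ⊆ Ω) (h0 : ∀ x ∉ K, f x = 0) : MemH10 Ω f := by
  refine ⟨hf, fun ε hε => ?_⟩
  obtain ⟨χ, hχ, hχ1⟩ := exists_isTestFunction_eq_one hΩ hK hKΩ
  obtain ⟨hf2, F, hF, hF2⟩ := hf
  have hχf : (fun x => χ x * f x) = f := by
    ext x
    by_cases hx : x ∈ K
    · rw [hχ1 x hx, one_mul]
    · rw [h0 x hx, mul_zero]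
  have hw := hF.univ_of_isTestFunction_mul hχ
  have hp2 := hχ.memLp_mul hΩ hf2
  have hP2 := hχ.memLp_gradient_mul hΩ hf2 hF2
  rw [hχf] at hw hp2
  obtain ⟨φ, hφ, hval, hgrad⟩ := exists_isTestFunction_eLpNorm_sub_le hΩ hw hp2 hP2 hK hKΩ h0
    (ε := ENNReal.ofReal (ε / 2)) (by simpa using hε)
  refine ⟨φ, hφ, IsWeakGradient.sqrt_h1NormSq_lt hΩ
    ((hw.mono (subset_univ _)).sub (isWeakGradient_of_contDiff hφ.contDiff_one))
    ((hp2.sub (hφ.memLp 2 _)).restrict Ω) ((hP2.sub (hφ.memLp_gradient 2 _)).restrict Ω) hε ?_ ?_⟩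
  · exact (eLpNorm_restrict_le _ _ _ _).trans ((eLpNorm_sub_comm _ _ _ _).trans_le hval)
  · exact (eLpNorm_restrict_le _ _ _ _).trans ((eLpNorm_sub_comm _ _ _ _).trans_le hgrad)

theorem MemH1.h1NormSq_const_mul (hΩ : IsOpen Ω) (hf : MemH1 Ω f) (c : ℝ) :
    h1NormSq Ω (fun x => c * f x) = c ^ 2 * h1NormSq Ω f := by
  rw [(hf.isWeakGradient.const_mul c).h1NormSq_eq hΩ, h1NormSq, ← integral_const_mul]
  refine integral_congr_ae (Eventually.of_forall fun x => ?_)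
  simp only [norm_smul, mul_pow, Real.norm_eq_abs, sq_abs]
  ring

theorem MemH10.const_mul (hΩ : IsOpen Ω) (hf : MemH10 Ω f) (c : ℝ) :
    MemH10 Ω fun x => c * f x := by
  refine ⟨hf.1.const_mul c, fun ε hε => ?_⟩
  obtain ⟨φ, hφ, hlt⟩ := hf.2 (ε / (|c| + 1)) (by positivity)
  refine ⟨fun x => c * φ x, hφ.const_mul c, ?_⟩
  simp only [← mul_sub]
  rw [(hf.1.sub (hφ.memH1 Ω)).h1NormSq_const_mul hΩ, Real.sqrt_mul (sq_nonneg c),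
    Real.sqrt_sq_eq_abs]
  rw [lt_div_iff₀ (by positivity)] at hlt
  nlinarith [Real.sqrt_nonneg (h1NormSq Ω fun x => f x - φ x)]

theorem MemH1.memH10_isTestFunction_mul (hΩ : IsOpen Ω) (hχ : IsTestFunction Ω χ)
    (hf : MemH1 Ω f) : MemH10 Ω fun x => χ x * f x :=
  (hf.isTestFunction_mul hΩ hχ).memH10_of_isCompact hΩ hχ.2.1 hχ.2.2 fun x hx => by
    rw [image_eq_zero_of_notMem_tsupport hx, zero_mul]

theorem IsTestFunction.memH10 (hΩ : IsOpen Ω) (hφ : IsTestFunction Ω φ) : MemH10 Ω φ :=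
  (hφ.memH1 Ω).memH10_of_isCompact hΩ hφ.2.1 hφ.2.2 fun _ => image_eq_zero_of_notMem_tsupport

end SobolevSpace

section ChainRule

theorem lipschitzWith_of_abs_hasDerivAt_le {Γ Γ' : ℝ → ℝ} (hd : ∀ s, HasDerivAt Γ (Γ' s) s)
    {L : ℝ} (hL : ∀ s, |Γ' s| ≤ L) : LipschitzWith L.toNNReal Γ := by
  refine lipschitzWith_of_nnnorm_deriv_le (fun s => (hd s).differentiableAt) fun s => ?_
  rw [(hd s).deriv, ← NNReal.coe_le_coe]
  exact (hL s).trans (Real.le_coe_toNNReal L)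

variable {X V ι : Type*} [MeasurableSpace X] {μ : Measure X} [NormedAddCommGroup V]
  [NormedSpace ℝ V] {l : Filter ι} {p : X → ℝ} {φ : ι → X → ℝ}

theorem tendsto_integral_comp_smul_of_lipschitzWith {Γ : ℝ → ℝ} {L : NNReal}
    (hΓ : LipschitzWith L Γ) (hp : AEStronglyMeasurable p μ)
    (hφ : ∀ k, AEStronglyMeasurable (φ k) μ)
    (hlim : Tendsto (fun k => eLpNorm (fun x => φ k x - p x) 2 μ) l (𝓝 0)) {b : X → V}
    (hb : MemLp b 2 μ) (hpi : Integrable (fun x => Γ (p x) • b x) μ)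
    (hφi : ∀ k, Integrable (fun x => Γ (φ k x) • b x) μ) :
    Tendsto (fun k => ∫ x, Γ (φ k x) • b x ∂μ) l (𝓝 (∫ x, Γ (p x) • b x ∂μ)) := by
  refine tendsto_integral_of_L1' _ hpi.1 (Eventually.of_forall hφi) ?_
  refine tendsto_of_tendsto_of_tendsto_of_le_of_le tendsto_const_nhds
    (h := fun k => L * eLpNorm (fun x => φ k x - p x) 2 μ * eLpNorm b 2 μ) ?_
    (fun _ => zero_le) fun k => ?_
  · simpa using ENNReal.Tendsto.mul_const
      (ENNReal.Tendsto.const_mul hlim (Or.inr ENNReal.coe_ne_top)) (Or.inr hb.2.ne)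
  · have hdiff : AEStronglyMeasurable (fun x => Γ (φ k x) - Γ (p x)) μ :=
      (hΓ.continuous.comp_aestronglyMeasurable (hφ k)).sub
        (hΓ.continuous.comp_aestronglyMeasurable hp)
    calc eLpNorm ((fun x => Γ (φ k x) • b x) - fun x => Γ (p x) • b x) 1 μ
        = eLpNorm ((fun x => Γ (φ k x) - Γ (p x)) • b) 1 μ := by
          congr 1
          ext1 x
          simp [sub_smul]
      _ ≤ eLpNorm (fun x => Γ (φ k x) - Γ (p x)) 2 μ * eLpNorm b 2 μ :=
          eLpNorm_smul_le_mul_eLpNorm hb.1 hdiff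
      _ ≤ L * eLpNorm (fun x => φ k x - p x) 2 μ * eLpNorm b 2 μ := by
          gcongr
          exact eLpNorm_le_nnreal_smul_eLpNorm_of_ae_le_mul
            (Eventually.of_forall fun x => hΓ.norm_sub_le _ _) 2

theorem tendsto_integral_smul_of_tendsto_eLpNorm_sub {a : ι → X → ℝ} {P : X → V} {G : ι → X → V}
    {C : ℝ≥0∞} (hC : C ≠ ⊤) (ha : ∀ k, AEStronglyMeasurable (a k) μ)
    (haC : ∀ k, eLpNorm (a k) 2 μ ≤ C) (hP : MemLp P 2 μ) (hG : ∀ k, MemLp (G k) 2 μ)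
    (hlim : Tendsto (fun k => eLpNorm (fun x => G k x - P x) 2 μ) l (𝓝 0)) {I : V}
    (hI : Tendsto (fun k => ∫ x, a k x • P x ∂μ) l (𝓝 I)) :
    Tendsto (fun k => ∫ x, a k x • G k x ∂μ) l (𝓝 I) := by
  have ha2 : ∀ k, MemLp (a k) 2 μ := fun k => ⟨ha k, (haC k).trans_lt hC.lt_top⟩
  have hrest : Tendsto (fun k => ∫ x, a k x • (G k x - P x) ∂μ) l (𝓝 0) := by
    rw [tendsto_zero_iff_enorm_tendsto_zero]
    refine tendsto_of_tendsto_of_tendsto_of_le_of_le tendsto_const_nhds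
      (h := fun k => C * eLpNorm (fun x => G k x - P x) 2 μ) ?_ (fun _ => zero_le) fun k => ?_
    · simpa using ENNReal.Tendsto.const_mul hlim (Or.inr hC)
    · calc ‖∫ x, a k x • (G k x - P x) ∂μ‖ₑ
          ≤ eLpNorm (a k • fun x => G k x - P x) 1 μ := by
            rw [eLpNorm_one_eq_lintegral_enorm]
            exact enorm_integral_le_lintegral_enorm _
        _ ≤ eLpNorm (a k) 2 μ * eLpNorm (fun x => G k x - P x) 2 μ :=
            eLpNorm_smul_le_mul_eLpNorm ((hG k).sub hP).1 (ha k)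
        _ ≤ C * eLpNorm (fun x => G k x - P x) 2 μ := by
            gcongr
            exact haC k
  have hsum := hI.add hrest
  rw [add_zero] at hsum
  refine hsum.congr fun k => ?_
  have hP1 : Integrable (fun x => a k x • P x) μ := memLp_one_iff_integrable.1 (hP.smul (ha2 k))
  have hrest1 : Integrable (fun x => a k x • (G k x - P x)) μ :=
    memLp_one_iff_integrable.1 (((hG k).sub hP).smul (ha2 k))
  rw [← integral_add hP1 hrest1]
  simp only [smul_sub, add_sub_cancel]

theorem tendsto_integral_comp_smul_of_tendsto_ae [l.IsCountablyGenerated] {Γ : ℝ → ℝ}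
    (hΓ : Continuous Γ) {L : ℝ} (hL : ∀ s, |Γ s| ≤ L)
    (hφ : ∀ k, AEStronglyMeasurable (φ k) μ)
    (hae : ∀ᵐ x ∂μ, Tendsto (fun k => φ k x) l (𝓝 (p x))) {b : X → V} (hb : Integrable b μ) :
    Tendsto (fun k => ∫ x, Γ (φ k x) • b x ∂μ) l (𝓝 (∫ x, Γ (p x) • b x ∂μ)) := by
  refine tendsto_integral_filter_of_dominated_convergence (fun x => L * ‖b x‖)
    (Eventually.of_forall fun k => (hΓ.comp_aestronglyMeasurable (hφ k)).smul hb.1)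
    (Eventually.of_forall fun k => Eventually.of_forall fun x => ?_) (hb.norm.const_mul L) ?_
  · rw [norm_smul]
    exact mul_le_mul_of_nonneg_right (hL _) (norm_nonneg _)
  · filter_upwards [hae] with x hx
    exact ((hΓ.tendsto _).comp hx).smul_const _

variable {Ω K : Set (E n)} {f p : E n → ℝ} {F P : E n → E n} {Γ Γ' : ℝ → ℝ} {L : ℝ}

theorem locallyIntegrableOn_comp_of_lipschitzWith (hΩ : IsOpen Ω) {C : NNReal}
    (hΓ : LipschitzWith C Γ) (hf : LocallyIntegrableOn f Ω) :
    LocallyIntegrableOn (fun x => Γ (f x)) Ω := by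
  rw [locallyIntegrableOn_iff hΩ.isLocallyClosed] at hf ⊢
  intro K hKΩ hK
  have hKf := memLp_one_iff_integrable.2 (hf K hKΩ hK)
  have hsub : LipschitzWith C (fun s => Γ s - Γ 0) := by
    simpa using hΓ.sub (LipschitzWith.const (Γ 0))
  have hinteg : IntegrableOn (fun x => Γ (f x) - Γ 0) K :=
    memLp_one_iff_integrable.1 (hsub.comp_memLp (sub_self _) hKf)
  have hconst : IntegrableOn (fun _ => Γ 0) K := integrableOn_const hK.measure_ne_top
  exact (hinteg.add hconst).congr_fun_ae (Eventually.of_forall fun x => sub_add_cancel _ _)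

theorem integral_comp_smul_gradient_eq_of_tendsto {φ : ℕ → E n → ℝ}
    (hd : ∀ s, HasDerivAt Γ (Γ' s) s) (hc : Continuous Γ') (hL : ∀ s, |Γ' s| ≤ L)
    (hp2 : MemLp p 2) (hP2 : MemLp P 2) (hφ : ∀ k, IsTestFunction univ (φ k))
    (hval : Tendsto (fun k => eLpNorm (fun x => φ k x - p x) 2 volume) atTop (𝓝 0))
    (hgrad : Tendsto (fun k => eLpNorm (fun x => gradient (φ k) x - P x) 2 volume) atTop (𝓝 0))
    (hae : ∀ᵐ x, Tendsto (fun k => φ k x) atTop (𝓝 (p x))) {ψ : E n → ℝ}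
    (hψ : IsTestFunction univ ψ) :
    ∫ x, Γ (p x) • gradient ψ x = -∫ x, ψ x • Γ' (p x) • P x := by
  have hΓ := lipschitzWith_of_abs_hasDerivAt_le hd hL
  have hΓ1 : ContDiff ℝ 1 Γ := by
    rw [contDiff_one_iff_deriv, show deriv Γ = Γ' from funext fun s => (hd s).deriv]
    exact ⟨fun s => (hd s).differentiableAt, hc⟩
  have hφm : ∀ k, AEStronglyMeasurable (φ k) := fun k => (hφ k).1.continuous.aestronglyMeasurable
  have hleft : Tendsto (fun k => ∫ x, Γ (φ k x) • gradient ψ x) atTop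
      (𝓝 (∫ x, Γ (p x) • gradient ψ x)) := by
    have hloc : ∀ q : E n → ℝ, LocallyIntegrable q → Integrable fun x => Γ (q x) • gradient ψ x :=
      fun q hq => hψ.integrable_smul_gradient
        (locallyIntegrableOn_comp_of_lipschitzWith isOpen_univ hΓ (hq.locallyIntegrableOn _))
    exact tendsto_integral_comp_smul_of_lipschitzWith hΓ hp2.1 hφm hval
      (hψ.memLp_gradient 2 _) (hloc p (hp2.locallyIntegrable (by norm_num)))
      fun k => hloc (φ k) (hφ k).1.continuous.locallyIntegrable
  have hright : Tendsto (fun k => ∫ x, (Γ' (φ k x) * ψ x) • gradient (φ k) x) atTop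
      (𝓝 (∫ x, Γ' (p x) • ψ x • P x)) := by
    have hψP : Integrable fun x => ψ x • P x :=
      hψ.integrable_smul ((hP2.locallyIntegrable (by norm_num)).locallyIntegrableOn _)
    refine tendsto_integral_smul_of_tendsto_eLpNorm_sub
      (a := fun k x => Γ' (φ k x) * ψ x)
      (C := ENNReal.ofReal L * eLpNorm ψ 2 volume)
      (ENNReal.mul_ne_top ENNReal.ofReal_ne_top (hψ.memLp 2 volume).2.ne)
      (fun k => ((hc.comp (hφ k).1.continuous).mul hψ.1.continuous).aestronglyMeasurable)
      (fun k => ?_) hP2 (fun k => (hφ k).memLp_gradient 2 _) hgrad ?_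
    · refine eLpNorm_le_mul_eLpNorm_of_ae_le_mul (Eventually.of_forall fun x => ?_) 2
      rw [norm_mul]
      exact mul_le_mul_of_nonneg_right (hL _) (norm_nonneg _)
    · simpa only [mul_smul] using tendsto_integral_comp_smul_of_tendsto_ae hc hL hφm hae hψP
  have hparts : ∀ k, ∫ x, Γ (φ k x) • gradient ψ x
      = -∫ x, (Γ' (φ k x) * ψ x) • gradient (φ k) x := fun k => by
    rw [integral_smul_gradient_of_contDiff (ψ := fun x => Γ (φ k x))
      (hΓ1.comp (hφ k).contDiff_one) hψ]
    simp only [gradient_comp ((hφ k).differentiable _) (hd _), smul_smul, mul_comm]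
  simp only [hparts] at hleft
  simpa only [smul_comm (ψ _)] using tendsto_nhds_unique hleft hright.neg

theorem IsWeakGradient.integral_comp_smul_gradient_eq (hp : IsWeakGradient univ p P)
    (hp2 : MemLp p 2) (hP2 : MemLp P 2) (hK : IsCompact K) (hpK : ∀ x ∉ K, p x = 0)
    (hd : ∀ s, HasDerivAt Γ (Γ' s) s) (hc : Continuous Γ') (hL : ∀ s, |Γ' s| ≤ L) {ψ : E n → ℝ}
    (hψ : IsTestFunction univ ψ) :
    ∫ x, Γ (p x) • gradient ψ x = -∫ x, ψ x • Γ' (p x) • P x := by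
  obtain ⟨φ, hφ, hval, hgrad⟩ :=
    exists_seq_isTestFunction_tendsto isOpen_univ hp hp2 hP2 hK (subset_univ _) hpK
  obtain ⟨ns, hns, hae⟩ := (tendstoInMeasure_of_tendsto_eLpNorm (p := 2) (by norm_num)
    (fun k => (hφ k).1.continuous.aestronglyMeasurable) hp2.1 hval).exists_seq_tendsto_ae
  exact integral_comp_smul_gradient_eq_of_tendsto hd hc hL hp2 hP2 (fun k => hφ (ns k))
    (hval.comp hns.tendsto_atTop) (hgrad.comp hns.tendsto_atTop) hae hψ

theorem IsWeakGradient.comp (hΩ : IsOpen Ω) (hf : IsWeakGradient Ω f F)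
    (hf2 : MemLp f 2 (volume.restrict Ω)) (hF2 : MemLp F 2 (volume.restrict Ω))
    (hd : ∀ s, HasDerivAt Γ (Γ' s) s) (hc : Continuous Γ') (hL : ∀ s, |Γ' s| ≤ L) :
    IsWeakGradient Ω (fun x => Γ (f x)) (fun x => Γ' (f x) • F x) := by
  have hΓF := memLp_comp_smul hf2.1 hF2 hc hL
  refine isWeakGradient_of_integral (locallyIntegrableOn_comp_of_lipschitzWith hΩ
    (lipschitzWith_of_abs_hasDerivAt_le hd hL) hf.1)
    (locallyIntegrableOn_of_locallyIntegrable_restrict (hΓF.locallyIntegrable (by norm_num)))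
    fun ψ hψ => ?_
  obtain ⟨χ, hχ, hχ1⟩ := exists_isTestFunction_eq_one hΩ hψ.2.1 hψ.2.2
  have hparts := (hf.univ_of_isTestFunction_mul hχ).integral_comp_smul_gradient_eq
    (hχ.memLp_mul hΩ hf2)
    (hχ.memLp_gradient_mul hΩ hf2 hF2) hχ.2.1
    (fun x hx => by rw [image_eq_zero_of_notMem_tsupport hx, zero_mul]) hd hc hL
    (hψ.mono (subset_univ _))
  have hleft : ∀ x, Γ (χ x * f x) • gradient ψ x = Γ (f x) • gradient ψ x := fun x => by
    by_cases hx : x ∈ tsupport ψ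
    · rw [hχ1 x hx, one_mul]
    · rw [image_eq_zero_of_notMem_tsupport fun h => hx (tsupport_gradient_subset ψ h), smul_zero,
        smul_zero]
  have hright : ∀ x, ψ x • Γ' (χ x * f x) • (χ x • F x + f x • gradient χ x)
      = ψ x • Γ' (f x) • F x := fun x => by
    by_cases hx : ψ x = 0
    · rw [hx, zero_smul, zero_smul]
    · have hloc : χ =ᶠ[𝓝 x] fun _ => 1 := by
        filter_upwards [hψ.1.continuous.continuousAt.eventually_ne hx] with y hy
        exact hχ1 y (subset_tsupport _ hy)
      have hgχ : gradient χ x = 0 := hloc.gradient_eq.trans (gradient_fun_const x 1)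
      rw [hgχ, hχ1 x (subset_tsupport _ hx), one_mul, one_smul, smul_zero, add_zero]
  simpa only [hleft, hright] using hparts

end ChainRule

section Kernel

variable {H : Type*} [NormedAddCommGroup H]

/-- The radial potential `ζ(y) = exp (-1 / (1 - |y|²))` on the unit ball, extended by `0`. -/
def potential (y : H) : ℝ := expNegInvGlue (1 - ‖y‖ ^ 2)

/-- The radial weight `η` with `∇ζ(y) = -η(y) y`, where `ζ` is `potential`. -/
def kernel (y : H) : ℝ := 2 * ((1 - ‖y‖ ^ 2)⁻¹ ^ 2 * expNegInvGlue (1 - ‖y‖ ^ 2))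

theorem potential_eq_zero {y : H} (hy : 1 ≤ ‖y‖) : potential y = 0 :=
  expNegInvGlue.zero_of_nonpos (by nlinarith)

theorem kernel_eq_zero {y : H} (hy : 1 ≤ ‖y‖) : kernel y = 0 := by
  rw [kernel, expNegInvGlue.zero_of_nonpos (by nlinarith), mul_zero, mul_zero]

theorem potential_nonneg (y : H) : 0 ≤ potential y := expNegInvGlue.nonneg _

theorem kernel_nonneg (y : H) : 0 ≤ kernel y :=
  mul_nonneg zero_le_two (mul_nonneg (sq_nonneg _) (expNegInvGlue.nonneg _))

theorem kernel_pos {y : H} (hy : ‖y‖ < 1) : 0 < kernel y := by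
  have hsub : 0 < 1 - ‖y‖ ^ 2 := by nlinarith [norm_nonneg y]
  have hglue := expNegInvGlue.pos_of_pos hsub
  rw [kernel]
  positivity

theorem expNegInvGlue_le_one (s : ℝ) : expNegInvGlue s ≤ 1 := by
  rw [expNegInvGlue]
  split_ifs with hs
  · exact zero_le_one
  · exact Real.exp_le_one_iff.2 (neg_nonpos.2 (inv_nonneg.2 (not_le.1 hs).le))

theorem inv_sq_mul_expNegInvGlue_le_two (s : ℝ) : s⁻¹ ^ 2 * expNegInvGlue s ≤ 2 := by
  rw [expNegInvGlue]
  split_ifs with hs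
  · rw [mul_zero]
    exact zero_le_two
  · rw [Real.exp_neg, ← div_eq_mul_inv, div_le_iff₀ (Real.exp_pos _)]
    have hinv : 0 < s⁻¹ := inv_pos.2 (not_le.1 hs)
    linarith [Real.quadratic_le_exp_of_nonneg hinv.le]

theorem potential_le_one (y : H) : potential y ≤ 1 := expNegInvGlue_le_one _

theorem kernel_le_four (y : H) : kernel y ≤ 4 := by
  rw [kernel]
  linarith [inv_sq_mul_expNegInvGlue_le_two (1 - ‖y‖ ^ 2)]

theorem le_kernel_of_norm_sq_le {y : H} (hy : ‖y‖ ^ 2 ≤ 3 / 4) : 1 / 64 ≤ kernel y := by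
  set q := (1 - ‖y‖ ^ 2)⁻¹ with hq
  have hs : 0 < 1 - ‖y‖ ^ 2 := by linarith
  have hq1 : 1 ≤ q := one_le_inv₀ hs |>.2 (by linarith [sq_nonneg ‖y‖])
  have hq4 : q ≤ 4 := inv_le_of_inv_le₀ (by norm_num) (by linarith)
  have hexp : (1 / 3 : ℝ) ^ 4 ≤ Real.exp (-q) :=
    calc (1 / 3 : ℝ) ^ 4 ≤ Real.exp (-1) ^ 4 := by
          rw [Real.exp_neg, one_div]
          gcongr
          exact Real.exp_one_lt_three.le
      _ = Real.exp (-4) := by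
          rw [← Real.exp_nat_mul]
          norm_num
      _ ≤ Real.exp (-q) := Real.exp_le_exp.2 (neg_le_neg hq4)
  rw [kernel, expNegInvGlue, if_neg hs.not_ge, ← hq]
  nlinarith [one_le_pow₀ hq1 (n := 2)]

theorem hasCompactSupport_of_eq_zero [ProperSpace H] {k : H → ℝ}
    (hk : ∀ y, 1 ≤ ‖y‖ → k y = 0) : HasCompactSupport k :=
  HasCompactSupport.of_support_subset_isCompact (isCompact_closedBall 0 1) fun y hy =>
    mem_closedBall_zero_iff.2 (not_lt.1 fun h => hy (hk y h.le))

variable [InnerProductSpace ℝ H]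

/-- The dilation `z ↦ k ((z - x) / r)`, which carries the unit ball to the ball `B_r(x)`. -/
def dilate (k : H → ℝ) (x : H) (r : ℝ) (z : H) : ℝ := k (r⁻¹ • (z - x))

theorem contDiff_potential : ContDiff ℝ ∞ (potential : H → ℝ) :=
  expNegInvGlue.contDiff.comp (contDiff_const.sub (contDiff_norm_sq ℝ))

theorem contDiff_kernel : ContDiff ℝ ∞ (kernel : H → ℝ) := by
  have hglue := expNegInvGlue.contDiff_polynomial_eval_inv_mul (n := ⊤) (Polynomial.X ^ 2)
  simp only [Polynomial.eval_pow, Polynomial.eval_X] at hglue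
  exact contDiff_const.mul (hglue.comp (contDiff_const.sub (contDiff_norm_sq ℝ)))

theorem dilate_eq_zero {k : H → ℝ} (hk : ∀ y, 1 ≤ ‖y‖ → k y = 0) {x z : H} {r : ℝ}
    (hr : 0 < r) (hz : z ∉ Metric.ball x r) : dilate k x r z = 0 := by
  refine hk _ ?_
  rw [norm_smul, norm_inv, Real.norm_of_nonneg hr.le, ← div_eq_inv_mul, le_div_iff₀ hr, one_mul]
  simpa [dist_eq_norm] using hz

theorem contDiff_dilate {N : ℕ∞ω} {k : H → ℝ} (hk : ContDiff ℝ N k) (x : H) (r : ℝ) :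
    ContDiff ℝ N (dilate k x r) :=
  hk.comp ((contDiff_id.sub contDiff_const).const_smul r⁻¹)

section CompleteSpace

variable [CompleteSpace H]

theorem gradient_potential (y : H) : gradient potential y = -(kernel y • y) := by
  have hglue : HasDerivAt expNegInvGlue ((1 - ‖y‖ ^ 2)⁻¹ ^ 2 * expNegInvGlue (1 - ‖y‖ ^ 2))
      (1 - ‖y‖ ^ 2) := by
    simpa using! expNegInvGlue.hasDerivAt_polynomial_eval_inv_mul 1 (1 - ‖y‖ ^ 2)
  have hsq : HasFDerivAt (fun z : H => 1 - ‖z‖ ^ 2) (-(2 • (innerSL ℝ y))) y :=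
    (hasStrictFDerivAt_norm_sq y).hasFDerivAt.const_sub 1
  refine HasGradientAt.gradient (hasGradientAt_iff_hasFDerivAt.2
    ((hglue.comp_hasFDerivAt y hsq).congr_fderiv ?_))
  ext v
  simp [kernel]
  ring

theorem norm_gradient_potential_le (y : H) : ‖gradient potential y‖ ≤ 4 := by
  rw [gradient_potential, norm_neg, norm_smul, Real.norm_of_nonneg (kernel_nonneg y)]
  rcases le_or_gt 1 ‖y‖ with hy | hy
  · rw [kernel_eq_zero hy, zero_mul]
    exact zero_le_four
  · exact (mul_le_of_le_one_right (kernel_nonneg y) hy.le).trans (kernel_le_four y)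

theorem gradient_dilate {k : H → ℝ} (hk : Differentiable ℝ k) (x : H) (r : ℝ) (z : H) :
    gradient (dilate k x r) z = r⁻¹ • gradient k (r⁻¹ • (z - x)) := by
  have haff : HasFDerivAt (fun z : H => r⁻¹ • (z - x)) (r⁻¹ • ContinuousLinearMap.id ℝ H) z :=
    ((hasFDerivAt_id z).sub_const x).const_smul r⁻¹
  have hfderiv : fderiv ℝ (dilate k x r) z = r⁻¹ • fderiv ℝ k (r⁻¹ • (z - x)) := by
    refine ((hk (r⁻¹ • (z - x))).hasFDerivAt.comp z haff).fderiv.trans ?_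
    ext v
    simp
  simp [gradient, hfderiv]

theorem gradient_dilate_potential (x : H) (r : ℝ) (z : H) :
    gradient (dilate potential x r) z = -((r ^ 2)⁻¹ * dilate kernel x r z) • (z - x) := by
  rw [gradient_dilate (contDiff_potential.differentiable (by simp)), gradient_potential, dilate,
    smul_neg, smul_smul, smul_smul, neg_smul]
  congr 2
  ring

theorem inner_gradient_dilate {k : H → ℝ} (hk : Differentiable ℝ k) (x : H) (r : ℝ) (z : H) :
    inner ℝ (gradient (dilate k x r) z) (z - x)
      = inner ℝ (gradient k (r⁻¹ • (z - x))) (r⁻¹ • (z - x)) := by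
  rw [gradient_dilate hk, real_inner_smul_left, real_inner_smul_right]

theorem hasDerivAt_dilate {k : H → ℝ} (hk : Differentiable ℝ k) (x z : H) {r : ℝ} (hr : r ≠ 0) :
    HasDerivAt (fun s => dilate k x s z)
      (-r⁻¹ * inner ℝ (gradient (dilate k x r) z) (z - x)) r := by
  have haff : HasDerivAt (fun s : ℝ => s⁻¹ • (z - x)) ((-(r ^ 2)⁻¹) • (z - x)) r :=
    (hasDerivAt_inv hr).smul_const (z - x)
  refine ((hk (r⁻¹ • (z - x))).hasFDerivAt.comp_hasDerivAt r haff).congr_deriv ?_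
  rw [inner_gradient_dilate hk, inner_gradient_left, map_smul, map_smul, smul_eq_mul, smul_eq_mul]
  field_simp

theorem exists_abs_inner_gradient_le {k : H → ℝ} (hk : ContDiff ℝ 1 k)
    (hc : HasCompactSupport k) : ∃ M, ∀ y, |inner ℝ (gradient k y) y| ≤ M := by
  refine HasCompactSupport.exists_bound_of_continuous (f := fun y => inner ℝ (gradient k y) y)
    (hc.mono' fun y hy => tsupport_gradient_subset k (subset_tsupport _ fun h => hy ?_))
    ((continuous_gradient hk).inner continuous_id)
  simp only [h, inner_zero_left]

theorem hasDerivAt_integral_dilate_mul [MeasurableSpace H] [OpensMeasurableSpace H]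
    {μ : Measure H} {k f : H → ℝ} (hk : ContDiff ℝ 1 k) (hc : HasCompactSupport k)
    (hf : Integrable f μ) (x : H) {r : ℝ} (hr : 0 < r) :
    HasDerivAt (fun s => ∫ z, dilate k x s z * f z ∂μ)
      (∫ z, (-r⁻¹ * inner ℝ (gradient (dilate k x r) z) (z - x)) * f z ∂μ) r := by
  have hkd : Differentiable ℝ k := hk.differentiable one_ne_zero
  obtain ⟨M, hM⟩ := exists_abs_inner_gradient_le hk hc
  obtain ⟨B, hB⟩ := hc.exists_bound_of_continuous hk.continuous
  have hdilate : ∀ s, Continuous (dilate k x s) := fun s => (contDiff_dilate hk x s).continuous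
  have hgrad : Continuous fun z => inner ℝ (gradient (dilate k x r) z) (z - x) :=
    (continuous_gradient (contDiff_dilate hk x r)).inner (continuous_id.sub continuous_const)
  have hhalf : ∀ s ∈ Metric.ball r (r / 2), r / 2 < s := fun s hs => by
    rw [Metric.mem_ball, Real.dist_eq, abs_lt] at hs
    linarith
  refine (hasDerivAt_integral_of_dominated_loc_of_deriv_le
    (F' := fun s z => (-s⁻¹ * inner ℝ (gradient (dilate k x s) z) (z - x)) * f z)
    (bound := fun z => (2 / r * M) * |f z|) (Metric.ball_mem_nhds r (half_pos hr))
    (Eventually.of_forall fun s => (hdilate s).aestronglyMeasurable.mul hf.1)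
    (hf.bdd_mul (hdilate r).aestronglyMeasurable (Eventually.of_forall fun z => hB _))
    ((continuous_const.mul hgrad).aestronglyMeasurable.mul hf.1)
    (Eventually.of_forall fun z s hs => ?_) (hf.abs.const_mul _)
    (Eventually.of_forall fun z s hs => ?_)).2
  · have hs0 : 0 < s := (half_pos hr).trans (hhalf s hs)
    rw [norm_mul, norm_mul, norm_neg, norm_inv, Real.norm_of_nonneg hs0.le, Real.norm_eq_abs (f z),
      inner_gradient_dilate hkd]
    gcongr
    · rw [inv_le_comm₀ hs0 (by positivity), inv_div]
      exact (hhalf s hs).le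
    · exact hM _
  · exact (hasDerivAt_dilate hkd x z ((half_pos hr).trans (hhalf s hs)).ne').mul_const (f z)

end CompleteSpace

variable {Ω : Set (E n)}

theorem isTestFunction_dilate {k : E n → ℝ} (hk : ContDiff ℝ ∞ k)
    (hk0 : ∀ y, 1 ≤ ‖y‖ → k y = 0) {x : E n} {r : ℝ} (hr : 0 < r)
    (h : Metric.closedBall x r ⊆ Ω) : IsTestFunction Ω (dilate k x r) := by
  have hs : tsupport (dilate k x r) ⊆ Metric.closedBall x r :=
    closure_minimal (fun z hz => by_contra fun hzr => hz (dilate_eq_zero hk0 hr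
      fun hzb => hzr (Metric.ball_subset_closedBall hzb))) Metric.isClosed_closedBall
  exact ⟨contDiff_dilate hk x r, (isCompact_closedBall x r).of_isClosed_subset
    (isClosed_tsupport _) hs, hs.trans h⟩

theorem isTestFunction_dilate_kernel {x : E n} {r : ℝ} (hr : 0 < r)
    (h : Metric.closedBall x r ⊆ Ω) : IsTestFunction Ω (dilate kernel x r) :=
  isTestFunction_dilate contDiff_kernel (fun _ => kernel_eq_zero) hr h

theorem isTestFunction_dilate_potential {x : E n} {r : ℝ} (hr : 0 < r)
    (h : Metric.closedBall x r ⊆ Ω) : IsTestFunction Ω (dilate potential x r) :=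
  isTestFunction_dilate contDiff_potential (fun _ => potential_eq_zero) hr h

theorem integral_dilate (k : E n → ℝ) (x : E n) {r : ℝ} (hr : 0 < r) :
    ∫ z, dilate k x r z = r ^ n * ∫ y, k y := by
  have htranslate : ∫ z, dilate k x r z = ∫ z, k (r⁻¹ • z) :=
    integral_sub_right_eq_self (fun z => k (r⁻¹ • z)) x
  rw [htranslate, Measure.integral_comp_inv_smul]
  simp [abs_of_pos hr]

end Kernel

section RadialMean

variable {Ω : Set (E n)} {f φ : E n → ℝ} {F : E n → E n}

/-- The mean of `f` over the ball of radius `r` about `x` with respect to the weight `η`, up to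
the normalization of `η`. -/
def radialMean (Ω : Set (E n)) (f : E n → ℝ) (x : E n) (r : ℝ) : ℝ :=
  (r ^ n)⁻¹ * ∫ z in Ω, dilate kernel x r z * f z

theorem gradient_mul_coord_sub (hφ : Differentiable ℝ φ) (x z : E n) (j : Fin n) :
    gradient (fun y => φ y * (y j - x j)) z j = φ z + (z - x) j * gradient φ z j := by
  have hcoord : HasGradientAt (fun y : E n => y j - x j) (EuclideanSpace.single j 1) z := by
    rw [hasGradientAt_iff_hasFDerivAt]
    refine ((EuclideanSpace.proj (𝕜 := ℝ) j).hasFDerivAt.sub_const (x j)).congr_fderiv ?_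
    ext v
    simp [EuclideanSpace.inner_single_left]
  rw [gradient_mul (hφ z) hcoord.differentiableAt, hcoord.gradient]
  simp

theorem IsWeakGradient.integral_div_smul_sub (hf : IsWeakGradient Ω f F)
    (hφ : IsTestFunction Ω φ) (x : E n) :
    ∫ z in Ω, f z * (n * φ z + inner ℝ (gradient φ z) (z - x))
      = -∫ z in Ω, φ z * inner ℝ (F z) (z - x) := by
  have htest : ∀ j : Fin n, IsTestFunction Ω fun z => φ z * (z j - x j) := fun j =>
    hφ.mul (by fun_prop)
  have hleft : ∀ j, IntegrableOn (fun z => f z * (φ z + (z - x) j * gradient φ z j)) Ω :=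
    fun j => by
      simpa [gradient_mul_coord_sub hφ.differentiable] using
        ((EuclideanSpace.proj (𝕜 := ℝ) j).integrable_comp
          ((htest j).integrable_smul_gradient hf.1)).integrableOn (s := Ω)
  have hright : ∀ j, IntegrableOn (fun z => φ z * (z - x) j * F z j) Ω := fun j => by
    simpa using ((EuclideanSpace.proj (𝕜 := ℝ) j).integrable_comp
      ((htest j).integrable_smul hf.2.1)).integrableOn (s := Ω)
  have hparts : ∀ j, ∫ z in Ω, f z * (φ z + (z - x) j * gradient φ z j)
      = -∫ z in Ω, φ z * (z - x) j * F z j := fun j => by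
    have h := congrArg (EuclideanSpace.proj (𝕜 := ℝ) j) (hf.2.2 _ (htest j))
    rw [map_neg, ← ContinuousLinearMap.integral_comp_comm _
      ((htest j).integrable_smul_gradient hf.1).integrableOn,
      ← ContinuousLinearMap.integral_comp_comm _ ((htest j).integrable_smul hf.2.1).integrableOn]
      at h
    simpa [gradient_mul_coord_sub hφ.differentiable] using h
  calc ∫ z in Ω, f z * (n * φ z + inner ℝ (gradient φ z) (z - x))
      = ∫ z in Ω, ∑ j, f z * (φ z + (z - x) j * gradient φ z j) := by
        simp only [← Finset.mul_sum, Finset.sum_add_distrib, Finset.sum_const, Finset.card_univ,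
          Fintype.card_fin, nsmul_eq_mul, PiLp.inner_apply, RCLike.inner_apply, conj_trivial]
    _ = ∑ j, -∫ z in Ω, φ z * (z - x) j * F z j := by
        rw [integral_finsetSum _ fun j _ => hleft j]
        exact Finset.sum_congr rfl fun j _ => hparts j
    _ = -∫ z in Ω, φ z * inner ℝ (F z) (z - x) := by
        rw [Finset.sum_neg_distrib, ← integral_finsetSum _ fun j _ => hright j]
        simp only [PiLp.inner_apply, RCLike.inner_apply, conj_trivial, Finset.mul_sum, mul_assoc]

theorem hasDerivAt_inv_pow (n : ℕ) {r : ℝ} (hr : r ≠ 0) :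
    HasDerivAt (fun s : ℝ => (s ^ n)⁻¹) (-(n * r⁻¹) * (r ^ n)⁻¹) r := by
  refine ((hasDerivAt_pow n r).inv (pow_ne_zero n hr)).congr_deriv ?_
  rcases n with _ | k
  · simp
  · rw [Nat.add_sub_cancel]
    field_simp
    ring

/- The derivative in `r` is a divergence: `n η_r f + ⟨∇η_r, z - x⟩ f` integrates to
`-∫ η_r ⟨F, z - x⟩`, and `η_r (z - x) = -r² ∇ζ_r`. -/
theorem hasDerivAt_radialMean (hf : IsWeakGradient Ω f F) (hfi : IntegrableOn f Ω) {x : E n}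
    {r : ℝ} (hr : 0 < r) (h : Metric.closedBall x r ⊆ Ω) :
    HasDerivAt (radialMean Ω f x)
      (-((r ^ n)⁻¹ * r * ∫ z in Ω, inner ℝ (F z) (gradient (dilate potential x r) z))) r := by
  have htest := isTestFunction_dilate_kernel hr h
  have hkernel : IntegrableOn (fun z => dilate kernel x r z * f z) Ω :=
    (htest.integrable_smul hf.1).integrableOn
  have hradial : IntegrableOn
      (fun z => f z * inner ℝ (gradient (dilate kernel x r) z) (z - x)) Ω := by
    obtain ⟨M, hM⟩ := exists_abs_inner_gradient_le (H := E n) (contDiff_kernel.of_le (by simp))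
      (hasCompactSupport_of_eq_zero fun _ => kernel_eq_zero)
    refine hfi.mul_bdd (c := M) ((continuous_gradient htest.contDiff_one).inner
      (continuous_id.sub continuous_const)).aestronglyMeasurable (Eventually.of_forall fun z => ?_)
    rw [inner_gradient_dilate (contDiff_kernel.differentiable (by simp)), Real.norm_eq_abs]
    exact hM _
  have hdiv : r⁻¹ * (n * (∫ z in Ω, dilate kernel x r z * f z)
      + ∫ z in Ω, f z * inner ℝ (gradient (dilate kernel x r) z) (z - x))
      = r * ∫ z in Ω, inner ℝ (F z) (gradient (dilate potential x r) z) := by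
    rw [inv_mul_eq_iff_eq_mul₀ hr.ne', ← mul_assoc, ← integral_const_mul,
      ← integral_add (hkernel.const_mul _) hradial, ← integral_const_mul]
    refine Eq.trans ?_ ((hf.integral_div_smul_sub htest x).trans ?_)
    · exact integral_congr_ae (Eventually.of_forall fun z => by ring)
    · rw [← integral_neg]
      refine integral_congr_ae (Eventually.of_forall fun z => ?_)
      simp only [gradient_dilate_potential, real_inner_smul_right]
      field_simp
  have hderiv : ∫ z in Ω, -r⁻¹ * inner ℝ (gradient (dilate kernel x r) z) (z - x) * f z
      = -r⁻¹ * ∫ z in Ω, f z * inner ℝ (gradient (dilate kernel x r) z) (z - x) := by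
    rw [← integral_const_mul]
    exact integral_congr_ae (Eventually.of_forall fun z => by ring)
  refine ((hasDerivAt_inv_pow n hr.ne').mul (hasDerivAt_integral_dilate_mul
    (contDiff_kernel.of_le (by simp)) (hasCompactSupport_of_eq_zero fun _ => kernel_eq_zero)
    hfi x hr)).congr_deriv ?_
  rw [hderiv]
  linear_combination (-(r ^ n)⁻¹) * hdiv

end RadialMean

section Perturbation

variable {Ω : Set (E n)} {Q p : E n → ℝ} {g u v : E n → E m} {P : E n → E n} {i : Fin m} {x : E n}

/-- The function obtained from `u` by adding `p` to its `i`-th component. -/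
def perturb (u : E n → E m) (i : Fin m) (p : E n → ℝ) (x : E n) : E m :=
  u x + p x • EuclideanSpace.single i 1

theorem perturb_apply (u : E n → E m) (i : Fin m) (p : E n → ℝ) (x : E n) (j : Fin m) :
    perturb u i p x j = u x j + (if j = i then 1 else 0) * p x := by
  by_cases h : j = i <;> simp [perturb, h]

theorem perturb_apply_self (u : E n → E m) (i : Fin m) (p : E n → ℝ) (x : E n) :
    perturb u i p x i = u x i + p x := by
  simp [perturb]

theorem perturb_of_eq_zero (u : E n → E m) (i : Fin m) (h : p x = 0) :
    perturb u i p x = u x := by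
  simp [perturb, h]

theorem MemH1Vec.perturb (hu : MemH1Vec Ω u) (i : Fin m) (hp : MemH1 Ω p) :
    MemH1Vec Ω (perturb u i p) := fun j => by
  simp only [perturb_apply]
  exact (hu j).add (hp.const_mul _)

theorem Admissible.perturb (hΩ : IsOpen Ω) (hu : Admissible Ω g u) (hp : MemH10 Ω p)
    (h0 : ∀ᵐ x ∂volume.restrict Ω, 0 ≤ u x i + p x) : Admissible Ω g (perturb u i p) := by
  refine ⟨MemH1Vec.perturb hu.1 i hp.1, fun j => ?_, fun j => ?_⟩
  · simp only [perturb_apply, add_sub_right_comm]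
    exact (hu.2.1 j).add hΩ (hp.const_mul hΩ _)
  · by_cases h : j = i
    · simpa only [h, perturb_apply_self] using h0
    · simpa only [perturb_apply, if_neg h, zero_mul, add_zero] using hu.2.2 j

theorem posChar_nonneg (u : E n → E m) (x : E n) : 0 ≤ posChar u x :=
  indicator_nonneg (fun _ _ => zero_le_one) x

theorem posChar_le_one (u : E n → E m) (x : E n) : posChar u x ≤ 1 :=
  indicator_le' (fun _ _ => le_rfl) (fun _ _ => zero_le_one) x

theorem posChar_of_pos (h : 0 < ‖u x‖) : posChar u x = 1 :=
  indicator_of_mem (s := {x | 0 < ‖u x‖}) h _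

theorem posChar_congr (h : u x = v x) : posChar u x = posChar v x := by
  simp only [posChar, indicator, mem_ofPred_eq, h]

theorem norm_pos_of_apply_pos {v : E m} (h : 0 < v i) : 0 < ‖v‖ := by
  refine norm_pos_iff.2 ?_
  rintro rfl
  simp at h

theorem exists_apply_pos_of_norm_pos {v : E m} (hv : ∀ j, 0 ≤ v j) (h : 0 < ‖v‖) :
    ∃ j, 0 < v j := by
  by_contra! hne
  refine h.ne' (norm_eq_zero.2 ?_)
  ext j
  exact le_antisymm (hne j) (hv j)

theorem MemH1Vec.aestronglyMeasurable (hu : MemH1Vec Ω u) :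
    AEStronglyMeasurable u (volume.restrict Ω) :=
  ((WithLp.measurable_toLp 2 (Fin m → ℝ)).comp_aemeasurable
    (aemeasurable_pi_lambda _ fun i => (hu i).1.1.aemeasurable)).aestronglyMeasurable

theorem MemH1Vec.aestronglyMeasurable_posChar (hu : MemH1Vec Ω u) :
    AEStronglyMeasurable (posChar u) (volume.restrict Ω) :=
  ((measurable_const.indicator measurableSet_Ioi :
    Measurable (indicator (Ioi (0 : ℝ)) fun _ => (1 : ℝ))).comp_aemeasurable
      hu.aestronglyMeasurable.norm.aemeasurable).aestronglyMeasurable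

theorem MemH1Vec.integrableOn_sq_mul_posChar (hu : MemH1Vec Ω u)
    (hQ : IntegrableOn (fun x => Q x ^ 2) Ω) : IntegrableOn (fun x => Q x ^ 2 * posChar u x) Ω :=
  hQ.mul_bdd (c := 1) hu.aestronglyMeasurable_posChar (Eventually.of_forall fun x => by
    rw [Real.norm_of_nonneg (posChar_nonneg u x)]
    exact posChar_le_one u x)

theorem J_eq_add (hΩ : IsOpen Ω) (hu : MemH1Vec Ω u) (hQ : IntegrableOn (fun x => Q x ^ 2) Ω) :
    J Ω Q u = (∑ j, ∫ x in Ω, ‖weakGradient Ω (fun y => u y j) x‖ ^ 2)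
      + ∫ x in Ω, Q x ^ 2 * posChar u x := by
  have hinteg : ∀ j, IntegrableOn (fun x => ‖weakGradient Ω (fun y => u y j) x‖ ^ 2) Ω := fun j =>
    integrable_norm_sq ((hu j).memLp_weakGradient hΩ)
  rw [J, integral_add (integrable_finsetSum _ fun j _ => hinteg j)
    (hu.integrableOn_sq_mul_posChar hQ), integral_finsetSum _ fun j _ => hinteg j]

theorem integral_norm_sq_weakGradient_perturb (hΩ : IsOpen Ω) (hu : MemH1Vec Ω u) (i : Fin m)
    (hP : IsWeakGradient Ω p P) (hP2 : MemLp P 2 (volume.restrict Ω)) (j : Fin m) :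
    ∫ x in Ω, ‖weakGradient Ω (fun y => perturb u i p y j) x‖ ^ 2
      = (∫ x in Ω, ‖weakGradient Ω (fun y => u y j) x‖ ^ 2)
        + if j = i then 2 * (∫ x in Ω, inner ℝ (weakGradient Ω (fun y => u y i) x) (P x))
          + ∫ x in Ω, ‖P x‖ ^ 2 else 0 := by
  by_cases h : j = i
  · subst h
    have hU2 := (hu j).memLp_weakGradient hΩ
    have hinner := (integrable_inner_of_memLp hU2 hP2).const_mul 2
    have hsum : IntegrableOn (fun x =>
        2 * inner ℝ (weakGradient Ω (fun y => u y j) x) (P x) + ‖P x‖ ^ 2) Ω :=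
      hinner.add (integrable_norm_sq hP2)
    rw [if_pos rfl, ← integral_const_mul, ← integral_add hinner (integrable_norm_sq hP2),
      ← integral_add (integrable_norm_sq hU2) hsum]
    simp only [perturb_apply_self]
    refine integral_congr_ae ?_
    filter_upwards [((hu j).isWeakGradient.add hP).weakGradient_ae_eq hΩ] with x hx
    rw [hx, norm_add_sq_real, add_assoc]
  · simp only [perturb_apply, if_neg h, zero_mul, add_zero]

theorem J_perturb (hΩ : IsOpen Ω) (hu : MemH1Vec Ω u) (hQ : IntegrableOn (fun x => Q x ^ 2) Ω)
    (i : Fin m) (hp : MemLp p 2 (volume.restrict Ω)) (hP : IsWeakGradient Ω p P)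
    (hP2 : MemLp P 2 (volume.restrict Ω)) :
    J Ω Q (perturb u i p) = J Ω Q u
      + (2 * ∫ x in Ω, inner ℝ (weakGradient Ω (fun y => u y i) x) (P x))
      + (∫ x in Ω, ‖P x‖ ^ 2)
      + ∫ x in Ω, Q x ^ 2 * (posChar (perturb u i p) x - posChar u x) := by
  have hup : MemH1Vec Ω (perturb u i p) := MemH1Vec.perturb hu i ⟨hp, P, hP, hP2⟩
  rw [J_eq_add hΩ hup hQ, J_eq_add hΩ hu hQ,
    Finset.sum_congr rfl fun j _ => integral_norm_sq_weakGradient_perturb hΩ hu i hP hP2 j,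
    Finset.sum_add_distrib, Finset.sum_ite_eq' Finset.univ i, if_pos (Finset.mem_univ i)]
  simp only [mul_sub]
  rw [integral_sub (hup.integrableOn_sq_mul_posChar hQ) (hu.integrableOn_sq_mul_posChar hQ)]
  ring

theorem h1Norm_sub_perturb (hΩ : IsOpen Ω) (u : E n → E m) (i : Fin m) (hp : MemH1 Ω p) :
    h1Norm Ω (fun x => u x - perturb u i p x) = Real.sqrt (h1NormSq Ω p) := by
  have hcomp : ∀ j, h1NormSq Ω (fun x => (u x - perturb u i p x) j)
      = if j = i then h1NormSq Ω p else 0 := fun j => by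
    have hdiff : (fun x => (u x - perturb u i p x) j)
        = fun x => (if j = i then (-1 : ℝ) else 0) * p x := by
      ext x
      rw [PiLp.sub_apply, perturb_apply]
      split_ifs <;> ring
    rw [hdiff, hp.h1NormSq_const_mul hΩ]
    by_cases h : j = i <;> simp [h]
  rw [h1Norm, Finset.sum_congr rfl fun j _ => hcomp j, Finset.sum_ite_eq' Finset.univ i,
    if_pos (Finset.mem_univ i)]

end Perturbation

section Minimizers

/-- `u` minimizes `J` among the admissible functions at distance less than `ε` from `u`, for a
coefficient with `|Q| ≤ Qmax`; this covers absolute and local minimizers alike. -/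
structure IsMinimizerWithin (Ω : Set (E n)) (Q : E n → ℝ) (Qmax : ℝ) (g u : E n → E m) (ε : ℝ) :
    Prop where
  isOpen : IsOpen Ω
  isBounded : Bornology.IsBounded Ω
  aemeasurable : AEMeasurable Q (volume.restrict Ω)
  pos : 0 < Qmax
  abs_le : ∀ᵐ x ∂volume.restrict Ω, |Q x| ≤ Qmax
  admissible : Admissible Ω g u
  eps_pos : 0 < ε
  le : ∀ v, Admissible Ω g v → d Ω u v < ε → J Ω Q u ≤ J Ω Q v

namespace IsMinimizerWithin

variable {Ω : Set (E n)} {Q p : E n → ℝ} {Qmax ε : ℝ} {g u : E n → E m} {P : E n → E n}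

theorem memH1 (h : IsMinimizerWithin Ω Q Qmax g u ε) (i : Fin m) : MemH1 Ω fun x => u x i :=
  h.admissible.1 i

theorem nonneg (h : IsMinimizerWithin Ω Q Qmax g u ε) (i : Fin m) :
    ∀ᵐ z ∂volume.restrict Ω, 0 ≤ u z i := h.admissible.2.2 i

theorem isFiniteMeasure (h : IsMinimizerWithin Ω Q Qmax g u ε) :
    IsFiniteMeasure (volume.restrict Ω) :=
  ⟨by simpa using h.isBounded.measure_lt_top⟩

theorem integrableOn (h : IsMinimizerWithin Ω Q Qmax g u ε) (i : Fin m) :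
    IntegrableOn (fun x => u x i) Ω :=
  have := h.isFiniteMeasure
  (h.memH1 i).1.integrable one_le_two

theorem ae_sq_le (h : IsMinimizerWithin Ω Q Qmax g u ε) :
    ∀ᵐ x ∂volume.restrict Ω, Q x ^ 2 ≤ Qmax ^ 2 := by
  filter_upwards [h.abs_le] with x hx
  exact sq_le_sq' (neg_le_of_abs_le hx) (le_of_abs_le hx)

theorem integrableOn_sq (h : IsMinimizerWithin Ω Q Qmax g u ε) :
    IntegrableOn (fun x => Q x ^ 2) Ω := by
  have := h.isFiniteMeasure
  refine Integrable.of_bound (h.aemeasurable.pow_const 2).aestronglyMeasurable (Qmax ^ 2) ?_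
  filter_upwards [h.ae_sq_le] with x hx
  rwa [Real.norm_of_nonneg (sq_nonneg _)]

theorem increment_nonneg (h : IsMinimizerWithin Ω Q Qmax g u ε) {i : Fin m} (hp : MemH10 Ω p)
    (hP : IsWeakGradient Ω p P) (hP2 : MemLp P 2 (volume.restrict Ω))
    (h0 : ∀ᵐ x ∂volume.restrict Ω, 0 ≤ u x i + p x) (hd : d Ω u (perturb u i p) < ε) :
    0 ≤ (2 * ∫ x in Ω, inner ℝ (weakGradient Ω (fun y => u y i) x) (P x))
      + (∫ x in Ω, ‖P x‖ ^ 2)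
      + ∫ x in Ω, Q x ^ 2 * (posChar (perturb u i p) x - posChar u x) := by
  have hle := h.le _ (h.admissible.perturb h.isOpen hp h0) hd
  rw [J_perturb h.isOpen h.admissible.1 h.integrableOn_sq i hp.1.1 hP hP2] at hle
  linarith

theorem increment_nonneg_of_posChar_eq (h : IsMinimizerWithin Ω Q Qmax g u ε) {i : Fin m}
    (hp : MemH10 Ω p) (hP : IsWeakGradient Ω p P) (hP2 : MemLp P 2 (volume.restrict Ω))
    (h0 : ∀ᵐ x ∂volume.restrict Ω, 0 ≤ u x i + p x)
    (hχ : ∀ᵐ x ∂volume.restrict Ω, posChar (perturb u i p) x = posChar u x)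
    (hε : Real.sqrt (h1NormSq Ω p) < ε) :
    0 ≤ (2 * ∫ x in Ω, inner ℝ (weakGradient Ω (fun y => u y i) x) (P x))
      + ∫ x in Ω, ‖P x‖ ^ 2 := by
  have hdist : ∫ x in Ω, |posChar u x - posChar (perturb u i p) x| = 0 :=
    integral_eq_zero_of_ae (hχ.mono fun x hx => by simp [hx])
  have hincr : ∫ x in Ω, Q x ^ 2 * (posChar (perturb u i p) x - posChar u x) = 0 :=
    integral_eq_zero_of_ae (hχ.mono fun x hx => by simp [hx])
  have hle := h.increment_nonneg hp hP hP2 h0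
    (by rwa [d, hdist, add_zero, h1Norm_sub_perturb h.isOpen u i hp.1])
  rwa [hincr, add_zero] at hle

theorem first_variation_nonneg (h : IsMinimizerWithin Ω Q Qmax g u ε) {i : Fin m}
    (hp : MemH10 Ω p) (hP : IsWeakGradient Ω p P) (hP2 : MemLp P 2 (volume.restrict Ω))
    {t₀ : ℝ} (ht₀ : 0 < t₀)
    (h0 : ∀ t ∈ Ioo 0 t₀, ∀ᵐ x ∂volume.restrict Ω, 0 ≤ u x i + t * p x)
    (hχ : ∀ t ∈ Ioo 0 t₀, ∀ᵐ x ∂volume.restrict Ω,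
      posChar (perturb u i fun y => t * p y) x = posChar u x) :
    0 ≤ ∫ x in Ω, inner ℝ (weakGradient Ω (fun y => u y i) x) (P x) := by
  set A := ∫ x in Ω, inner ℝ (weakGradient Ω (fun y => u y i) x) (P x)
  set B := ∫ x in Ω, ‖P x‖ ^ 2
  have hquot : ∀ t ∈ Ioo 0 t₀, t * Real.sqrt (h1NormSq Ω p) < ε → 0 ≤ 2 * A + t * B := by
    intro t ht htε
    have hle := h.increment_nonneg_of_posChar_eq (hp.const_mul h.isOpen t) (hP.const_mul t)
      (hP2.const_smul t) (h0 t ht) (hχ t ht) (by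
        rwa [hp.1.h1NormSq_const_mul h.isOpen, Real.sqrt_mul (sq_nonneg t), Real.sqrt_sq ht.1.le])
    simp only [real_inner_smul_right, norm_smul, mul_pow, Real.norm_eq_abs, sq_abs,
      integral_const_mul] at hle
    exact nonneg_of_mul_nonneg_right (by linarith : 0 ≤ t * (2 * A + t * B)) ht.1
  have hlim : Tendsto (fun t : ℝ => 2 * A + t * B) (𝓝[>] 0) (𝓝 (2 * A)) := by
    have hcont : Continuous fun t : ℝ => 2 * A + t * B := by fun_prop
    simpa using (hcont.tendsto 0).mono_left nhdsWithin_le_nhds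
  have hsmall : ∀ᶠ t in 𝓝[>] (0 : ℝ), t * Real.sqrt (h1NormSq Ω p) < ε := by
    have hcont : Continuous fun t : ℝ => t * Real.sqrt (h1NormSq Ω p) := by fun_prop
    exact (hcont.continuousAt.eventually_lt_const
      (by simpa using h.eps_pos)).filter_mono nhdsWithin_le_nhds
  have hA : 0 ≤ 2 * A := ge_of_tendsto hlim (by
    filter_upwards [Ioo_mem_nhdsGT ht₀, hsmall] with t ht htε using hquot t ht htε)
  linarith

end IsMinimizerWithin

end Minimizers

section RegularizedAbs

/-- The smooth approximation `√(s² + δ²)` of `|s|`. -/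
def regAbs (δ s : ℝ) : ℝ := Real.sqrt (s ^ 2 + δ ^ 2)

theorem abs_le_regAbs (δ s : ℝ) : |s| ≤ regAbs δ s :=
  Real.abs_le_sqrt (le_add_of_nonneg_right (sq_nonneg δ))

theorem le_regAbs (δ s : ℝ) : δ ≤ regAbs δ s :=
  Real.le_sqrt_of_sq_le (le_add_of_nonneg_left (sq_nonneg s))

theorem regAbs_le {δ : ℝ} (hδ : 0 ≤ δ) (s : ℝ) : regAbs δ s ≤ |s| + δ :=
  Real.sqrt_le_iff.2 ⟨by positivity, by nlinarith [sq_abs s, abs_nonneg s]⟩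

variable {δ : ℝ}

theorem regAbs_pos (hδ : 0 < δ) (s : ℝ) : 0 < regAbs δ s :=
  hδ.trans_le (le_regAbs δ s)

theorem continuous_regAbs (δ : ℝ) : Continuous (regAbs δ) :=
  ((continuous_pow 2).add continuous_const).sqrt

theorem continuous_div_regAbs (hδ : 0 < δ) : Continuous fun s => s / regAbs δ s :=
  continuous_id.div (continuous_regAbs δ) fun s => (regAbs_pos hδ s).ne'

theorem hasDerivAt_regAbs (hδ : 0 < δ) (s : ℝ) : HasDerivAt (regAbs δ) (s / regAbs δ s) s := by
  have hsq : HasDerivAt (fun s : ℝ => s ^ 2 + δ ^ 2) (2 * s) s := by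
    simpa using (hasDerivAt_pow 2 s).add_const (δ ^ 2)
  refine (hsq.sqrt (by positivity)).congr_deriv ?_
  rw [regAbs]
  field_simp

theorem hasDerivAt_div_regAbs (hδ : 0 < δ) (s : ℝ) :
    HasDerivAt (fun s => s / regAbs δ s) (δ ^ 2 / regAbs δ s ^ 3) s := by
  have hpos := regAbs_pos hδ s
  refine ((hasDerivAt_id' s).div (hasDerivAt_regAbs hδ s) hpos.ne').congr_deriv ?_
  have hsq : regAbs δ s ^ 2 = s ^ 2 + δ ^ 2 := Real.sq_sqrt (by positivity)
  field_simp
  linarith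

theorem abs_div_regAbs_le_one (hδ : 0 < δ) (s : ℝ) : |s / regAbs δ s| ≤ 1 := by
  rw [abs_div, abs_of_pos (regAbs_pos hδ s)]
  exact div_le_one_of_le₀ (abs_le_regAbs δ s) (regAbs_pos hδ s).le

theorem sq_div_regAbs_pow_three_le (hδ : 0 < δ) (s : ℝ) : δ ^ 2 / regAbs δ s ^ 3 ≤ δ⁻¹ :=
  calc δ ^ 2 / regAbs δ s ^ 3 ≤ δ ^ 2 / δ ^ 3 := by
        gcongr
        exact le_regAbs δ s
    _ = δ⁻¹ := by field_simp

end RegularizedAbs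

section Harmonicity

variable {Ω : Set (E n)} {f g : E n → ℝ} {F : E n → E n} {x : E n} {R r : ℝ}

theorem monotoneOn_radialMean (hf : IsWeakGradient Ω f F) (hfi : IntegrableOn f Ω)
    (hxR : Metric.ball x R ⊆ Ω) (h : ∀ r ∈ Ioo 0 R,
      ∫ z in Ω, inner ℝ (F z) (gradient (dilate potential x r) z) ≤ 0) :
    MonotoneOn (radialMean Ω f x) (Ioo 0 R) := by
  have hd : ∀ r ∈ Ioo 0 R, HasDerivAt (radialMean Ω f x) _ r := fun r hr =>
    hasDerivAt_radialMean hf hfi hr.1 ((Metric.closedBall_subset_ball hr.2).trans hxR)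
  refine monotoneOn_of_hasDerivWithinAt_nonneg (convex_Ioo 0 R)
    (fun r hr => (hd r hr).continuousAt.continuousWithinAt)
    (fun r hr => (hd r (interior_subset hr)).hasDerivWithinAt) fun r hr => ?_
  obtain ⟨hr0, -⟩ := interior_subset hr
  exact neg_nonneg.2 (mul_nonpos_of_nonneg_of_nonpos (by positivity) (h r (interior_subset hr)))

theorem antitoneOn_radialMean_sub (hf : IsWeakGradient Ω f F) (hfi : IntegrableOn f Ω)
    (hxR : Metric.ball x R ⊆ Ω) {c : ℝ} (h : ∀ r ∈ Ioo 0 R,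
      -((r ^ n)⁻¹ * r * ∫ z in Ω, inner ℝ (F z) (gradient (dilate potential x r) z)) ≤ c) :
    AntitoneOn (fun r => radialMean Ω f x r - c * r) (Ioo 0 R) := by
  have hd : ∀ r ∈ Ioo 0 R, HasDerivAt (fun r => radialMean Ω f x r - c * r) _ r := fun r hr =>
    (hasDerivAt_radialMean hf hfi hr.1 ((Metric.closedBall_subset_ball hr.2).trans hxR)).sub
      ((hasDerivAt_id' r).const_mul c)
  refine antitoneOn_of_hasDerivWithinAt_nonpos (convex_Ioo 0 R)
    (fun r hr => (hd r hr).continuousAt.continuousWithinAt)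
    (fun r hr => (hd r (interior_subset hr)).hasDerivWithinAt) fun r hr => ?_
  linarith [h r (interior_subset hr)]

theorem integrableOn_dilate_kernel_mul (hf : IntegrableOn f Ω) (x : E n) (r : ℝ) :
    IntegrableOn (fun z => dilate kernel x r z * f z) Ω :=
  hf.bdd_mul (c := 4) (contDiff_dilate contDiff_kernel x r).continuous.aestronglyMeasurable
    (Eventually.of_forall fun z => by
      rw [dilate, Real.norm_of_nonneg (kernel_nonneg _)]
      exact kernel_le_four _)

theorem radialMean_mono (hf : IntegrableOn f Ω) (hg : IntegrableOn g Ω)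
    (hfg : ∀ᵐ z ∂volume.restrict Ω, f z ≤ g z) (x : E n) (hr : 0 < r) :
    radialMean Ω f x r ≤ radialMean Ω g x r := by
  refine mul_le_mul_of_nonneg_left (integral_mono_ae (integrableOn_dilate_kernel_mul hf x r)
    (integrableOn_dilate_kernel_mul hg x r) ?_) (by positivity)
  filter_upwards [hfg] with z hz
  exact mul_le_mul_of_nonneg_left hz (kernel_nonneg _)

theorem radialMean_nonneg (hf : ∀ᵐ z ∂volume.restrict Ω, 0 ≤ f z) (x : E n) (hr : 0 < r) :
    0 ≤ radialMean Ω f x r := by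
  refine mul_nonneg (by positivity) (integral_nonneg_of_ae ?_)
  filter_upwards [hf] with z hz
  exact mul_nonneg (kernel_nonneg _) hz

theorem radialMean_add_const [IsFiniteMeasure (volume.restrict Ω)] (hf : IntegrableOn f Ω) (c : ℝ)
    (x : E n) (r : ℝ) :
    radialMean Ω (fun z => f z + c) x r
      = radialMean Ω f x r + c * radialMean Ω (fun _ => 1) x r := by
  have hone : IntegrableOn (fun z => dilate kernel x r z * 1) Ω :=
    integrableOn_dilate_kernel_mul (integrable_const 1) x r
  have hsplit : ∀ z, dilate kernel x r z * (f z + c)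
      = dilate kernel x r z * f z + c * (dilate kernel x r z * 1) := fun z => by ring
  simp only [radialMean, hsplit]
  rw [integral_add (integrableOn_dilate_kernel_mul hf x r) (hone.const_mul c), integral_const_mul]
  ring

end Harmonicity

section Minimizers

variable {Ω : Set (E n)} {Q φ p : E n → ℝ} {Qmax ε : ℝ} {g u : E n → E m} {i : Fin m} {x : E n}
  {θ θ' : ℝ → ℝ} {L M : ℝ}

theorem posChar_perturb_of_apply_pos (hu : 0 < u x i) (hp : 0 < u x i + p x) :
    posChar (perturb u i p) x = posChar u x := by
  rw [posChar_of_pos (norm_pos_of_apply_pos hu),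
    posChar_of_pos (norm_pos_of_apply_pos (i := i) (by rwa [perturb_apply_self]))]

theorem posChar_perturb_of_nonneg (hu : ∀ j, 0 ≤ u x j) (hpos : 0 < ‖u x‖) (hp : 0 ≤ p x) :
    posChar (perturb u i p) x = posChar u x := by
  obtain ⟨j, hj⟩ := exists_apply_pos_of_norm_pos hu hpos
  refine (posChar_of_pos (norm_pos_of_apply_pos (i := j) ?_)).trans (posChar_of_pos hpos).symm
  rw [perturb_apply]
  exact add_pos_of_pos_of_nonneg hj (mul_nonneg (by split_ifs <;> simp) hp)

theorem exists_forall_abs_mul_lt (hφ : IsTestFunction Ω φ) (hd : ∀ s, HasDerivAt θ (θ' s) s)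
    (hL : ∀ s, |θ' s| ≤ L) (hθ0 : θ 0 = 0) :
    ∃ t₀ > 0, ∀ t ∈ Ioo 0 t₀, ∀ x, ∀ s > 0, |t * (φ x * θ s)| < s := by
  obtain ⟨C, hC⟩ := hφ.exists_abs_le
  have hC0 : 0 ≤ C := (abs_nonneg _).trans (hC 0)
  have hL0 : 0 ≤ L := (abs_nonneg _).trans (hL 0)
  refine ⟨1 / (C * L + 1), by positivity, fun t ht x s hs => ?_⟩
  have hθ : |θ s| ≤ L * s := by
    simpa [hθ0, hL0, abs_of_pos hs] using (lipschitzWith_of_abs_hasDerivAt_le hd hL).dist_le_mul s 0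
  have htC : t * (C * L + 1) < 1 := (lt_div_iff₀ (by positivity)).1 ht.2
  calc |t * (φ x * θ s)| = t * (|φ x| * |θ s|) := by rw [abs_mul, abs_mul, abs_of_pos ht.1]
    _ ≤ t * (C * (L * s)) := by
        have := ht.1.le
        gcongr
        exact hC x
    _ < s := by nlinarith [mul_pos ht.1 hs]

namespace IsMinimizerWithin

theorem integral_inner_variation_nonneg (h : IsMinimizerWithin Ω Q Qmax g u ε) (i : Fin m)
    (hφ : IsTestFunction Ω φ) (hd : ∀ s, HasDerivAt θ (θ' s) s) (hc : Continuous θ')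
    (hL : ∀ s, |θ' s| ≤ L) (hθ0 : θ 0 = 0) :
    0 ≤ ∫ x in Ω, inner ℝ (weakGradient Ω (fun y => u y i) x)
      (φ x • θ' (u x i) • weakGradient Ω (fun y => u y i) x + θ (u x i) • gradient φ x) := by
  have hu2 := (h.memH1 i).1
  have hF2 := (h.memH1 i).memLp_weakGradient h.isOpen
  have hθw := (h.memH1 i).isWeakGradient.comp h.isOpen hu2 hF2 hd hc hL
  have hθu2 : MemLp (fun x => θ (u x i)) 2 (volume.restrict Ω) :=
    (lipschitzWith_of_abs_hasDerivAt_le hd hL).comp_memLp hθ0 hu2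
  have hθF2 := memLp_comp_smul hu2.1 hF2 hc hL
  obtain ⟨t₀, ht₀, hsmall⟩ := exists_forall_abs_mul_lt hφ hd hL hθ0
  refine h.first_variation_nonneg (MemH1.memH10_isTestFunction_mul h.isOpen hφ
    ⟨hθu2, _, hθw, hθF2⟩) ((hθw.univ_of_isTestFunction_mul hφ).mono (subset_univ _))
    ((hφ.memLp_gradient_mul h.isOpen hθu2 hθF2).restrict Ω) ht₀ (fun t ht => ?_) fun t ht => ?_
  · filter_upwards [h.nonneg i] with x hx
    rcases hx.eq_or_lt with hx0 | hx0
    · simp [← hx0, hθ0]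
    · linarith [(abs_lt.1 (hsmall t ht x _ hx0)).1]
  · filter_upwards [h.nonneg i] with x hx
    rcases hx.eq_or_lt with hx0 | hx0
    · exact posChar_congr (perturb_of_eq_zero u i (by simp [← hx0, hθ0]))
    · exact posChar_perturb_of_apply_pos hx0 (by linarith [(abs_lt.1 (hsmall t ht x _ hx0)).1])

theorem integral_inner_comp_smul_gradient_nonpos (h : IsMinimizerWithin Ω Q Qmax g u ε)
    (i : Fin m) (hφ : IsTestFunction Ω φ) (hφ0 : ∀ x, 0 ≤ φ x)
    (hd : ∀ s, HasDerivAt θ (θ' s) s) (hc : Continuous θ') (hθ' : ∀ s, 0 ≤ θ' s)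
    (hL : ∀ s, θ' s ≤ L) (hθ0 : θ 0 = 0) (hM : ∀ s, |θ s| ≤ M) :
    ∫ x in Ω, inner ℝ (θ (u x i) • weakGradient Ω (fun y => u y i) x) (gradient φ x) ≤ 0 := by
  set F := weakGradient Ω fun y => u y i with hF
  have hu2 := (h.memH1 i).1
  have hF2 : MemLp F 2 (volume.restrict Ω) := (h.memH1 i).memLp_weakGradient h.isOpen
  have hL' : ∀ s, |θ' s| ≤ L := fun s => (abs_of_nonneg (hθ' s)).trans_le (hL s)
  have hquad : IntegrableOn (fun x => φ x * (θ' (u x i) * ‖F x‖ ^ 2)) Ω := by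
    have hθF := integrable_inner_of_memLp (memLp_comp_smul hu2.1 hF2 hc hL') hF2
    simp only [real_inner_smul_left, real_inner_self_eq_norm_sq] at hθF
    exact (hφ.integrable_smul 
      (locallyIntegrableOn_of_locallyIntegrable_restrict hθF.locallyIntegrable)).integrableOn
  have hcross : IntegrableOn (fun x => inner ℝ (θ (u x i) • F x) (gradient φ x)) Ω :=
    integrable_inner_of_memLp (memLp_comp_smul hu2.1 hF2
      (continuous_iff_continuousAt.2 fun s => (hd s).continuousAt) hM) (hφ.memLp_gradient 2 _)
  have hsplit : ∀ x, inner ℝ (F x) (φ x • -θ' (u x i) • F x + -θ (u x i) • gradient φ x)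
      = -(φ x * (θ' (u x i) * ‖F x‖ ^ 2) + inner ℝ (θ (u x i) • F x) (gradient φ x)) := fun x => by
    rw [inner_add_right, real_inner_smul_right, real_inner_smul_right, real_inner_smul_right,
      real_inner_smul_left, real_inner_self_eq_norm_sq]
    ring
  have hvar := h.integral_inner_variation_nonneg i hφ (fun s => (hd s).neg) hc.neg
    (fun s => (abs_neg _).trans_le (hL' s)) (by simp [hθ0])
  simp only [Pi.neg_apply, ← hF, hsplit] at hvar
  rw [integral_neg, integral_add hquad hcross] at hvar
  have hnonneg : 0 ≤ ∫ x in Ω, φ x * (θ' (u x i) * ‖F x‖ ^ 2) :=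
    integral_nonneg fun x => mul_nonneg (hφ0 x) (mul_nonneg (hθ' _) (sq_nonneg _))
  linarith

theorem integrableOn_regAbs (h : IsMinimizerWithin Ω Q Qmax g u ε) (i : Fin m) {δ : ℝ}
    (hδ : 0 ≤ δ) : IntegrableOn (fun z => regAbs δ (u z i)) Ω := by
  have := h.isFiniteMeasure
  refine ((h.integrableOn i).abs.add (integrable_const δ)).mono'
    ((continuous_regAbs δ).comp_aestronglyMeasurable (h.integrableOn i).1)
    (Eventually.of_forall fun z => ?_)
  rw [Real.norm_of_nonneg (hδ.trans (le_regAbs δ _))]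
  exact regAbs_le hδ _

theorem monotoneOn_radialMean_regAbs (h : IsMinimizerWithin Ω Q Qmax g u ε) (i : Fin m) {R : ℝ}
    (hxR : Metric.ball x R ⊆ Ω) {δ : ℝ} (hδ : 0 < δ) :
    MonotoneOn (radialMean Ω (fun z => regAbs δ (u z i)) x) (Ioo 0 R) := by
  have hw := (h.memH1 i).isWeakGradient.comp h.isOpen (h.memH1 i).1
    ((h.memH1 i).memLp_weakGradient h.isOpen) (hasDerivAt_regAbs hδ) (continuous_div_regAbs hδ)
    (abs_div_regAbs_le_one hδ)
  refine BernoulliSystem.monotoneOn_radialMean hw (h.integrableOn_regAbs i hδ.le) hxR fun r hr => ?_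
  exact h.integral_inner_comp_smul_gradient_nonpos i
    (isTestFunction_dilate_potential hr.1 ((Metric.closedBall_subset_ball hr.2).trans hxR))
    (fun z => potential_nonneg _) (hasDerivAt_div_regAbs hδ)
    (continuous_const.div ((continuous_regAbs δ).pow 3) fun s => (pow_pos (regAbs_pos hδ s) 3).ne')
    (fun s => div_nonneg (sq_nonneg δ) (pow_pos (regAbs_pos hδ s) 3).le)
    (sq_div_regAbs_pow_three_le hδ) (zero_div _) (abs_div_regAbs_le_one hδ)

theorem monotoneOn_radialMean (h : IsMinimizerWithin Ω Q Qmax g u ε) (i : Fin m) {R : ℝ}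
    (hxR : Metric.ball x R ⊆ Ω) : MonotoneOn (radialMean Ω (fun z => u z i) x) (Ioo 0 R) := by
  have := h.isFiniteMeasure
  have hfi := h.integrableOn i
  intro s hs r hr hsr
  have hle : ∀ δ > 0, radialMean Ω (fun z => u z i) x s
      ≤ radialMean Ω (fun z => u z i) x r + δ * radialMean Ω (fun _ => 1) x r := fun δ hδ =>
    calc radialMean Ω (fun z => u z i) x s
        ≤ radialMean Ω (fun z => regAbs δ (u z i)) x s :=
          radialMean_mono hfi (h.integrableOn_regAbs i hδ.le) (Eventually.of_forall fun z =>
            (le_abs_self _).trans (abs_le_regAbs δ _)) x hs.1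
      _ ≤ radialMean Ω (fun z => regAbs δ (u z i)) x r :=
          h.monotoneOn_radialMean_regAbs i hxR hδ hs hr hsr
      _ ≤ radialMean Ω (fun z => u z i + δ) x r := by
          refine radialMean_mono (h.integrableOn_regAbs i hδ.le) (hfi.add (integrable_const δ)) ?_ x
            hr.1
          filter_upwards [h.nonneg i] with z hz
          exact (regAbs_le hδ.le _).trans_eq (congrArg (· + δ) (abs_of_nonneg hz))
      _ = _ := radialMean_add_const hfi δ x r
  have hlim : Tendsto (fun δ => radialMean Ω (fun z => u z i) x r
      + δ * radialMean Ω (fun _ => 1) x r) (𝓝[>] 0) (𝓝 (radialMean Ω (fun z => u z i) x r)) := by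
    have hcont : Continuous fun δ => radialMean Ω (fun z => u z i) x r
      + δ * radialMean Ω (fun _ => 1) x r := by fun_prop
    simpa using (hcont.tendsto 0).mono_left nhdsWithin_le_nhds
  exact ge_of_tendsto hlim (eventually_mem_nhdsWithin.mono hle)

theorem antitoneOn_radialMean (h : IsMinimizerWithin Ω Q Qmax g u ε) (i : Fin m) {R : ℝ}
    (hxR : Metric.ball x R ⊆ Ω)
    (hpos : ∀ᵐ z ∂volume.restrict Ω, z ∈ Metric.ball x R → 0 < ‖u z‖) :
    AntitoneOn (radialMean Ω (fun z => u z i) x) (Ioo 0 R) := by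
  suffices hanti : AntitoneOn (fun r => radialMean Ω (fun z => u z i) x r - 0 * r) (Ioo 0 R) by
    simpa only [zero_mul, sub_zero] using hanti
  refine antitoneOn_radialMean_sub (h.memH1 i).isWeakGradient (h.integrableOn i) hxR
    fun r hr => neg_nonpos.2 (mul_nonneg ?_ ?_)
  · have := hr.1
    positivity
  have htest := isTestFunction_dilate_potential hr.1
    ((Metric.closedBall_subset_ball hr.2).trans hxR)
  refine h.first_variation_nonneg (htest.memH10 h.isOpen)
    (isWeakGradient_of_contDiff htest.contDiff_one) (htest.memLp_gradient 2 _) one_pos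
    (fun t ht => ?_) fun t ht => ?_
  · filter_upwards [h.nonneg i] with z hz
    exact add_nonneg hz (mul_nonneg ht.1.le (potential_nonneg _))
  · filter_upwards [hpos, eventually_all.2 h.nonneg] with z hz hz0
    by_cases hzr : z ∈ Metric.ball x r
    · exact posChar_perturb_of_nonneg hz0 (hz (Metric.ball_subset_ball hr.2.le hzr))
        (mul_nonneg ht.1.le (potential_nonneg _))
    · refine posChar_congr (perturb_of_eq_zero u i ?_)
      rw [dilate_eq_zero (fun _ => potential_eq_zero) hr.1 hzr, mul_zero]

end IsMinimizerWithin

end Minimizers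

section BallEstimates

variable {Ω : Set (E n)} {h Q : E n → ℝ} {u v : E n → E m} {x z : E n} {r C : ℝ}

/-- The volume of the unit ball of `ℝⁿ`. -/
def unitBallVolume (n : ℕ) : ℝ := volume.real (Metric.closedBall (0 : E n) 1)

theorem unitBallVolume_pos (n : ℕ) : 0 < unitBallVolume n :=
  ENNReal.toReal_pos (Metric.measure_closedBall_pos _ _ one_pos).ne' measure_closedBall_lt_top.ne

theorem volume_real_closedBall (x : E n) (hr : 0 ≤ r) :
    volume.real (Metric.closedBall x r) = r ^ n * unitBallVolume n := by
  simpa [unitBallVolume] using Measure.addHaar_real_closedBall' (volume : Measure (E n)) x hr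

theorem setIntegral_le_of_eq_zero_of_notMem_ball (hr : 0 ≤ r)
    (hC : ∀ᵐ z ∂volume.restrict Ω, ‖h z‖ ≤ C) (hC0 : 0 ≤ C) (h0 : ∀ z ∉ Metric.ball x r, h z = 0) :
    ∫ z in Ω, h z ≤ C * (r ^ n * unitBallVolume n) := by
  have hle : volume.restrict Ω (Metric.ball x r) ≤ volume (Metric.closedBall x r) :=
    (Measure.restrict_apply_le _ _).trans (measure_mono Metric.ball_subset_closedBall)
  calc ∫ z in Ω, h z = ∫ z in Metric.ball x r, h z ∂volume.restrict Ω :=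
        (setIntegral_eq_integral_of_forall_compl_eq_zero h0).symm
    _ ≤ C * (volume.restrict Ω).real (Metric.ball x r) :=
        (Real.le_norm_self _).trans (norm_setIntegral_le_of_norm_le_const_ae
          (hle.trans_lt measure_closedBall_lt_top) (ae_restrict_of_ae hC))
    _ ≤ C * volume.real (Metric.closedBall x r) :=
        mul_le_mul_of_nonneg_left (ENNReal.toReal_mono measure_closedBall_lt_top.ne hle) hC0
    _ = _ := by rw [volume_real_closedBall x hr]

theorem norm_gradient_dilate_potential_le (hr : 0 < r) (x z : E n) :
    ‖gradient (dilate potential x r) z‖ ≤ 4 / r := by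
  rw [gradient_dilate (contDiff_potential.differentiable (by simp)), norm_smul, norm_inv,
    Real.norm_of_nonneg hr.le, inv_mul_eq_div]
  gcongr
  exact norm_gradient_potential_le _

theorem gradient_dilate_potential_eq_zero (hr : 0 < r) (hz : z ∉ Metric.ball x r) :
    gradient (dilate potential x r) z = 0 := by
  rw [gradient_dilate_potential, dilate_eq_zero (fun _ => kernel_eq_zero) hr hz, mul_zero, neg_zero,
    zero_smul]

theorem integral_norm_sq_gradient_dilate_potential_le (Ω : Set (E n)) (x : E n) (hr : 0 < r) :
    ∫ z in Ω, ‖gradient (dilate potential x r) z‖ ^ 2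
      ≤ (4 / r) ^ 2 * (r ^ n * unitBallVolume n) := by
  refine setIntegral_le_of_eq_zero_of_notMem_ball (x := x) hr.le (.of_forall fun z => ?_)
    (sq_nonneg _) fun z hz => by
      rw [gradient_dilate_potential_eq_zero hr hz, norm_zero, zero_pow two_ne_zero]
  rw [norm_pow, norm_norm]
  gcongr
  exact norm_gradient_dilate_potential_le hr x z

theorem h1NormSq_dilate_potential_le (hΩ : IsOpen Ω) (hr : 0 < r)
    (hx : Metric.closedBall x r ⊆ Ω) :
    h1NormSq Ω (dilate potential x r) ≤ (1 + (4 / r) ^ 2) * (r ^ n * unitBallVolume n) := by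
  have htest := isTestFunction_dilate_potential hr hx
  rw [(isWeakGradient_of_contDiff htest.contDiff_one).h1NormSq_eq hΩ]
  refine setIntegral_le_of_eq_zero_of_notMem_ball (x := x) hr.le (.of_forall fun z => ?_)
    (by positivity) fun z hz => by simp [dilate_eq_zero (fun _ => potential_eq_zero) hr hz,
      gradient_dilate_potential_eq_zero hr hz]
  rw [Real.norm_of_nonneg (by positivity)]
  gcongr
  · exact pow_le_one₀ (potential_nonneg _) (potential_le_one _)
  · exact norm_gradient_dilate_potential_le hr x z

theorem abs_posChar_sub_le_one (u v : E n → E m) (x : E n) : |posChar u x - posChar v x| ≤ 1 :=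
  abs_sub_le_of_nonneg_of_le (posChar_nonneg u x) (posChar_le_one u x) (posChar_nonneg v x)
    (posChar_le_one v x)

theorem integral_abs_posChar_sub_le (Ω : Set (E n)) (hr : 0 ≤ r)
    (huv : ∀ z ∉ Metric.ball x r, u z = v z) :
    ∫ z in Ω, |posChar u z - posChar v z| ≤ r ^ n * unitBallVolume n := by
  refine (setIntegral_le_of_eq_zero_of_notMem_ball (x := x) hr (.of_forall fun z => ?_)
    zero_le_one fun z hz => ?_).trans_eq (one_mul _)
  · rw [Real.norm_eq_abs, abs_abs]
    exact abs_posChar_sub_le_one u v z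
  · rw [posChar_congr (huv z hz), sub_self, abs_zero]

theorem integral_sq_mul_posChar_sub_le (hQ : ∀ᵐ z ∂volume.restrict Ω, Q z ^ 2 ≤ C) (hC : 0 ≤ C)
    (hr : 0 ≤ r) (huv : ∀ z ∉ Metric.ball x r, u z = v z) :
    ∫ z in Ω, Q z ^ 2 * (posChar u z - posChar v z) ≤ C * (r ^ n * unitBallVolume n) := by
  refine setIntegral_le_of_eq_zero_of_notMem_ball (x := x) hr (hQ.mono fun z hz => ?_) hC
    fun z hz => ?_
  · rw [norm_mul, norm_pow, Real.norm_eq_abs, sq_abs]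
    exact (mul_le_of_le_one_right (sq_nonneg _) (abs_posChar_sub_le_one u v z)).trans hz
  · rw [posChar_congr (huv z hz), sub_self, mul_zero]

end BallEstimates

section Competitors

variable {Ω : Set (E n)} {Q : E n → ℝ} {Qmax ε : ℝ} {g u : E n → E m} {x : E n} {r : ℝ}

/-- A bound for the distance from `u` to its competitor `u + Qmax r ζ_r`, which differs from `u`
only in a ball of radius `r`. -/
def competitorDistance (n : ℕ) (Qmax r : ℝ) : ℝ :=
  Real.sqrt (Qmax ^ 2 * (r ^ 2 + 16) * (r ^ n * unitBallVolume n)) + r ^ n * unitBallVolume n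

theorem competitorDistance_nonneg (n : ℕ) (Qmax : ℝ) (hr : 0 ≤ r) :
    0 ≤ competitorDistance n Qmax r :=
  add_nonneg (Real.sqrt_nonneg _) (mul_nonneg (pow_nonneg hr n) (unitBallVolume_pos n).le)

theorem competitorDistance_mono (n : ℕ) (Qmax : ℝ) {s : ℝ} (hs : 0 ≤ s) (hsr : s ≤ r) :
    competitorDistance n Qmax s ≤ competitorDistance n Qmax r := by
  have := unitBallVolume_pos n
  unfold competitorDistance
  gcongr

theorem exists_competitorDistance_lt (hn : n ≠ 0) (Qmax : ℝ) {ε : ℝ} (hε : 0 < ε) :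
    ∃ r₀, 0 < r₀ ∧ competitorDistance n Qmax r₀ < ε := by
  have hcont : ContinuousAt (competitorDistance n Qmax) 0 := by
    unfold competitorDistance
    fun_prop
  have hzero : competitorDistance n Qmax 0 = 0 := by
    simp [competitorDistance, hn]
  have hev : ∀ᶠ r in 𝓝[>] 0, competitorDistance n Qmax r < ε :=
    nhdsWithin_le_nhds (hcont.eventually_lt_const (by rwa [hzero]))
  exact (eventually_mem_nhdsWithin.and hev).exists

theorem perturb_dilate_potential_of_notMem_ball (u : E n → E m) (i : Fin m) (t : ℝ) (hr : 0 < r)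
    {z : E n} (hz : z ∉ Metric.ball x r) :
    perturb u i (fun y => t * dilate potential x r y) z = u z :=
  perturb_of_eq_zero u i (by rw [dilate_eq_zero (fun _ => potential_eq_zero) hr hz, mul_zero])

theorem d_perturb_dilate_potential_le (hΩ : IsOpen Ω) (u : E n → E m) (i : Fin m) (Qmax : ℝ)
    (hr : 0 < r) (hx : Metric.closedBall x r ⊆ Ω) :
    d Ω u (perturb u i fun y => Qmax * r * dilate potential x r y)
      ≤ competitorDistance n Qmax r := by
  have htest := (isTestFunction_dilate_potential hr hx).memH1 Ω
  rw [d, competitorDistance, h1Norm_sub_perturb hΩ u i (htest.const_mul _),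
    htest.h1NormSq_const_mul hΩ]
  gcongr ?_ + ?_
  · refine Real.sqrt_le_sqrt ?_
    calc (Qmax * r) ^ 2 * h1NormSq Ω (dilate potential x r)
        ≤ (Qmax * r) ^ 2 * ((1 + (4 / r) ^ 2) * (r ^ n * unitBallVolume n)) := by
          gcongr
          exact h1NormSq_dilate_potential_le hΩ hr hx
      _ = Qmax ^ 2 * (r ^ 2 + 16) * (r ^ n * unitBallVolume n) := by
          field_simp
          ring
  · exact integral_abs_posChar_sub_le Ω hr.le fun z hz =>
      (perturb_dilate_potential_of_notMem_ball u i _ hr hz).symm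

/-- A constant such that the radial means of the components of a minimizer grow in the radius at
rate at most `growthConstant n * Qmax`. -/
def growthConstant (n : ℕ) : ℝ := 17 / 2 * unitBallVolume n

theorem growthConstant_pos (n : ℕ) : 0 < growthConstant n :=
  mul_pos (by norm_num) (unitBallVolume_pos n)

/- Adding `t ζ_r` to `u_i` changes the Dirichlet energy by `2 t ∫ ⟨∇u_i, ∇ζ_r⟩ + O(t² r^(n-2))`
and the measure term by at most `Qmax² |B_r|`; the choice `t = Qmax r` balances the errors. -/
theorem IsMinimizerWithin.neg_integral_inner_gradient_potential_le
    (h : IsMinimizerWithin Ω Q Qmax g u ε) (i : Fin m) (hr : 0 < r)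
    (hx : Metric.closedBall x r ⊆ Ω) (hε : competitorDistance n Qmax r < ε) :
    -((r ^ n)⁻¹ * r * ∫ z in Ω, inner ℝ (weakGradient Ω (fun y => u y i) z)
      (gradient (dilate potential x r) z)) ≤ growthConstant n * Qmax := by
  have hQ := h.pos
  have htest := isTestFunction_dilate_potential hr hx
  have hincr := h.increment_nonneg (i := i) ((htest.memH10 h.isOpen).const_mul h.isOpen (Qmax * r))
    ((isWeakGradient_of_contDiff htest.contDiff_one).const_mul _)
    ((htest.memLp_gradient 2 _).const_smul (Qmax * r))
    (by
      filter_upwards [h.nonneg i] with z hz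
      exact add_nonneg hz (mul_nonneg (by positivity) (potential_nonneg _)))
    ((d_perturb_dilate_potential_le h.isOpen u i Qmax hr hx).trans_lt hε)
  simp only [real_inner_smul_right, norm_smul, mul_pow _ ‖_‖, Real.norm_eq_abs, sq_abs,
    integral_const_mul] at hincr
  have henergy := mul_le_mul_of_nonneg_left
    (integral_norm_sq_gradient_dilate_potential_le Ω x hr) (sq_nonneg (Qmax * r))
  have hmeasure := integral_sq_mul_posChar_sub_le h.ae_sq_le (sq_nonneg Qmax) hr.le fun z hz =>
    perturb_dilate_potential_of_notMem_ball (x := x) u i (Qmax * r) hr hz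
  set A := ∫ z in Ω, inner ℝ (weakGradient Ω (fun y => u y i) z)
    (gradient (dilate potential x r) z)
  have hfactor : 2 * (Qmax * r * A) + (Qmax * r) ^ 2 * ((4 / r) ^ 2 * (r ^ n * unitBallVolume n))
      + Qmax ^ 2 * (r ^ n * unitBallVolume n)
      = 2 * Qmax * r ^ n * ((r ^ n)⁻¹ * r * A + growthConstant n * Qmax) := by
    rw [growthConstant]
    field_simp
    ring
  have hnonneg : 0 ≤ (r ^ n)⁻¹ * r * A + growthConstant n * Qmax :=
    nonneg_of_mul_nonneg_right (by linarith) (by positivity : 0 < 2 * Qmax * r ^ n)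
  linarith

end Competitors

section KernelMass

variable {Ω : Set (E n)} {f : E n → ℝ} {x : E n} {r a : ℝ}

/-- The total mass of `kernel`; the radial means of `f` at `x` tend to `kernelMass n * f x`. -/
def kernelMass (n : ℕ) : ℝ := ∫ y : E n, kernel y

theorem kernelMass_pos (n : ℕ) : 0 < kernelMass n :=
  contDiff_kernel.continuous.integral_pos_of_hasCompactSupport_nonneg_nonzero
    (hasCompactSupport_of_eq_zero fun _ => kernel_eq_zero) kernel_nonneg (x := 0)
    (kernel_pos (by simp)).ne'

theorem radialMean_const (hr : 0 < r) (hx : Metric.ball x r ⊆ Ω) (a : ℝ) :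
    radialMean Ω (fun _ => a) x r = kernelMass n * a := by
  have hmass : ∫ z in Ω, dilate kernel x r z = ∫ z, dilate kernel x r z :=
    setIntegral_eq_integral_of_forall_compl_eq_zero fun z hz =>
      dilate_eq_zero (fun _ => kernel_eq_zero) hr fun h => hz (hx h)
  rw [radialMean, integral_mul_const, hmass, integral_dilate kernel x hr, kernelMass]
  field_simp

theorem continuous_radialMean (hf : IntegrableOn f Ω) (r : ℝ) :
    Continuous fun x => radialMean Ω f x r := by
  refine continuous_const.mul (continuous_of_dominated (bound := fun z => 4 * |f z|)
    (fun x => (integrableOn_dilate_kernel_mul hf x r).1) (fun x => .of_forall fun z => ?_)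
    (hf.abs.const_mul 4) (.of_forall fun z => ?_))
  · rw [norm_mul, dilate, Real.norm_of_nonneg (kernel_nonneg _)]
    gcongr
    exacts [kernel_le_four _, le_rfl]
  · exact (contDiff_kernel.continuous.comp
      (by fun_prop : Continuous fun x : E n => r⁻¹ • (z - x))).mul continuous_const

theorem radialMean_sub_const (hf : IntegrableOn f Ω) (hr : 0 < r)
    (hx : Metric.closedBall x r ⊆ Ω) (a : ℝ) :
    radialMean Ω (fun z => f z - a) x r = radialMean Ω f x r - kernelMass n * a := by
  have hconst : IntegrableOn (fun z => dilate kernel x r z * a) Ω :=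
    (((isTestFunction_dilate_kernel hr hx).contDiff_one.continuous.integrable_of_hasCompactSupport
      (isTestFunction_dilate_kernel hr hx).2.1).mul_const a).integrableOn
  rw [← radialMean_const hr (Metric.ball_subset_closedBall.trans hx) a]
  simp only [radialMean, mul_sub]
  rw [integral_sub (integrableOn_dilate_kernel_mul hf x r) hconst, mul_sub]

theorem abs_radialMean_sub_le_setAverage (hf : IntegrableOn f Ω) (hΩ : MeasurableSet Ω)
    (hr : 0 < r) (hx : Metric.closedBall x r ⊆ Ω) (a : ℝ) :
    |radialMean Ω f x r - kernelMass n * a|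
      ≤ 4 * unitBallVolume n * ⨍ z in Metric.closedBall x r, ‖f z - a‖ := by
  have hV := unitBallVolume_pos n
  have hfi : IntegrableOn (fun z => f z - a) (Metric.closedBall x r) :=
    (hf.mono_set hx).sub (integrableOn_const measure_closedBall_lt_top.ne)
  have hset : ∫ z in Ω, dilate kernel x r z * (f z - a)
      = ∫ z in Metric.closedBall x r, dilate kernel x r z * (f z - a) :=
    setIntegral_eq_of_subset_of_forall_sdiff_eq_zero hΩ hx fun z hz => by
      rw [dilate_eq_zero (fun _ => kernel_eq_zero) hr
        fun h => hz.2 (Metric.ball_subset_closedBall h), zero_mul]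
  have hbound : |∫ z in Metric.closedBall x r, dilate kernel x r z * (f z - a)|
      ≤ 4 * ∫ z in Metric.closedBall x r, ‖f z - a‖ := by
    rw [← integral_const_mul]
    rw [← Real.norm_eq_abs]
    refine norm_integral_le_of_norm_le (hfi.norm.const_mul 4) (.of_forall fun z => ?_)
    rw [norm_mul, dilate, Real.norm_of_nonneg (kernel_nonneg _)]
    gcongr
    exact kernel_le_four _
  rw [← radialMean_sub_const hf hr hx, radialMean, hset, abs_mul, abs_of_pos (by positivity),
    setAverage_eq, volume_real_closedBall x hr.le, smul_eq_mul]
  calc (r ^ n)⁻¹ * |∫ z in Metric.closedBall x r, dilate kernel x r z * (f z - a)|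
      ≤ (r ^ n)⁻¹ * (4 * ∫ z in Metric.closedBall x r, ‖f z - a‖) := by gcongr
    _ = _ := by field_simp

theorem tendsto_radialMean_ae (hΩ : IsOpen Ω) (hf : IntegrableOn f Ω) :
    ∀ᵐ x ∂volume.restrict Ω, Tendsto (radialMean Ω f x) (𝓝[>] 0) (𝓝 (kernelMass n * f x)) := by
  have hi : Integrable (Ω.indicator f) := (integrable_indicator_iff hΩ.measurableSet).2 hf
  rw [ae_restrict_iff' hΩ.measurableSet]
  filter_upwards [IsUnifLocDoublingMeasure.ae_tendsto_average_norm_sub volume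
    hi.locallyIntegrable 1] with x hx hxΩ
  obtain ⟨R, hR, hRΩ⟩ := Metric.isOpen_iff.1 hΩ x hxΩ
  have hlebesgue := hx (l := 𝓝[>] (0 : ℝ)) (fun _ => x) (fun r => r) tendsto_id (by
    filter_upwards [self_mem_nhdsWithin] with r hr
    rw [one_mul]
    exact Metric.mem_closedBall_self (le_of_lt hr))
  rw [tendsto_iff_norm_sub_tendsto_zero]
  refine squeeze_zero' (.of_forall fun _ => norm_nonneg _) ?_
    (by simpa only [mul_zero] using hlebesgue.const_mul (4 * unitBallVolume n))
  filter_upwards [Ioo_mem_nhdsGT hR] with r hr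
  have hsub : Metric.closedBall x r ⊆ Ω := (Metric.closedBall_subset_ball hr.2).trans hRΩ
  refine (abs_radialMean_sub_le_setAverage hf hΩ.measurableSet hr.1 hsub (f x)).trans_eq ?_
  congr 1
  refine setAverage_congr_fun Metric.isClosed_closedBall.measurableSet (.of_forall fun z hz => ?_)
  simp only [indicator_of_mem (hsub hz), indicator_of_mem hxΩ]

end KernelMass

section PreciseVersion

variable {Ω : Set (E n)} {Q : E n → ℝ} {Qmax ε : ℝ} {g u w : E n → E m} {x : E n} {i : Fin m}
  {r R : ℝ}

theorem tendsto_setAverage_ball (hΩ : IsOpen Ω) (hu : IntegrableOn u Ω)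
    (hwu : w =ᵐ[volume.restrict Ω] u) (hx : x ∈ Ω) (hw : ContinuousAt w x) :
    Tendsto (fun ρ => ⨍ y in Metric.ball x ρ, u y) (𝓝[>] 0) (𝓝 (w x)) := by
  rw [Metric.tendsto_nhds]
  intro η hη
  obtain ⟨R, hR, hRΩ⟩ := Metric.isOpen_iff.1 hΩ x hx
  obtain ⟨δ, hδ, hδη⟩ := Metric.continuousAt_iff.1 hw (η / 2) (half_pos hη)
  filter_upwards [Ioo_mem_nhdsGT (lt_min hR hδ)] with ρ hρ
  have hρΩ : Metric.ball x ρ ⊆ Ω :=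
    (Metric.ball_subset_ball (hρ.2.le.trans (min_le_left _ _))).trans hRΩ
  have hmem : ⨍ y in Metric.ball x ρ, u y ∈ Metric.closedBall (w x) (η / 2) := by
    refine (convex_closedBall _ _).set_average_mem Metric.isClosed_closedBall
      (Metric.measure_ball_pos _ _ hρ.1).ne' measure_ball_lt_top.ne ?_ (hu.mono_set hρΩ)
    filter_upwards [ae_restrict_of_ae_restrict_of_subset hρΩ hwu,
      ae_restrict_mem Metric.isOpen_ball.measurableSet] with y hy hyρ
    rw [← hy, Metric.mem_closedBall]
    exact (hδη ((Metric.mem_ball.1 hyρ).trans (hρ.2.trans_le (min_le_right _ _)))).le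
  exact (Metric.mem_closedBall.1 hmem).trans_lt (half_lt_self hη)

/-- The version of `u` whose components are the limits of the normalized radial means of those
of `u`; at a point where such a limit does not exist, `limUnder` gives an arbitrary value. -/
def preciseVersion (Ω : Set (E n)) (u : E n → E m) (x : E n) : E m :=
  WithLp.toLp 2 fun i => limUnder (𝓝[>] (0 : ℝ)) (radialMean Ω (fun z => u z i) x) / kernelMass n

theorem kernelMass_mul_preciseVersion {a : ℝ}
    (h : Tendsto (radialMean Ω (fun z => u z i) x) (𝓝[>] 0) (𝓝 a)) :
    kernelMass n * preciseVersion Ω u x i = a := by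
  rw [preciseVersion, PiLp.toLp_apply, h.limUnder_eq, mul_div_cancel₀ _ (kernelMass_pos n).ne']

namespace IsMinimizerWithin

theorem tendsto_radialMean (h : IsMinimizerWithin Ω Q Qmax g u ε) (i : Fin m) (hx : x ∈ Ω) :
    Tendsto (radialMean Ω (fun z => u z i) x) (𝓝[>] 0)
      (𝓝 (kernelMass n * preciseVersion Ω u x i)) := by
  obtain ⟨R, hR, hRΩ⟩ := Metric.isOpen_iff.1 h.isOpen x hx
  have hbdd : BddBelow (radialMean Ω (fun z => u z i) x '' Ioo 0 R) :=
    ⟨0, forall_mem_image.2 fun r hr => radialMean_nonneg (h.nonneg i) x hr.1⟩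
  have hlim := (h.monotoneOn_radialMean i hRΩ).tendsto_nhdsWithin_Ioo_right
    (nonempty_Ioo.2 hR) hbdd
  rwa [kernelMass_mul_preciseVersion hlim]

theorem preciseVersion_nonneg (h : IsMinimizerWithin Ω Q Qmax g u ε) (i : Fin m) (hx : x ∈ Ω) :
    0 ≤ preciseVersion Ω u x i := by
  have hlim : 0 ≤ kernelMass n * preciseVersion Ω u x i :=
    ge_of_tendsto (h.tendsto_radialMean i hx) (by
      filter_upwards [self_mem_nhdsWithin] with r hr using radialMean_nonneg (h.nonneg i) x hr)
  exact nonneg_of_mul_nonneg_right hlim (kernelMass_pos n)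

theorem preciseVersion_le (h : IsMinimizerWithin Ω Q Qmax g u ε) (i : Fin m) (hr : 0 < r)
    (hrR : r < R) (hx : Metric.ball x R ⊆ Ω) :
    kernelMass n * preciseVersion Ω u x i ≤ radialMean Ω (fun z => u z i) x r := by
  refine le_of_tendsto (h.tendsto_radialMean i (hx (Metric.mem_ball_self (hr.trans hrR)))) ?_
  filter_upwards [Ioo_mem_nhdsGT hr] with s hs
  exact h.monotoneOn_radialMean i hx ⟨hs.1, hs.2.trans hrR⟩ ⟨hr, hrR⟩ hs.2.le

theorem radialMean_le (h : IsMinimizerWithin Ω Q Qmax g u ε) (i : Fin m)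
    (hε : competitorDistance n Qmax R < ε) (hr : 0 < r) (hrR : r < R)
    (hx : Metric.ball x R ⊆ Ω) :
    radialMean Ω (fun z => u z i) x r
      ≤ kernelMass n * preciseVersion Ω u x i + growthConstant n * Qmax * r := by
  have hanti := antitoneOn_radialMean_sub (h.memH1 i).isWeakGradient (h.integrableOn i) hx
    fun s hs => h.neg_integral_inner_gradient_potential_le i hs.1
      ((Metric.closedBall_subset_ball hs.2).trans hx)
      ((competitorDistance_mono n Qmax hs.1.le hs.2.le).trans_lt hε)
  have hlim : Tendsto (fun s => radialMean Ω (fun z => u z i) x s - growthConstant n * Qmax * s)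
      (𝓝[>] 0) (𝓝 (kernelMass n * preciseVersion Ω u x i - growthConstant n * Qmax * 0)) :=
    (h.tendsto_radialMean i (hx (Metric.mem_ball_self (hr.trans hrR)))).sub
      ((tendsto_id.mono_left nhdsWithin_le_nhds).const_mul _)
  have hle : radialMean Ω (fun z => u z i) x r - growthConstant n * Qmax * r
      ≤ kernelMass n * preciseVersion Ω u x i - growthConstant n * Qmax * 0 := by
    refine ge_of_tendsto hlim ?_
    filter_upwards [Ioo_mem_nhdsGT hr] with s hs
    exact hanti ⟨hs.1, hs.2.trans hrR⟩ ⟨hr, hrR⟩ hs.2.le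
  linarith

theorem radialMean_eq (h : IsMinimizerWithin Ω Q Qmax g u ε) (i : Fin m) (hr : 0 < r)
    (hrR : r < R) (hx : Metric.ball x R ⊆ Ω)
    (hpos : ∀ᵐ z ∂volume.restrict Ω, z ∈ Metric.ball x R → 0 < ‖u z‖) :
    radialMean Ω (fun z => u z i) x r = kernelMass n * preciseVersion Ω u x i := by
  refine le_antisymm ?_ (h.preciseVersion_le i hr hrR hx)
  refine ge_of_tendsto (h.tendsto_radialMean i (hx (Metric.mem_ball_self (hr.trans hrR)))) ?_
  filter_upwards [Ioo_mem_nhdsGT hr] with s hs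
  exact h.antitoneOn_radialMean i hx hpos ⟨hs.1, hs.2.trans hrR⟩ ⟨hr, hrR⟩ hs.2.le

theorem preciseVersion_ae_eq (h : IsMinimizerWithin Ω Q Qmax g u ε) :
    preciseVersion Ω u =ᵐ[volume.restrict Ω] u := by
  have hcoord : ∀ i, ∀ᵐ x ∂volume.restrict Ω, preciseVersion Ω u x i = u x i := fun i => by
    filter_upwards [tendsto_radialMean_ae h.isOpen (h.integrableOn i)] with x hx
    exact mul_left_cancel₀ (kernelMass_pos n).ne' (kernelMass_mul_preciseVersion hx)
  filter_upwards [eventually_all.2 hcoord] with x hx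
  ext i
  exact hx i

theorem tendstoUniformlyOn_radialMean (h : IsMinimizerWithin Ω Q Qmax g u ε) (i : Fin m)
    (hR : 0 < R) (hε : competitorDistance n Qmax R < ε) :
    TendstoUniformlyOn (fun r x => radialMean Ω (fun z => u z i) x r)
      (fun x => kernelMass n * preciseVersion Ω u x i) (𝓝[>] 0) {x | Metric.ball x R ⊆ Ω} := by
  have hrate : Tendsto (fun r => growthConstant n * Qmax * r) (𝓝[>] 0) (𝓝 0) :=
    (by fun_prop : Continuous fun r => growthConstant n * Qmax * r).tendsto' 0 0 (by simp)
      |>.mono_left nhdsWithin_le_nhds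
  rw [Metric.tendstoUniformlyOn_iff]
  intro η hη
  filter_upwards [Ioo_mem_nhdsGT hR, hrate.eventually_lt_const hη] with r hr hrη x hx
  have hlower := h.preciseVersion_le i hr.1 hr.2 hx
  have hupper := h.radialMean_le i hε hr.1 hr.2 hx
  rw [Real.dist_eq, abs_sub_lt_iff]
  constructor <;> linarith

theorem continuousOn_preciseVersion (h : IsMinimizerWithin Ω Q Qmax g u ε) (hn : n ≠ 0) :
    ContinuousOn (preciseVersion Ω u) Ω := by
  obtain ⟨r₀, hr₀, hε⟩ := exists_competitorDistance_lt hn Qmax h.eps_pos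
  refine h.isOpen.continuousOn_iff.2 fun {x} hx => ?_
  obtain ⟨R, hR, hRΩ⟩ := Metric.isOpen_iff.1 h.isOpen x hx
  set r := min (R / 2) r₀
  have hr : 0 < r := lt_min (half_pos hR) hr₀
  have hnhds : {y | Metric.ball y r ⊆ Ω} ∈ 𝓝 x := by
    filter_upwards [Metric.ball_mem_nhds x (half_pos hR)] with y hy
    refine (Metric.ball_subset_ball' ?_).trans hRΩ
    linarith [min_le_left (R / 2) r₀, Metric.mem_ball.1 hy]
  have hcoord : ∀ i, ContinuousAt (fun y => preciseVersion Ω u y i) x := fun i => by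
    have hlim := h.tendstoUniformlyOn_radialMean i hr
      ((competitorDistance_mono n Qmax hr.le (min_le_right _ _)).trans_lt hε)
    have hcont := (hlim.continuousOn (.of_forall fun r =>
      (continuous_radialMean (h.integrableOn i) r).continuousOn)).continuousAt hnhds
    simpa [(kernelMass_pos n).ne'] using hcont.div_const (kernelMass n)
  exact (PiLp.continuous_toLp 2 _).continuousAt.comp (continuousAt_pi.2 hcoord)

theorem isPreciseVersion (h : IsMinimizerWithin Ω Q Qmax g u ε) (hn : n ≠ 0) :
    IsPreciseVersion Ω u (preciseVersion Ω u) := by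
  have hu : MemLp u 1 (volume.restrict Ω) :=
    MemLp.of_eval_piLp fun i => memLp_one_iff_integrable.2 (h.integrableOn i)
  exact ⟨h.preciseVersion_ae_eq, fun x hx =>
    tendsto_setAverage_ball h.isOpen (memLp_one_iff_integrable.1 hu) h.preciseVersion_ae_eq hx
      ((h.continuousOn_preciseVersion hn).continuousAt (h.isOpen.mem_nhds hx))⟩

end IsMinimizerWithin

end PreciseVersion

section RadialMeanEstimates

variable {Ω S : Set (E n)} {f : E n → ℝ} {x y : E n} {r s : ℝ}

theorem setIntegral_ball_le_radialMean (hf : IntegrableOn f Ω)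
    (hf0 : ∀ᵐ z ∂volume.restrict Ω, 0 ≤ f z) (hr : 0 < r) (hs : s ≤ 6 / 7 * r)
    (hx : Metric.ball x s ⊆ Ω) :
    ∫ z in Metric.ball x s, f z ≤ 64 * r ^ n * radialMean Ω f x r := by
  have hinteg := integrableOn_dilate_kernel_mul hf x r
  have hkernel : ∀ z ∈ Metric.ball x s, 1 / 64 ≤ dilate kernel x r z := fun z hz => by
    have hnorm : ‖r⁻¹ • (z - x)‖ ≤ 6 / 7 := by
      rw [norm_smul, norm_inv, Real.norm_of_nonneg hr.le, ← div_eq_inv_mul, div_le_iff₀ hr,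
        ← dist_eq_norm]
      exact (Metric.mem_ball.1 hz).le.trans hs
    exact le_kernel_of_norm_sq_le ((pow_le_pow_left₀ (norm_nonneg _) hnorm 2).trans (by norm_num))
  have hle : 1 / 64 * ∫ z in Metric.ball x s, f z ≤ ∫ z in Ω, dilate kernel x r z * f z := by
    rw [← integral_const_mul]
    refine le_trans (integral_mono_ae ((hf.mono_set hx).const_mul _) (hinteg.mono_set hx) ?_)
      (setIntegral_mono_set hinteg ?_ hx.eventuallyLE)
    · filter_upwards [ae_restrict_of_ae_restrict_of_subset hx hf0,
        ae_restrict_mem Metric.isOpen_ball.measurableSet] with z hz hzs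
      exact mul_le_mul_of_nonneg_right (hkernel z hzs) hz
    · filter_upwards [hf0] with z hz
      exact mul_nonneg (kernel_nonneg _) hz
  rw [radialMean, mul_assoc, mul_inv_cancel_left₀ (by positivity)]
  linarith

theorem abs_setIntegral_mul_le {k : E n → ℝ} {b : ℝ} (hf : IntegrableOn f Ω)
    (hΩ : MeasurableSet Ω) (hf0 : ∀ᵐ z ∂volume.restrict Ω, 0 ≤ f z) (hS : S ⊆ Ω)
    (hk0 : ∀ z ∉ S, k z = 0) (hk : ∀ z, |k z| ≤ b) :
    |∫ z in Ω, k z * f z| ≤ b * ∫ z in S, f z := by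
  rw [setIntegral_eq_of_subset_of_forall_sdiff_eq_zero hΩ hS
    fun z hz => by rw [hk0 z hz.2, zero_mul], ← integral_const_mul, ← Real.norm_eq_abs]
  refine norm_integral_le_of_norm_le ((hf.mono_set hS).const_mul b) ?_
  filter_upwards [ae_restrict_of_ae_restrict_of_subset hS hf0] with z hz
  rw [norm_mul, Real.norm_of_nonneg hz]
  exact mul_le_mul_of_nonneg_right (hk z) hz

theorem radialMean_le_setIntegral (hf : IntegrableOn f Ω) (hΩ : MeasurableSet Ω)
    (hf0 : ∀ᵐ z ∂volume.restrict Ω, 0 ≤ f z) (hr : 0 < r) (hx : Metric.ball x r ⊆ S)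
    (hS : S ⊆ Ω) :
    radialMean Ω f x r ≤ (r ^ n)⁻¹ * (4 * ∫ z in S, f z) := by
  refine mul_le_mul_of_nonneg_left ((le_abs_self _).trans ?_) (by positivity)
  refine abs_setIntegral_mul_le hf hΩ hf0 hS
    (fun z hz => dilate_eq_zero (fun _ => kernel_eq_zero) hr fun hzr => hz (hx hzr)) fun z => ?_
  rw [dilate, abs_of_nonneg (kernel_nonneg _)]
  exact kernel_le_four _

theorem abs_radialMean_sub_radialMean_le {L : NNReal} (hL : LipschitzWith L (kernel : E n → ℝ))
    (hf : IntegrableOn f Ω) (hΩ : MeasurableSet Ω) (hf0 : ∀ᵐ z ∂volume.restrict Ω, 0 ≤ f z)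
    (hr : 0 < r) (hx : Metric.ball x r ⊆ S) (hy : Metric.ball y r ⊆ S) (hS : S ⊆ Ω) :
    |radialMean Ω f x r - radialMean Ω f y r|
      ≤ (r ^ n)⁻¹ * (L * (r⁻¹ * dist x y) * ∫ z in S, f z) := by
  have hdiff : radialMean Ω f x r - radialMean Ω f y r
      = (r ^ n)⁻¹ * ∫ z in Ω, (dilate kernel x r z - dilate kernel y r z) * f z := by
    simp only [radialMean, sub_mul]
    rw [integral_sub (integrableOn_dilate_kernel_mul hf x r)
      (integrableOn_dilate_kernel_mul hf y r), mul_sub]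
  rw [hdiff, abs_mul, abs_of_pos (by positivity : 0 < (r ^ n)⁻¹)]
  gcongr
  refine abs_setIntegral_mul_le hf hΩ hf0 hS (fun z hz => ?_) fun z => ?_
  · rw [dilate_eq_zero (fun _ => kernel_eq_zero) hr fun hzr => hz (hx hzr),
      dilate_eq_zero (fun _ => kernel_eq_zero) hr fun hzr => hz (hy hzr), sub_zero]
  · refine (hL.dist_le_mul _ _).trans_eq ?_
    rw [dist_smul₀, norm_inv, Real.norm_of_nonneg hr.le, dist_sub_left]

theorem exists_lipschitzWith_kernel (n : ℕ) : ∃ L, LipschitzWith L (kernel : E n → ℝ) :=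
  ContDiff.lipschitzWith_of_hasCompactSupport
    (hasCompactSupport_of_eq_zero fun _ => kernel_eq_zero) contDiff_kernel (by simp)

end RadialMeanEstimates

section MetricLemmas

theorem exists_ball_subset_of_mem {X : Type*} [PseudoMetricSpace X] {Z : Set X} {x y z : X} {r : ℝ}
    (hx : x ∈ Z) (hz : z ∈ Z) (hyx : dist y x < r / 3) (hyz : 0 < dist y z) :
    ∃ z' ∈ Z, ∃ R, 0 < R ∧ R ≤ 5 * dist y z ∧ R ≤ r ∧ Metric.ball z' R ⊆ Metric.ball x r ∧
      dist y z' ≤ R / 2 := by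
  have hr : 0 < r := by linarith [dist_nonneg (x := y) (y := x)]
  rcases le_or_gt (r / 5) (dist y z) with hfar | hnear
  · exact ⟨x, hx, r, hr, by linarith, le_rfl, subset_rfl, by linarith⟩
  · refine ⟨z, hz, 2 * dist y z, by linarith, by linarith, by linarith,
      Metric.ball_subset_ball' ?_, by linarith⟩
    linarith [dist_triangle_left z x y]

theorem abs_sub_le_of_le_mul_dist {X : Type*} [MetricSpace X] {Z : Set X} {f : X → ℝ} {A D : ℝ}
    {y y' : X} (hZ : Z.Nonempty) (hA : 0 ≤ A) (hD : 0 ≤ D) (hy : 0 ≤ f y) (hy' : 0 ≤ f y')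
    (hfy : ∀ z ∈ Z, f y ≤ A * dist y z) (hfy' : ∀ z ∈ Z, f y' ≤ A * dist y' z)
    (hD' : 0 < Metric.infDist y Z → 4 * dist y y' ≤ Metric.infDist y Z →
      |f y - f y'| ≤ D * dist y y') :
    |f y - f y'| ≤ (5 * A + D) * dist y y' := by
  rcases eq_or_ne y y' with rfl | hne
  · simp
  have hdist : 0 < dist y y' := dist_pos.2 hne
  rcases le_or_gt (4 * dist y y') (Metric.infDist y Z) with hfar | hnear
  · refine (hD' (by linarith) hfar).trans ?_
    gcongr
    linarith
  · obtain ⟨z, hz, hyz⟩ := (Metric.infDist_lt_iff hZ).1 hnear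
    have hy'z : dist y' z ≤ 5 * dist y y' := by linarith [dist_triangle_left y' z y]
    calc |f y - f y'| ≤ A * (5 * dist y y') :=
          abs_sub_le_of_nonneg_of_le hy ((hfy z hz).trans (by gcongr; linarith)) hy'
            ((hfy' z hz).trans (by gcongr))
      _ ≤ (5 * A + D) * dist y y' := by linarith [mul_nonneg hD hdist.le]

theorem norm_le_sqrt_mul_of_abs_le {v : E m} {c : ℝ} (hc : 0 ≤ c) (hv : ∀ i, |v i| ≤ c) :
    ‖v‖ ≤ Real.sqrt m * c := by
  rw [EuclideanSpace.norm_eq, ← Real.sqrt_sq hc, ← Real.sqrt_mul (Nat.cast_nonneg m)]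
  refine Real.sqrt_le_sqrt ((Finset.sum_le_sum fun i _ =>
    pow_le_pow_left₀ (norm_nonneg _) (hv i) 2).trans_eq ?_)
  simp

theorem lipSeminorm_le {w : E n → E m} {S : Set (E n)} {K : ℝ} (hK : 0 ≤ K)
    (h : ∀ y ∈ S, ∀ z ∈ S, dist (w y) (w z) ≤ K * dist y z) :
    lipSeminorm w S ≤ ENNReal.ofReal K := by
  refine iSup₂_le fun y hy => iSup₂_le fun z hz => ENNReal.div_le_of_le_mul ?_
  rw [edist_dist, edist_dist, ← ENNReal.ofReal_mul hK]
  exact ENNReal.ofReal_le_ofReal (h y hy z hz)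

end MetricLemmas

section Lipschitz

variable {Ω : Set (E n)} {Q : E n → ℝ} {Qmax ε : ℝ} {g u : E n → E m} {x y y' z : E n}
  {r R ρ : ℝ} {L : NNReal}

namespace IsMinimizerWithin

theorem setIntegral_ball_le (h : IsMinimizerWithin Ω Q Qmax g u ε) (i : Fin m)
    (hε : competitorDistance n Qmax R < ε) (hR : 0 < R) (hz : Metric.ball z R ⊆ Ω)
    (hz0 : preciseVersion Ω u z = 0) :
    ∫ y in Metric.ball z (3 / 4 * R), u y i ≤ 64 * (growthConstant n * Qmax) * R ^ (n + 1) := by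
  have hpos := mul_pos (growthConstant_pos n) h.pos
  have hmean : radialMean Ω (fun y => u y i) z (7 / 8 * R)
      ≤ growthConstant n * Qmax * (7 / 8 * R) := by
    simpa [hz0] using h.radialMean_le i hε (by linarith : 0 < 7 / 8 * R) (by linarith) hz
  calc ∫ y in Metric.ball z (3 / 4 * R), u y i
      ≤ 64 * (7 / 8 * R) ^ n * radialMean Ω (fun y => u y i) z (7 / 8 * R) :=
        setIntegral_ball_le_radialMean (h.integrableOn i) (h.nonneg i) (by linarith) (by linarith)
          ((Metric.ball_subset_ball (by linarith)).trans hz)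
    _ ≤ 64 * (7 / 8 * R) ^ n * (growthConstant n * Qmax * (7 / 8 * R)) := by gcongr
    _ ≤ 64 * R ^ n * (growthConstant n * Qmax * R) := by gcongr <;> linarith
    _ = 64 * (growthConstant n * Qmax) * R ^ (n + 1) := by ring

theorem preciseVersion_le_mul_radius (h : IsMinimizerWithin Ω Q Qmax g u ε) (i : Fin m)
    (hε : competitorDistance n Qmax R < ε) (hR : 0 < R) (hz : Metric.ball z R ⊆ Ω)
    (hz0 : preciseVersion Ω u z = 0) (hy : dist y z ≤ R / 2) :
    kernelMass n * preciseVersion Ω u y i ≤ 256 * 5 ^ n * (growthConstant n * Qmax) * R := by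
  have hball : Metric.ball y (R / 4) ⊆ Metric.ball z (3 / 4 * R) :=
    Metric.ball_subset_ball' (by linarith)
  have hzΩ : Metric.ball z (3 / 4 * R) ⊆ Ω := (Metric.ball_subset_ball (by linarith)).trans hz
  calc kernelMass n * preciseVersion Ω u y i
      ≤ radialMean Ω (fun w => u w i) y (R / 5) :=
        h.preciseVersion_le i (by linarith) (by linarith : R / 5 < R / 4) (hball.trans hzΩ)
    _ ≤ ((R / 5) ^ n)⁻¹ * (4 * ∫ w in Metric.ball z (3 / 4 * R), u w i) :=
        radialMean_le_setIntegral (h.integrableOn i) h.isOpen.measurableSet (h.nonneg i)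
          (by linarith) ((Metric.ball_subset_ball (by linarith)).trans hball) hzΩ
    _ ≤ ((R / 5) ^ n)⁻¹ * (4 * (64 * (growthConstant n * Qmax) * R ^ (n + 1))) := by
        gcongr
        exact h.setIntegral_ball_le i hε hR hz hz0
    _ = 256 * 5 ^ n * (growthConstant n * Qmax) * R := by
        rw [div_pow]
        field_simp
        ring

theorem radialMean_eq_of_ne_zero (h : IsMinimizerWithin Ω Q Qmax g u ε) (i : Fin m) (hr : 0 < r)
    (hrρ : r < ρ) (hx : Metric.ball x ρ ⊆ Ω)
    (hne : ∀ y ∈ Metric.ball x ρ, preciseVersion Ω u y ≠ 0) :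
    radialMean Ω (fun y => u y i) x r = kernelMass n * preciseVersion Ω u x i := by
  refine h.radialMean_eq i hr hrρ hx ?_
  filter_upwards [h.preciseVersion_ae_eq] with y hy hyx
  rw [← hy]
  exact norm_pos_iff.2 (hne y hyx)

/- Where `u ≠ 0` the radial means do not depend on the radius, so `u` inherits the Lipschitz
constant of the radial means at the fixed scale `ρ / 8`. -/
theorem abs_preciseVersion_sub_le_of_ne_zero (h : IsMinimizerWithin Ω Q Qmax g u ε)
    (hL : LipschitzWith L (kernel : E n → ℝ)) (i : Fin m) (hε : competitorDistance n Qmax R < ε)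
    (hR : 0 < R) (hz : Metric.ball z R ⊆ Ω) (hz0 : preciseVersion Ω u z = 0)
    (hyz : dist y z ≤ R / 2) (hRρ : R ≤ 10 * ρ)
    (hne : ∀ w ∈ Metric.ball y ρ, preciseVersion Ω u w ≠ 0) (hyy' : dist y y' ≤ ρ / 4) :
    kernelMass n * |preciseVersion Ω u y i - preciseVersion Ω u y' i|
      ≤ 64 * 80 ^ (n + 1) * L * (growthConstant n * Qmax) * dist y y' := by
  have hpos := mul_pos (growthConstant_pos n) h.pos
  have hρz : ρ ≤ dist y z := by
    rw [dist_comm]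
    exact not_lt.1 fun hlt => hne z (Metric.mem_ball.2 hlt) hz0
  set s := ρ / 8 with hs
  have hs0 : 0 < s := by linarith
  set B := Metric.ball z (3 / 4 * R)
  have hB : B ⊆ Ω := (Metric.ball_subset_ball (by linarith)).trans hz
  have hyB : Metric.ball y (ρ / 2) ⊆ B := Metric.ball_subset_ball' (by linarith)
  have hsub : ∀ {q}, dist q y ≤ ρ / 4 → Metric.ball q (ρ / 4) ⊆ Metric.ball y (ρ / 2) :=
    fun hq => Metric.ball_subset_ball' (by linarith)
  have hsB : ∀ {q}, dist q y ≤ ρ / 4 → Metric.ball q s ⊆ B := fun hq =>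
    (Metric.ball_subset_ball (by linarith)).trans ((hsub hq).trans hyB)
  have hmean : ∀ {q}, dist q y ≤ ρ / 4 →
      radialMean Ω (fun w => u w i) q s = kernelMass n * preciseVersion Ω u q i := fun hq =>
    h.radialMean_eq_of_ne_zero i hs0 (by linarith : s < ρ / 4) (((hsub hq).trans hyB).trans hB)
      fun w hw => hne w (Metric.ball_subset_ball (by linarith) (hsub hq hw))
  have hy : dist y y ≤ ρ / 4 := by linarith [dist_self y]
  have hy' : dist y' y ≤ ρ / 4 := by rwa [dist_comm]
  calc kernelMass n * |preciseVersion Ω u y i - preciseVersion Ω u y' i|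
      = |radialMean Ω (fun w => u w i) y s - radialMean Ω (fun w => u w i) y' s| := by
        rw [hmean hy, hmean hy', ← mul_sub, abs_mul, abs_of_pos (kernelMass_pos n)]
    _ ≤ (s ^ n)⁻¹ * (L * (s⁻¹ * dist y y') * ∫ w in B, u w i) :=
        abs_radialMean_sub_radialMean_le hL (h.integrableOn i) h.isOpen.measurableSet (h.nonneg i)
          hs0 (hsB hy) (hsB hy') hB
    _ ≤ (s ^ n)⁻¹ * (L * (s⁻¹ * dist y y')
          * (64 * (growthConstant n * Qmax) * (80 * s) ^ (n + 1))) := by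
        gcongr
        refine (h.setIntegral_ball_le i hε hR hz hz0).trans ?_
        gcongr
        linarith
    _ = 64 * 80 ^ (n + 1) * L * (growthConstant n * Qmax) * dist y y' := by
        rw [mul_pow]
        field_simp
        ring

theorem preciseVersion_le_mul_dist (h : IsMinimizerWithin Ω Q Qmax g u ε) (i : Fin m)
    (hε : competitorDistance n Qmax r < ε) (hx : Metric.ball x r ⊆ Ω)
    (hx0 : preciseVersion Ω u x = 0) (hz0 : preciseVersion Ω u z = 0)
    (hy : y ∈ Metric.ball x (r / 3)) :
    kernelMass n * preciseVersion Ω u y i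
      ≤ 1280 * 5 ^ n * (growthConstant n * Qmax) * dist y z := by
  have hpos := mul_pos (growthConstant_pos n) h.pos
  rcases (dist_nonneg (x := y) (y := z)).eq_or_lt with hyz | hyz
  · rw [← hyz, eq_of_dist_eq_zero hyz.symm, hz0]
    simp
  obtain ⟨z', hz', R, hR, hRyz, hRr, hball, hyz'⟩ :=
    exists_ball_subset_of_mem (Z := {z | preciseVersion Ω u z = 0}) hx0 hz0 hy hyz
  calc kernelMass n * preciseVersion Ω u y i
      ≤ 256 * 5 ^ n * (growthConstant n * Qmax) * R :=
        h.preciseVersion_le_mul_radius i ((competitorDistance_mono n Qmax hR.le hRr).trans_lt hε)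
          hR (hball.trans hx) hz' hyz'
    _ ≤ 256 * 5 ^ n * (growthConstant n * Qmax) * (5 * dist y z) := by gcongr
    _ = 1280 * 5 ^ n * (growthConstant n * Qmax) * dist y z := by ring

theorem abs_preciseVersion_sub_le_of_infDist (h : IsMinimizerWithin Ω Q Qmax g u ε)
    (hL : LipschitzWith L (kernel : E n → ℝ)) (i : Fin m) (hε : competitorDistance n Qmax r < ε)
    (hx : Metric.ball x r ⊆ Ω) (hx0 : preciseVersion Ω u x = 0)
    (hy : y ∈ Metric.ball x (r / 3))
    (hpos : 0 < Metric.infDist y {z | preciseVersion Ω u z = 0})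
    (hyy' : 4 * dist y y' ≤ Metric.infDist y {z | preciseVersion Ω u z = 0}) :
    kernelMass n * |preciseVersion Ω u y i - preciseVersion Ω u y' i|
      ≤ 64 * 80 ^ (n + 1) * L * (growthConstant n * Qmax) * dist y y' := by
  set Z := {z | preciseVersion Ω u z = 0}
  obtain ⟨z, hz, hyz⟩ := (Metric.infDist_lt_iff ⟨x, hx0⟩).1
    (by linarith : Metric.infDist y Z < 2 * Metric.infDist y Z)
  obtain ⟨z', hz', R, hR, hRyz, hRr, hball, hyz'⟩ := exists_ball_subset_of_mem (Z := Z) hx0 hz hy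
    (hpos.trans_le (Metric.infDist_le_dist_of_mem hz))
  refine h.abs_preciseVersion_sub_le_of_ne_zero hL i
    ((competitorDistance_mono n Qmax hR.le hRr).trans_lt hε) hR (hball.trans hx) hz' hyz'
    (by linarith : R ≤ 10 * Metric.infDist y Z) (fun w hw hw0 => ?_) (by linarith)
  rw [Metric.mem_ball, dist_comm] at hw
  exact hw.not_ge (Metric.infDist_le_dist_of_mem hw0)

theorem abs_preciseVersion_sub_le (h : IsMinimizerWithin Ω Q Qmax g u ε)
    (hL : LipschitzWith L (kernel : E n → ℝ)) (i : Fin m) (hε : competitorDistance n Qmax r < ε)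
    (hx : Metric.ball x r ⊆ Ω) (hx0 : preciseVersion Ω u x = 0)
    (hy : y ∈ Metric.ball x (r / 3)) (hy' : y' ∈ Metric.ball x (r / 3)) :
    kernelMass n * |preciseVersion Ω u y i - preciseVersion Ω u y' i|
      ≤ (5 * (1280 * 5 ^ n) + 64 * 80 ^ (n + 1) * L) * growthConstant n * Qmax * dist y y' := by
  have hpos := mul_pos (growthConstant_pos n) h.pos
  have hmass := kernelMass_pos n
  have hr : 0 < r / 3 := Metric.pos_of_mem_ball hy
  have hsub : Metric.ball x (r / 3) ⊆ Ω := (Metric.ball_subset_ball (by linarith)).trans hx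
  have hmul : kernelMass n * |preciseVersion Ω u y i - preciseVersion Ω u y' i|
      = |kernelMass n * preciseVersion Ω u y i - kernelMass n * preciseVersion Ω u y' i| := by
    rw [← mul_sub, abs_mul, abs_of_pos hmass]
  have hglue := abs_sub_le_of_le_mul_dist (Z := {z | preciseVersion Ω u z = 0})
    (f := fun q => kernelMass n * preciseVersion Ω u q i) (y := y) (y' := y') ⟨x, hx0⟩
    (by positivity) (by positivity)
    (mul_nonneg hmass.le (h.preciseVersion_nonneg i (hsub hy)))
    (mul_nonneg hmass.le (h.preciseVersion_nonneg i (hsub hy')))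
    (fun z hz => h.preciseVersion_le_mul_dist i hε hx hx0 hz hy)
    (fun z hz => h.preciseVersion_le_mul_dist i hε hx hx0 hz hy')
    (fun hinf hyy' => hmul.symm.trans_le
      (h.abs_preciseVersion_sub_le_of_infDist hL i hε hx hx0 hy hinf hyy'))
  rw [hmul]
  refine hglue.trans_eq ?_
  ring

end IsMinimizerWithin

theorem exists_lipschitz_constant (n m : ℕ) : ∃ C : ℝ, 0 < C ∧
    ∀ {Ω : Set (E n)} {Q : E n → ℝ} {Qmax ε : ℝ} {g u : E n → E m} {x : E n} {r : ℝ},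
      IsMinimizerWithin Ω Q Qmax g u ε → competitorDistance n Qmax r < ε →
      Metric.ball x r ⊆ Ω → preciseVersion Ω u x = 0 →
      lipSeminorm (preciseVersion Ω u) (Metric.ball x (r / 3)) ≤ ENNReal.ofReal (C * Qmax) := by
  obtain ⟨L, hL⟩ := exists_lipschitzWith_kernel n
  have hmass := kernelMass_pos n
  have hgrowth := growthConstant_pos n
  set D := (5 * (1280 * 5 ^ n) + 64 * 80 ^ (n + 1) * L) * growthConstant n / kernelMass n with hD
  have : 0 < D := by positivity
  refine ⟨Real.sqrt m * D + 1, by positivity, fun {Ω Q Qmax ε g u x r} h hε hx hx0 => ?_⟩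
  have hQ := h.pos
  refine lipSeminorm_le (by positivity) fun y hy y' hy' => ?_
  have hcoord : ∀ i, |(preciseVersion Ω u y - preciseVersion Ω u y') i|
      ≤ D * Qmax * dist y y' := fun i => by
    rw [hD, div_mul_eq_mul_div, div_mul_eq_mul_div, le_div_iff₀' hmass]
    exact h.abs_preciseVersion_sub_le hL i hε hx hx0 hy hy'
  calc dist (preciseVersion Ω u y) (preciseVersion Ω u y')
      ≤ Real.sqrt m * (D * Qmax * dist y y') := by
        rw [dist_eq_norm]
        exact norm_le_sqrt_mul_of_abs_le (by positivity) hcoord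
    _ ≤ (Real.sqrt m * D + 1) * Qmax * dist y y' := by
        linarith [mul_nonneg hQ.le (dist_nonneg (x := y) (y := y'))]

end Lipschitz

section Minimizers

variable {Ω : Set (E n)} {Q : E n → ℝ} {Qmin Qmax ε : ℝ} {g u : E n → E m}

theorem ae_abs_le_of_bounds (hQmin : 0 < Qmin)
    (hQ : ∀ᵐ x ∂volume.restrict Ω, Qmin ≤ Q x ∧ Q x ≤ Qmax) :
    ∀ᵐ x ∂volume.restrict Ω, |Q x| ≤ Qmax := by
  filter_upwards [hQ] with x hx
  rw [abs_of_pos (hQmin.trans_le hx.1)]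
  exact hx.2

theorem IsAbsoluteMinimizer.isMinimizerWithin (h : IsAbsoluteMinimizer Ω Q g u) (hΩ : IsOpen Ω)
    (hb : Bornology.IsBounded Ω) (hQm : AEMeasurable Q (volume.restrict Ω)) (hpos : 0 < Qmax)
    (hQ : ∀ᵐ x ∂volume.restrict Ω, |Q x| ≤ Qmax) (hε : 0 < ε) :
    IsMinimizerWithin Ω Q Qmax g u ε :=
  ⟨hΩ, hb, hQm, hpos, hQ, h.1, hε, fun v hv _ => h.2 v hv⟩

theorem IsLocalMinimizer.exists_isMinimizerWithin (h : IsLocalMinimizer Ω Q g u) (hΩ : IsOpen Ω)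
    (hb : Bornology.IsBounded Ω) (hQm : AEMeasurable Q (volume.restrict Ω)) (hpos : 0 < Qmax)
    (hQ : ∀ᵐ x ∂volume.restrict Ω, |Q x| ≤ Qmax) :
    ∃ ε, IsMinimizerWithin Ω Q Qmax g u ε :=
  let ⟨hA, ε, hε, hle⟩ := h
  ⟨ε, hΩ, hb, hQm, hpos, hQ, hA, hε, hle⟩

theorem isPreciseVersion_self_of_subsingleton [Subsingleton (E n)] (Ω : Set (E n))
    (u : E n → E m) : IsPreciseVersion Ω u u := by
  refine ⟨Filter.EventuallyEq.rfl, fun x _ => tendsto_const_nhds.congr' ?_⟩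
  filter_upwards [self_mem_nhdsWithin] with ρ hρ
  have hu : u = fun _ => u x := funext fun y => congrArg u (Subsingleton.elim y x)
  rw [hu]
  exact (setAverage_const (Metric.measure_ball_pos volume x hρ).ne' measure_ball_lt_top.ne _).symm

theorem lipSeminorm_of_subsingleton [Subsingleton (E n)] (w : E n → E m) (s : Set (E n)) :
    lipSeminorm w s = 0 := by
  refine le_antisymm (iSup₂_le fun y _ => iSup₂_le fun z _ => ?_) bot_le
  rw [Subsingleton.elim y z]
  simp

end Minimizers

end BernoulliSystem

end

open BernoulliSystem in
theorem mainTheorem3_general (n m : ℕ) :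
    ∃ C : ℝ, 0 < C ∧
      ∀ (Ω : Set (E n)) (Q : E n → ℝ) (Qmax : ℝ) (g u : E n → E m),
        IsOpen Ω → Bornology.IsBounded Ω → AEMeasurable Q (volume.restrict Ω) → 0 < Qmax →
        (∀ᵐ x ∂volume.restrict Ω, |Q x| ≤ Qmax) →
        (IsAbsoluteMinimizer Ω Q g u →
          ∃ w : E n → E m, IsPreciseVersion Ω u w ∧
            ∀ (x : E n) (r : ℝ), 0 < r → Metric.ball x r ⊆ Ω → w x = 0 →
              lipSeminorm w (Metric.ball x (r / 3)) ≤ ENNReal.ofReal (C * Qmax)) ∧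
        (IsLocalMinimizer Ω Q g u →
          ∃ w : E n → E m, IsPreciseVersion Ω u w ∧
            ∃ r₀ : ℝ, 0 < r₀ ∧
              ∀ (x : E n) (r : ℝ), 0 < r → r ≤ r₀ → Metric.ball x r ⊆ Ω → w x = 0 →
                lipSeminorm w (Metric.ball x (r / 3)) ≤ ENNReal.ofReal (C * Qmax)) := by
  rcases eq_or_ne n 0 with rfl | hn
  · exact ⟨1, one_pos, fun Ω Q Qmax g u _ _ _ _ _ =>
      ⟨fun _ => ⟨u, isPreciseVersion_self_of_subsingleton Ω u, fun x r _ _ _ =>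
        (lipSeminorm_of_subsingleton u _).trans_le bot_le⟩,
      fun _ => ⟨u, isPreciseVersion_self_of_subsingleton Ω u, 1, one_pos, fun x r _ _ _ _ =>
        (lipSeminorm_of_subsingleton u _).trans_le bot_le⟩⟩⟩
  obtain ⟨C, hC, hlip⟩ := exists_lipschitz_constant n m
  refine ⟨C, hC, fun Ω Q Qmax g u hΩ hb hQm hpos hQ => ⟨fun h => ?_, fun h => ?_⟩⟩
  · have hmin : ∀ {ε}, 0 < ε → IsMinimizerWithin Ω Q Qmax g u ε :=
      h.isMinimizerWithin hΩ hb hQm hpos hQ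
    refine ⟨preciseVersion Ω u, (hmin one_pos).isPreciseVersion hn, fun x r hr hx hx0 => ?_⟩
    have hd := competitorDistance_nonneg n Qmax hr.le
    exact hlip (hmin (by linarith)) (lt_add_one (competitorDistance n Qmax r)) hx hx0
  · obtain ⟨ε, hmin⟩ := h.exists_isMinimizerWithin hΩ hb hQm hpos hQ
    obtain ⟨r₀, hr₀, hd⟩ := exists_competitorDistance_lt hn Qmax hmin.eps_pos
    exact ⟨preciseVersion Ω u, hmin.isPreciseVersion hn, r₀, hr₀, fun x r hr hrr₀ hx hx0 =>
      hlip hmin ((competitorDistance_mono n Qmax hr.le hrr₀).trans_lt hd) hx hx0⟩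

theorem mainTheorem3 (n m : ℕ) :
    ∃ C : ℝ, 0 < C ∧
      ∀ (Ω : Set (BernoulliSystem.E n)) (Q : BernoulliSystem.E n → ℝ) (Qmin Qmax : ℝ)
        (g u : BernoulliSystem.E n → BernoulliSystem.E m),
        IsOpen Ω → IsConnected Ω → Bornology.IsBounded Ω →
        AEMeasurable Q (volume.restrict Ω) →
        0 < Qmin → Qmin ≤ Qmax →
        (∀ᵐ x ∂volume.restrict Ω, Qmin ≤ Q x ∧ Q x ≤ Qmax) →
        BernoulliSystem.MemH1Vec Ω g →
        (∀ i : Fin m, ∀ᵐ x ∂volume.restrict Ω, 0 ≤ g x i) →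
        (BernoulliSystem.IsAbsoluteMinimizer Ω Q g u →
          ∃ w : BernoulliSystem.E n → BernoulliSystem.E m,
            BernoulliSystem.IsPreciseVersion Ω u w ∧
            ∀ (x : BernoulliSystem.E n) (r : ℝ), 0 < r → Metric.ball x r ⊆ Ω → w x = 0 →
              BernoulliSystem.lipSeminorm w (Metric.ball x (r / 3)) ≤
                ENNReal.ofReal (C * Qmax)) ∧
        (BernoulliSystem.IsLocalMinimizer Ω Q g u →
          ∃ w : BernoulliSystem.E n → BernoulliSystem.E m,
            BernoulliSystem.IsPreciseVersion Ω u w ∧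
            ∃ r₀ : ℝ, 0 < r₀ ∧
              ∀ (x : BernoulliSystem.E n) (r : ℝ), 0 < r → r ≤ r₀ →
                Metric.ball x r ⊆ Ω → w x = 0 →
                BernoulliSystem.lipSeminorm w (Metric.ball x (r / 3)) ≤
                  ENNReal.ofReal (C * Qmax)) := by
  obtain ⟨C, hC, hmin⟩ := mainTheorem3_general n m
  exact ⟨C, hC, fun Ω Q Qmin Qmax g u hΩ _ hb hQm hQmin hle hQ _ _ =>
    hmin Ω Q Qmax g u hΩ hb hQm (hQmin.trans_le hle) (BernoulliSystem.ae_abs_le_of_bounds hQmin hQ)⟩
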